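/- Let $d\in\{1,2,3\}$, let $\beta_{\uparrow\uparrow},\beta_{\downarrow\downarrow},\beta_{\uparrow\downarrow}\in\mathbb R$, $\nu\in(0,1)$, and let $V_\uparrow,V_\downarrow:\mathbb R^d\to[0,\infty)$ be locally integrable with $V_j(x)\to+\infty$ as $|x|\to\infty$. For $\Phi=(\phi_\uparrow,\phi_\downarrow)$, $\phi_j:\mathbb R^d\to\mathbb C$, put $$E_0(\Phi)=\int_{\mathbb R^d}\Big[\sum_{j=\uparrow,\downarrow}\big(\tfrac12|\nabla\phi_j|^2+V_j|\phi_j|^2\big)+\tfrac12\beta_{\uparrow\uparrow}|\phi_\uparrow|^4+\tfrac12\beta_{\downarrow\downarrow}|\phi_\downarrow|^4+\beta_{\uparrow\downarrow}|\phi_\uparrow|^2|\phi_\downarrow|^2\Big]dx$$ and let $S_\nu$ be the set of $\Phi$ with $\phi_j\in H^1(\mathbb R^d)$, $\int V_j|\phi_j|^2<\infty$ ($j=\uparrow,\downarrow$), $\|\phi_\uparrow\|_{L^2}^2=\nu$ and $\|\phi_\downarrow\|_{L^2}^2=1-\nu$. A ground state is a minimizer of $E_0$ on $S_\nu$. Let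 $B=\begin{pmatrix}\beta_{\uparrow\uparrow}&\beta_{\uparrow\downarrow}\\ \beta_{\uparrow\downarrow}&\beta_{\downarrow\downarrow}\end{pmatrix}$, call $B$ nonnegative if its entries are $\ge0$, and put $$\beta'_{\uparrow\uparrow}=\nu\beta_{\uparrow\uparrow},\quad \beta'_{\downarrow\downarrow}=(1-\nu)\beta_{\downarrow\downarrow},\quad \beta'_{\uparrow\downarrow}=\sqrt{\nu'}\,\beta_{\uparrow\downarrow},\quad \nu'=\nu(1-\nu),\qquad C_b=\inf_{0\ne f\in H^1(\mathbb R^2)}\frac{\|\nabla f\|_{L^2}^2\|f\|_{L^2}^2}{\|f\|_{L^4}^4}.$$ Suppose that one of the following holds: (i) $d=1$; (ii) $d=2$, $\beta'_{\uparrow\uparrow}>-C_b$, $\beta'_{\downarrow\downarrow}>-C_b$, $\beta'_{\uparrow\downarrow}\ge-\sqrt{(C_b+\beta'_{\uparrow\uparrow})(C_b+\beta'_{\downarrow\downarrow})}$, and $\beta'_{\uparrow\downarrow}>-\frac1{2\sqrt{\nu'}}\big(\nu\beta'_{\uparrow\uparrow}+(1-\nu)\beta'_{\downarrow\downarrow}+C_b\big)$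 (given the other conditions, the last one fails only if $\beta'_{\uparrow\downarrow}=-\sqrt{(C_b+\beta'_{\uparrow\uparrow})(C_b+\beta'_{\downarrow\downarrow})}$ and $\nu(C_b+\beta'_{\uparrow\uparrow})=(1-\nu)(C_b+\beta'_{\downarrow\downarrow})$); (iii) $d=3$ and $B$ is positive semi-definite or nonnegative. Then a ground state exists. If $(\phi_\uparrow,\phi_\downarrow)$ is a ground state, then so is $(e^{i\theta_\uparrow}|\phi_\uparrow|,e^{i\theta_\downarrow}|\phi_\downarrow|)$ for all real constants $\theta_\uparrow,\theta_\downarrow$. If, moreover, $B$ is positive semi-definite, then the ground state of the form $(|\phi_\uparrow|,|\phi_\downarrow|)$ is unique: any two ground states have almost everywhere equal moduli $|\phi_\uparrow|$ and $|\phi_\downarrow|$. In contrast, no ground state exists if one of the following holds: (i)$'$ $d=2$ and ($\beta'_{\uparrow\uparrow}\le-C_b$, or $\beta'_{\downarrow\downarrow}\le-C_b$, or $\beta'_{\uparrow\downarrow}<-\frac1{2\sqrt{\nu'}}\big(\nu\beta'_{\uparrow\uparrow}+(1-\nu)\beta'_{\downarrow\downarrow}+C_b\big)$); (ii)$'$ $d=3$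 and ($\beta_{\uparrow\uparrow}<0$, or $\beta_{\downarrow\downarrow}<0$, or $\beta_{\uparrow\downarrow}<-\frac1{2\nu'}\big(\nu^2\beta_{\uparrow\uparrow}+(1-\nu)^2\beta_{\downarrow\downarrow}\big)$). -/

import Mathlib

open MeasureTheory Filter Topology
open scoped ContDiff

noncomputable section

namespace TwoComponentBEC

/-- `ℝ^d` with the Euclidean norm. -/
abbrev Space (d : ℕ) : Type := EuclideanSpace ℝ (Fin d)

/-- `g` is the weak (distributional) partial derivative `∂_i f`, tested against smooth compactly
supported functions. -/
def IsWeakPartial {d : ℕ} (i : Fin d) (f g : Space d → ℂ) : Prop :=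
  ∀ η : Space d → ℝ, ContDiff ℝ ∞ η → HasCompactSupport η →
    ∫ x, f x * ((fderiv ℝ η x (EuclideanSpace.single i 1) : ℝ) : ℂ) = -∫ x, g x * ((η x : ℝ) : ℂ)

/-- `f ∈ H¹(ℝ^d; ℂ)`: `f` and its weak first partial derivatives are square integrable. -/
def MemH1 {d : ℕ} (f : Space d → ℂ) : Prop :=
  MemLp f 2 volume ∧ ∀ i : Fin d, ∃ g : Space d → ℂ, MemLp g 2 volume ∧ IsWeakPartial i f g

open Classical in
/-- The square integrable weak partial derivative `∂_i f` (unique up to null sets), when there is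
one. -/
def weakPartial {d : ℕ} (i : Fin d) (f : Space d → ℂ) : Space d → ℂ :=
  if h : ∃ g : Space d → ℂ, MemLp g 2 volume ∧ IsWeakPartial i f g then h.choose else 0

/-- `|∇f|²`. -/
def gradSq {d : ℕ} (f : Space d → ℂ) (x : Space d) : ℝ :=
  ∑ i : Fin d, ‖weakPartial i f x‖ ^ 2

/-- The best constant `C_b` of the Gagliardo–Nirenberg inequality in `ℝ²`: the infimum of
`‖∇f‖₂² ‖f‖₂² / ‖f‖₄⁴` over `0 ≠ f ∈ H¹(ℝ²)`. -/
def bestConst : ℝ :=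
  sInf {r : ℝ | ∃ f : Space 2 → ℂ, MemH1 f ∧ ¬ f =ᵐ[volume] 0 ∧
    r = (∫ x, gradSq f x) * (∫ x, ‖f x‖ ^ 2) / ∫ x, ‖f x‖ ^ 4}

/-- The energy `E₀(φ↑, φ↓)` for `Ω = δ = 0`. -/
def energy {d : ℕ} (Vu Vd : Space d → ℝ) (βuu βud βdd : ℝ) (Φ : (Space d → ℂ) × (Space d → ℂ)) :
    ℝ :=
  ∫ x, (((1 / 2) * gradSq Φ.1 x + Vu x * ‖Φ.1 x‖ ^ 2)
      + ((1 / 2) * gradSq Φ.2 x + Vd x * ‖Φ.2 x‖ ^ 2)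
      + (1 / 2) * βuu * ‖Φ.1 x‖ ^ 4 + (1 / 2) * βdd * ‖Φ.2 x‖ ^ 4
      + βud * (‖Φ.1 x‖ ^ 2 * ‖Φ.2 x‖ ^ 2))

/-- The constraint set `S_ν`: component masses `ν` and `1 - ν` and finite energy. Finite energy
means that the kinetic and the potential energies are finite; for `d ≤ 3` the quartic terms are
then finite since `H¹ ⊂ L⁴`. -/
def admissible {d : ℕ} (Vu Vd : Space d → ℝ) (ν : ℝ) : Set ((Space d → ℂ) × (Space d → ℂ)) :=
  {Φ | MemH1 Φ.1 ∧ MemH1 Φ.2 ∧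
    Integrable (fun x => Vu x * ‖Φ.1 x‖ ^ 2) ∧ Integrable (fun x => Vd x * ‖Φ.2 x‖ ^ 2) ∧
    ∫ x, ‖Φ.1 x‖ ^ 2 = ν ∧ ∫ x, ‖Φ.2 x‖ ^ 2 = 1 - ν}

/-- A ground state: a minimizer of the energy `E₀` on `S_ν`. -/
def IsGroundState {d : ℕ} (Vu Vd : Space d → ℝ) (βuu βud βdd ν : ℝ)
    (Φ : (Space d → ℂ) × (Space d → ℂ)) : Prop :=
  Φ ∈ admissible Vu Vd ν ∧
    ∀ Ψ ∈ admissible Vu Vd ν, energy Vu Vd βuu βud βdd Φ ≤ energy Vu Vd βuu βud βdd Ψ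

/-- `(e^{iθ↑} |φ↑|, e^{iθ↓} |φ↓|)`. -/
def phaseModulus {d : ℕ} (θu θd : ℝ) (Φ : (Space d → ℂ) × (Space d → ℂ)) :
    (Space d → ℂ) × (Space d → ℂ) :=
  (fun x => Complex.exp (θu * Complex.I) * (‖Φ.1 x‖ : ℂ),
   fun x => Complex.exp (θd * Complex.I) * (‖Φ.2 x‖ : ℂ))

/-- The interaction matrix `B`. -/
def interactionMatrix (βuu βud βdd : ℝ) : Matrix (Fin 2) (Fin 2) ℝ :=
  !![βuu, βud; βud, βdd]

/-- The conditions for existence. The strengths `β'↑↑ = ν β↑↑`, `β'↓↓ = (1 - ν) β↓↓`,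
`β'↑↓ = √(ν(1 - ν)) β↑↓` are written out. The last condition for `d = 2` follows from the
one before it, with `≤` in place of `<`; it only excludes the coincidence of both boundaries. -/
def ExistenceCondition (d : ℕ) (βuu βud βdd ν : ℝ) : Prop :=
  d = 1 ∨
  (d = 2 ∧ -bestConst < ν * βuu ∧ -bestConst < (1 - ν) * βdd ∧
    -√((bestConst + ν * βuu) * (bestConst + (1 - ν) * βdd)) ≤ √(ν * (1 - ν)) * βud ∧
    -(1 / (2 * √(ν * (1 - ν)))) * (ν * (ν * βuu) + (1 - ν) * ((1 - ν) * βdd) + bestConst)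
      < √(ν * (1 - ν)) * βud) ∨
  (d = 3 ∧ ((interactionMatrix βuu βud βdd).PosSemidef ∨ (0 ≤ βuu ∧ 0 ≤ βud ∧ 0 ≤ βdd)))

/-- The conditions for nonexistence. -/
def NonexistenceCondition (d : ℕ) (βuu βud βdd ν : ℝ) : Prop :=
  (d = 2 ∧ (ν * βuu ≤ -bestConst ∨ (1 - ν) * βdd ≤ -bestConst ∨
    √(ν * (1 - ν)) * βud <
      -(1 / (2 * √(ν * (1 - ν)))) *
        (ν * (ν * βuu) + (1 - ν) * ((1 - ν) * βdd) + bestConst))) ∨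
  (d = 3 ∧ (βuu < 0 ∨ βdd < 0 ∨
    βud < -(1 / (2 * (ν * (1 - ν)))) * (ν ^ 2 * βuu + (1 - ν) ^ 2 * βdd)))

end TwoComponentBEC

end

/-! Kinetic energies are handled through increments. A real L² function u lies in H¹ as soon as ∫
(u(x + h e_i) - u(x))² ≤ C_i h² for all h and i, and the squared norm of ∂_i u is the limit of these
integrals divided by h² (`memH1_toC`, `MemH1.tendsto_diff`). A pointwise inequality between
increments is then an inequality between kinetic energies, so moduli, truncations and √(a u² + b v²)
need no chain rule. Moduli do not raise the energy and constant phases do not change it, so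
everything reduces to real pairs (`isMin_norm_of_isGroundState`, `isGroundState_of_isMin`).

Existence is the direct method (`exists_isMin`): the trap gives L² compactness, Gagliardo–Nirenberg
makes the quartic terms continuous, the other terms are lower semicontinuous. What remains is that
bounded energy bounds the quartic terms. For d = 1 the kinetic energy dominates them; for d = 3 the
interaction is pointwise nonnegative. For d = 2 the kinetic energy is worth C_b/ν ∫ u⁴ + C_b/(1-ν) ∫
v⁴, which leaves a quadratic form in the densities. If it is positive definite on the quadrant, the
bound is immediate. On the boundary it is the square of a linear combination of u² and v², so the
densities are nearly proportional, but with a ratio incompatible with their masses; a large quartic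
term would then beat the sharp Gagliardo–Nirenberg inequality after truncation
(`quartic_bound_of_mass_gap`).

Uniqueness: the kinetic energy is convex in the density, so comparison with the midpoint of the
densities of two minimizers shows that the densities differ by a null vector of B. Both first
components thus see the same mean field and minimize the same linear Schrödinger form
(`IsMin.linear_le`), whose nonnegative minimizer is unique (`ae_eq_of_linear_min`). The strong
maximum principle behind this uses no regularity: changing f to √(f² + ε² η²) costs O(ε²), which
forces the indicator of {f > 0} to have a locally square integrable gradient, hence to be constant.

Nonexistence: varying one component of a minimizer, or both with a common profile, bounds ½ (∫ |∇g|²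
+ β ∫ g⁴) + ∫ W g² from below over test functions g of mass one (`LowerBound`). Concentrating g
violates this if β < 0 for d = 3 or β < -C_b for d = 2. At β = -C_b, functions of arbitrarily small
support and small absolute deficit (`exists_isTrial_deficit_le`) show that W is bounded below by
exactly the value per unit mass that u attains. Then u optimizes Gagliardo–Nirenberg, is positive,
and W is constant, which a trapping potential forbids (`IsMin.ne_critical`). -/

namespace TwoComponentBEC
noncomputable section
variable {d : ℕ}


/-! ### Real L² as a Hilbert space, in terms of integrals. -/

section L2

variable {α : Type*} [MeasurableSpace α] {μ : Measure α}

theorem norm_toLp_two {u : α → ℝ} (hu : MemLp u 2 μ) : ‖hu.toLp u‖ = √(∫ x, u x ^ 2 ∂μ) := by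
  symm
  rw [Real.sqrt_eq_iff_eq_sq (integral_nonneg fun x => sq_nonneg _) (norm_nonneg _),
    ← real_inner_self_eq_norm_sq, L2.inner_def]
  refine integral_congr_ae ?_
  filter_upwards [hu.coeFn_toLp] with x h1
  rw [h1]; simp [sq]

theorem inner_toLp_two {u v : α → ℝ} (hu : MemLp u 2 μ) (hv : MemLp v 2 μ) :
    inner ℝ (hu.toLp u) (hv.toLp v) = ∫ x, u x * v x ∂μ := by
  rw [L2.inner_def]
  refine integral_congr_ae ?_
  filter_upwards [hu.coeFn_toLp, hv.coeFn_toLp] with x h1 h2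
  rw [h1, h2]; simp [mul_comm]

theorem abs_integral_mul_le {u v : α → ℝ} (hu : MemLp u 2 μ) (hv : MemLp v 2 μ) :
    |∫ x, u x * v x ∂μ| ≤ √(∫ x, u x ^ 2 ∂μ) * √(∫ x, v x ^ 2 ∂μ) := by
  rw [← inner_toLp_two hu hv, ← norm_toLp_two hu, ← norm_toLp_two hv]
  exact abs_real_inner_le_norm _ _

theorem sqrt_integral_add_sq_le {u v : α → ℝ} (hu : MemLp u 2 μ) (hv : MemLp v 2 μ) :
    √(∫ x, (u x + v x) ^ 2 ∂μ) ≤ √(∫ x, u x ^ 2 ∂μ) + √(∫ x, v x ^ 2 ∂μ) := by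
  have h := norm_add_le (hu.toLp u) (hv.toLp v)
  rw [← MemLp.toLp_add, norm_toLp_two hu, norm_toLp_two hv, norm_toLp_two (hu.add hv)] at h
  exact h

theorem integral_add_sq_le {u v : α → ℝ} (hu : MemLp u 2 μ) (hv : MemLp v 2 μ) :
    ∫ x, (u x + v x) ^ 2 ∂μ ≤ (√(∫ x, u x ^ 2 ∂μ) + √(∫ x, v x ^ 2 ∂μ)) ^ 2 := by
  have h := sqrt_integral_add_sq_le hu hv
  rwa [Real.sqrt_le_left (by positivity)] at h

theorem sqrt_integral_sub_sq_le {u v : α → ℝ} (hu : MemLp u 2 μ) (hv : MemLp v 2 μ) :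
    √(∫ x, (u x - v x) ^ 2 ∂μ) ≤ √(∫ x, u x ^ 2 ∂μ) + √(∫ x, v x ^ 2 ∂μ) := by
  simpa [sub_eq_add_neg] using sqrt_integral_add_sq_le hu hv.neg

theorem abs_sqrt_integral_sq_sub_le {u v : α → ℝ} (hu : MemLp u 2 μ) (hv : MemLp v 2 μ) :
    |√(∫ x, u x ^ 2 ∂μ) - √(∫ x, v x ^ 2 ∂μ)| ≤ √(∫ x, (u x - v x) ^ 2 ∂μ) := by
  have h := abs_norm_sub_norm_le (hu.toLp u) (hv.toLp v)
  rw [← MemLp.toLp_sub, norm_toLp_two hu, norm_toLp_two hv, norm_toLp_two (hu.sub hv)] at h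
  exact h

theorem integrable_mul_of_memLp_two {u v : α → ℝ} (hu : MemLp u 2 μ) (hv : MemLp v 2 μ) :
    Integrable (fun x => u x * v x) μ := hu.integrable_mul hv

/-- Weak lower semicontinuity of the norm: ‖g‖² = lim ⟨u n, g⟩ ≤ √C ‖g‖, so pairing with the limit
`g` alone is enough. -/
theorem integral_sq_le_of_forall_weak {u : ℕ → α → ℝ} {g : α → ℝ} (hu : ∀ n, MemLp (u n) 2 μ)
    (hg : MemLp g 2 μ) {C : ℝ} (hC : ∀ n, ∫ x, u n x ^ 2 ∂μ ≤ C)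
    (hlim : Tendsto (fun n => ∫ x, u n x * g x ∂μ) atTop (𝓝 (∫ x, g x * g x ∂μ))) :
    ∫ x, g x ^ 2 ∂μ ≤ C := by
  have hC0 : 0 ≤ C := le_trans (integral_nonneg fun x => sq_nonneg _) (hC 0)
  have h0 : 0 ≤ ∫ x, g x ^ 2 ∂μ := integral_nonneg fun x => sq_nonneg _
  have h1 : ∫ x, g x * g x ∂μ ≤ √C * √(∫ x, g x ^ 2 ∂μ) := by
    refine le_of_tendsto' hlim fun n => (le_abs_self _).trans ?_
    refine (abs_integral_mul_le (hu n) hg).trans ?_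
    gcongr
    exact hC n
  simp_rw [← sq] at h1
  have h2 := Real.mul_self_sqrt h0
  have h3 := Real.mul_self_sqrt hC0
  by_contra! hlt
  have h4 : √C < √(∫ x, g x ^ 2 ∂μ) := Real.sqrt_lt_sqrt hC0 hlt
  nlinarith [Real.sqrt_nonneg C]

end L2
-- Weak compactness, translations and weak derivatives of real functions.
theorem exists_weak_subseq {u : ℕ → Space d → ℝ} (hu : ∀ n, MemLp (u n) 2 volume) {C : ℝ}
    (hC : ∀ n, ∫ x, u n x ^ 2 ≤ C) :
    ∃ g : Space d → ℝ, MemLp g 2 volume ∧ ∃ φ : ℕ → ℕ, StrictMono φ ∧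
      ∀ w : Space d → ℝ, MemLp w 2 volume →
        Tendsto (fun n => ∫ x, u (φ n) x * w x) atTop (𝓝 (∫ x, g x * w x)) := by
  -- A finite exponent makes `Lp` separable, which sequential Banach–Alaoglu in the dual needs;
  -- Riesz representation brings the limit back to L².
  have : Fact ((2 : ENNReal) ≠ ⊤) := ⟨by simp⟩
  let T := InnerProductSpace.toDual ℝ (Lp ℝ 2 (volume : Measure (Space d)))
  have hb : ∀ n, StrongDual.toWeakDual (T ((hu n).toLp (u n))) ∈
      WeakDual.toStrongDual ⁻¹' Metric.closedBall 0 √C := by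
    intro n
    simp only [Set.mem_preimage, Metric.mem_closedBall, dist_zero_right]
    change ‖T ((hu n).toLp (u n))‖ ≤ √C
    rw [LinearIsometryEquiv.norm_map]
    rw [norm_toLp_two]
    exact Real.sqrt_le_sqrt (hC n)
  obtain ⟨G, -, φ, hφ, hlim⟩ := WeakDual.isSeqCompact_closedBall ℝ _ 0 √C hb
  obtain ⟨g', hg'⟩ := T.surjective (WeakDual.toStrongDual G)
  refine ⟨g', Lp.memLp g', φ, hφ, fun w hw => ?_⟩
  have h1 := ((WeakDual.eval_continuous (hw.toLp w)).tendsto G).comp hlim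
  have h2 : G (hw.toLp w) = ∫ x, g' x * w x := by
    have : G (hw.toLp w) = T g' (hw.toLp w) := by rw [hg']; rfl
    rw [this]
    have := inner_toLp_two (Lp.memLp g') hw
    rw [Lp.toLp_coeFn] at this
    exact this
  rw [← h2]
  refine h1.congr fun n => ?_
  exact inner_toLp_two (hu (φ n)) hw

theorem memLp_comp_add {F : Type*} [NormedAddCommGroup F] {f : Space d → F} {p : ENNReal}
    (hf : MemLp f p volume) (v : Space d) : MemLp (fun x => f (x + v)) p volume :=
  hf.comp_measurePreserving (measurePreserving_add_right volume v)

theorem memLp_of_contDiff {F : Type*} [NormedAddCommGroup F] [NormedSpace ℝ F] {η : Space d → F}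
    (hη : ContDiff ℝ ∞ η) (hc : HasCompactSupport η) (p : ENNReal) : MemLp η p volume :=
  hη.continuous.memLp_of_hasCompactSupport hc

/-- A function in `L²` is controlled by its pairings with test functions. -/
theorem integral_sq_le_of_forall_test {F : Space d → ℝ} (hF : MemLp F 2 volume) {M : ℝ}
    (h : ∀ η : Space d → ℝ, ContDiff ℝ ∞ η → HasCompactSupport η →
      |∫ x, F x * η x| ≤ M * √(∫ x, η x ^ 2)) : ∫ x, F x ^ 2 ≤ M ^ 2 := by
  have h0 : 0 ≤ ∫ x, F x ^ 2 := integral_nonneg fun x => sq_nonneg _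
  set A := √(∫ x, F x ^ 2) with hA
  have hA0 : 0 ≤ A := Real.sqrt_nonneg _
  have hAA : A * A = ∫ x, F x ^ 2 := Real.mul_self_sqrt h0
  -- The sign of `M` is free. A negative `M` annihilates every pairing and so forces F = 0;
  -- otherwise F is approximated by test functions.
  by_cases hM : 0 ≤ M
  swap
  · have h1 : ∀ η : Space d → ℝ, ContDiff ℝ ∞ η → HasCompactSupport η →
        ∫ x, η x • F x = 0 := by
      intro η h1 h2
      have := h η h1 h2
      have h3 : |∫ x, F x * η x| ≤ 0 :=
        this.trans (mul_nonpos_of_nonpos_of_nonneg (by linarith) (Real.sqrt_nonneg _))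
      have h4 := abs_nonpos_iff.1 h3
      simpa [mul_comm] using h4
    have h2 := ae_eq_zero_of_integral_contDiff_smul_eq_zero
      (hF.locallyIntegrable (by norm_num)) h1
    have : ∫ x, F x ^ 2 = 0 := by
      rw [integral_congr_ae (g := fun _ => 0)]
      · simp
      · filter_upwards [h2] with x hx; simp [hx]
    rw [this]; positivity
  suffices A ≤ M by rw [← hAA]; nlinarith
  have key : ∀ ε > 0, A * A ≤ M * (A + ε) + A * ε := by
    intro ε hε
    obtain ⟨η, hc, hs, hle⟩ := hF.exist_eLpNorm_sub_le (by simp) (by simp) hε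
    have hη := memLp_of_contDiff hs hc 2
    have hd : √(∫ x, (F x - η x) ^ 2) ≤ ε := by
      have := norm_toLp_two (hF.sub hη)
      simp only [Pi.sub_apply] at this
      rw [← this, Lp.norm_toLp]
      exact ENNReal.toReal_le_of_le_ofReal hε.le hle
    have h1 : √(∫ x, η x ^ 2) ≤ A + ε := by
      have := abs_sqrt_integral_sq_sub_le hF hη
      have := (abs_le.1 this).1
      linarith
    have h2 := h η hs hc
    have h3 := abs_integral_mul_le hF (hF.sub hη)
    simp only [Pi.sub_apply] at h3
    have h4 : ∫ x, F x * (F x - η x) = A * A - ∫ x, F x * η x := by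
      rw [hAA, ← integral_sub hF.integrable_sq (integrable_mul_of_memLp_two hF hη)]
      congr 1; ext x; ring
    rw [h4] at h3
    have h5 := (abs_le.1 h2).2
    have h6 := (abs_le.1 h3).2
    have h7 : A * √(∫ x, (F x - η x) ^ 2) ≤ A * ε := by gcongr
    have h8 : M * √(∫ x, η x ^ 2) ≤ M * (A + ε) := by gcongr
    linarith
  have : A * A ≤ M * A := by
    refine le_of_forall_pos_le_add fun δ hδ => ?_
    have := key (δ / (M + A + 1)) (by positivity)
    have h9 : (M + A) * (δ / (M + A + 1)) ≤ δ := by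
      rw [← mul_div_assoc, div_le_iff₀ (by positivity)]; nlinarith
    nlinarith
  by_contra! hlt
  have : 0 < A := lt_of_le_of_lt hM hlt
  nlinarith

/-- Integration against a translated test function is differentiable in the translation. -/
theorem hasDerivAt_integral_test {f : Space d → ℝ} (hf : LocallyIntegrable f volume)
    {η : Space d → ℝ} (hη : ContDiff ℝ ∞ η) (hc : HasCompactSupport η) (v : Space d) (s : ℝ) :
    HasDerivAt (fun s : ℝ => ∫ x, f x * η (x - s • v))
      (-∫ x, f x * fderiv ℝ η (x - s • v) v) s := by
  have hη' : ContDiff ℝ ∞ (fun x => η (-x)) := hη.comp contDiff_neg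
  have hc' : HasCompactSupport (fun x => η (-x)) := hc.comp_homeomorph (Homeomorph.neg _)
  have h := HasCompactSupport.hasFDerivAt_convolution_right (μ := volume)
    (ContinuousLinearMap.mul ℝ ℝ) hc' hf (hη'.of_le (by simp)) (s • v)
  have h2 : HasDerivAt (fun s : ℝ => s • v) v s := by
    simpa using (hasDerivAt_id s).smul_const v
  have h3 := h.comp_hasDerivAt s h2
  rw [convolution_precompR_apply _ hf (hc'.fderiv ℝ) (hη'.continuous_fderiv (by simp))] at h3
  have e1 : (convolution f (fun x => η (-x)) (ContinuousLinearMap.mul ℝ ℝ) volume ∘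
      fun s : ℝ => s • v) = fun s : ℝ => ∫ x, f x * η (x - s • v) := by
    ext s
    simp [convolution_def]
  have e2 : convolution f (fun a => fderiv ℝ (fun x => η (-x)) a v) (ContinuousLinearMap.mul ℝ ℝ)
      volume (s • v) = -∫ x, f x * fderiv ℝ η (x - s • v) v := by
    simp only [convolution_def, ContinuousLinearMap.mul_apply']
    rw [← integral_neg]
    congr 1; ext x
    have h5 : HasFDerivAt (fun x => η (-x)) (-fderiv ℝ η (x - s • v)) (s • v - x) := by
      have h6 : HasFDerivAt η (fderiv ℝ η (x - s • v)) (-(s • v - x)) := by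
        rw [neg_sub]
        exact (hη.differentiable (by simp)).differentiableAt.hasFDerivAt
      have h7 := h6.comp (s • v - x) (hasFDerivAt_id (𝕜 := ℝ) (s • v - x)).neg
      have h8 : (fderiv ℝ η (x - s • v)).comp (-ContinuousLinearMap.id ℝ (Space d)) =
          -fderiv ℝ η (x - s • v) := by ext; simp
      rw [h8] at h7
      exact h7
    rw [h5.fderiv]
    simp
  rwa [e1, e2] at h3

/-- Translates of `f` are controlled by the norm of its weak derivative as a functional on test
functions. -/
theorem integral_translate_sub_sq_le_of_bound {f : Space d → ℝ} (hf : MemLp f 2 volume)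
    (v : Space d) {M : ℝ} (h : ∀ η : Space d → ℝ, ContDiff ℝ ∞ η → HasCompactSupport η →
      |∫ x, f x * fderiv ℝ η x v| ≤ M * √(∫ x, η x ^ 2)) :
    ∫ x, (f (x + v) - f x) ^ 2 ≤ M ^ 2 := by
  have hfl : LocallyIntegrable f volume := hf.locallyIntegrable (by norm_num)
  refine integral_sq_le_of_forall_test ((memLp_comp_add hf v).sub hf) fun η hη hc => ?_
  have hη2 := memLp_of_contDiff hη hc 2
  have e1 : ∫ x, (f (x + v) - f x) * η x = (∫ x, f x * η (x - v)) - ∫ x, f x * η x := by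
    rw [← integral_add_right_eq_self (fun x => f x * η (x - v)) v, ← integral_sub]
    · congr 1; ext x; simp; ring
    · simpa using integrable_mul_of_memLp_two (memLp_comp_add hf v) hη2
    · exact integrable_mul_of_memLp_two hf hη2
  have hshift : ∀ s : ℝ, ContDiff ℝ ∞ (fun x => η (x - s • v)) ∧
      HasCompactSupport (fun x => η (x - s • v)) := fun s =>
    ⟨hη.comp (contDiff_id.sub contDiff_const),
      hc.comp_homeomorph (Homeomorph.subRight (s • v))⟩
  have hb : ∀ s : ℝ, ‖-∫ x, f x * fderiv ℝ η (x - s • v) v‖ ≤ M * √(∫ x, η x ^ 2) := by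
    intro s
    have h2 := h _ (hshift s).1 (hshift s).2
    simp_rw [fderiv_comp_sub] at h2
    rwa [integral_sub_right_eq_self (fun x => η x ^ 2) (s • v), ← Real.norm_eq_abs,
      ← norm_neg] at h2
  -- Although `f` need not be differentiable, its pairing with the moving test function is; the mean
  -- value inequality on [0, 1] compares the translation by `v` with no translation.
  have := norm_image_sub_le_of_norm_deriv_le_segment_01' (C := M * √(∫ x, η x ^ 2))
    (fun s _ => (hasDerivAt_integral_test hfl hη hc v s).hasDerivWithinAt) (fun s _ => hb s)
  simp only [one_smul, zero_smul, sub_zero, Real.norm_eq_abs] at this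
  simpa only [Pi.sub_apply, e1] using this

theorem integral_translate_sub_sq_le {f g : Space d → ℝ} (hf : MemLp f 2 volume)
    (hg : MemLp g 2 volume) (v : Space d)
    (h : ∀ η : Space d → ℝ, ContDiff ℝ ∞ η → HasCompactSupport η →
      ∫ x, f x * fderiv ℝ η x v = -∫ x, g x * η x) :
    ∫ x, (f (x + v) - f x) ^ 2 ≤ ∫ x, g x ^ 2 := by
  rw [← Real.sq_sqrt (integral_nonneg fun x => sq_nonneg (g x) : 0 ≤ ∫ x, g x ^ 2)]
  refine integral_translate_sub_sq_le_of_bound hf v fun η hη hc => ?_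
  rw [h η hη hc, abs_neg]
  exact abs_integral_mul_le hg (memLp_of_contDiff hη hc 2)

/-- The derivative is a weak limit of the difference quotients, which a change of variables moves
onto the test function. A bound along one sequence of steps suffices; `MemH1.tendsto_diff` depends
on this when it argues along a subsequence. -/
theorem exists_weak_derivative {u : Space d → ℝ} (hu : MemLp u 2 volume) (v : Space d) {C : ℝ}
    {h : ℕ → ℝ} (hne : ∀ n, h n ≠ 0) (h0 : Tendsto h atTop (𝓝 0))
    (hC : ∀ n, ∫ x, (u (x + h n • v) - u x) ^ 2 ≤ C * h n ^ 2) :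
    ∃ g : Space d → ℝ, MemLp g 2 volume ∧ ∫ x, g x ^ 2 ≤ C ∧
      ∀ η : Space d → ℝ, ContDiff ℝ ∞ η → HasCompactSupport η →
        ∫ x, u x * fderiv ℝ η x v = -∫ x, g x * η x := by
  have hul : LocallyIntegrable u volume := hu.locallyIntegrable (by norm_num)
  set G : ℕ → Space d → ℝ := fun n x => (h n)⁻¹ * (u (x + h n • v) - u x) with hG
  have hGm : ∀ n, MemLp (G n) 2 volume := fun n =>
    ((memLp_comp_add hu (h n • v)).sub hu).const_mul _
  have hGC : ∀ n, ∫ x, G n x ^ 2 ≤ C := by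
    intro n
    simp only [hG, mul_pow]
    rw [integral_const_mul, inv_pow, inv_mul_le_iff₀ (by have := hne n; positivity), mul_comm]
    exact hC n
  obtain ⟨g, hg, φ, hφ, hlim⟩ := exists_weak_subseq hGm hGC
  refine ⟨g, hg, integral_sq_le_of_forall_weak (fun n => hGm (φ n)) hg (fun n => hGC (φ n))
    (hlim g hg), fun η hη hc => ?_⟩
  have hη2 := memLp_of_contDiff hη hc 2
  have h1 := hlim η hη2
  have h2 := (hasDerivAt_integral_test hul hη hc v 0).tendsto_slope
  have h3 : Tendsto (fun n => h (φ n)) atTop (𝓝[≠] 0) :=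
    tendsto_nhdsWithin_iff.2 ⟨h0.comp hφ.tendsto_atTop, Eventually.of_forall fun n => hne _⟩
  have h4 := h2.comp h3
  have h5 : ∀ n, ∫ x, G (φ n) x * η x =
      (slope (fun s : ℝ => ∫ x, u x * η (x - s • v)) 0 ∘ fun n => h (φ n)) n := by
    intro n
    simp only [Function.comp_apply, slope_def_field, hG, zero_smul, sub_zero]
    rw [← integral_add_right_eq_self (fun x => u x * η (x - h (φ n) • v)) (h (φ n) • v),
      ← integral_sub, div_eq_inv_mul, ← integral_const_mul]
    · congr 1; ext x; simp; ring
    · simpa using integrable_mul_of_memLp_two (memLp_comp_add hu (h (φ n) • v)) hη2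
    · exact integrable_mul_of_memLp_two hu hη2
  have h6 := tendsto_nhds_unique (h1.congr h5) h4
  simp only [zero_smul, sub_zero] at h6
  linarith

/-! ### H¹ characterized by difference quotients. -/

/-- A real function, regarded as a complex one. -/
abbrev toC (u : Space d → ℝ) : Space d → ℂ := fun x => (u x : ℂ)

/-- The squared `L²` norm of the `i`-th weak partial derivative. -/
def kin (i : Fin d) (f : Space d → ℂ) : ℝ := ∫ x, ‖weakPartial i f x‖ ^ 2

theorem kin_nonneg (i : Fin d) (f : Space d → ℂ) : 0 ≤ kin i f :=
  integral_nonneg fun _ => by positivity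

theorem MemH1.weakPartial_spec {f : Space d → ℂ} (hf : MemH1 f) (i : Fin d) :
    MemLp (weakPartial i f) 2 volume ∧ IsWeakPartial i f (weakPartial i f) := by
  unfold weakPartial
  rw [dif_pos (hf.2 i)]
  exact (hf.2 i).choose_spec

theorem weakPartial_ae_eq {i : Fin d} {f g : Space d → ℂ} (hg : MemLp g 2 volume)
    (h : IsWeakPartial i f g) : weakPartial i f =ᵐ[volume] g := by
  have hex : ∃ g : Space d → ℂ, MemLp g 2 volume ∧ IsWeakPartial i f g := ⟨g, hg, h⟩
  have hs : MemLp (weakPartial i f) 2 volume ∧ IsWeakPartial i f (weakPartial i f) := by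
    unfold weakPartial
    rw [dif_pos hex]
    exact hex.choose_spec
  refine ae_eq_of_integral_contDiff_smul_eq (hs.1.locallyIntegrable (by norm_num))
    (hg.locallyIntegrable (by norm_num)) fun η hη hc => ?_
  have h1 := hs.2 η hη hc
  have h2 := h η hη hc
  rw [h1, neg_inj] at h2
  simpa [mul_comm] using h2

theorem kin_eq_of_isWeakPartial {i : Fin d} {f g : Space d → ℂ} (hg : MemLp g 2 volume)
    (h : IsWeakPartial i f g) : kin i f = ∫ x, ‖g x‖ ^ 2 :=
  integral_congr_ae ((weakPartial_ae_eq hg h).mono fun x hx => by simp [hx])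

theorem isWeakPartial_toC {i : Fin d} {u g : Space d → ℝ}
    (h : ∀ η : Space d → ℝ, ContDiff ℝ ∞ η → HasCompactSupport η →
        ∫ x, u x * fderiv ℝ η x (EuclideanSpace.single i 1) = -∫ x, g x * η x) :
    IsWeakPartial i (toC u) (toC g) := by
  intro η hη hc
  have := h η hη hc
  have h2 := congrArg (fun r : ℝ => (r : ℂ)) this
  simpa [← integral_complex_ofReal] using h2

theorem integrable_norm_sq {f : Space d → ℂ} (hf : MemLp f 2 volume) :
    Integrable (fun x => ‖f x‖ ^ 2) := hf.norm.integrable_sq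

theorem sum_smul_single (v : Space d) : ∑ i, v i • EuclideanSpace.single i (1 : ℝ) = v := by
  ext j
  simp [Pi.single_apply]

theorem integral_sum_smul_mul {ι : Type*} (s : Finset ι) (c : ι → ℝ) {g : ι → Space d → ℝ}
    {η : Space d → ℝ} (h : ∀ i, Integrable fun x => g i x * η x) :
    ∫ x, (∑ i ∈ s, c i * g i x) * η x = ∑ i ∈ s, c i * ∫ x, g i x * η x := by
  simp_rw [Finset.sum_mul, mul_assoc]
  rw [integral_finsetSum _ fun i _ => (h i).const_mul _]
  simp_rw [integral_const_mul]

/-- Test functions are real, so any real-linear functional on ℂ passes through the definition of the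
weak derivative. The real and the imaginary part reduce the claim to the scalar estimate. -/
theorem MemH1.integral_translate_sub_sq_le {f : Space d → ℂ} (hf : MemH1 f) (v : Space d) :
    ∫ x, ‖f (x + v) - f x‖ ^ 2 ≤ ∫ x, ‖∑ i, (v i : ℂ) * weakPartial i f x‖ ^ 2 := by
  have hsm : MemLp (fun x => ∑ i, (v i : ℂ) * weakPartial i f x) 2 volume :=
    memLp_finsetSum _ fun i _ => (hf.weakPartial_spec i).1.const_mul _
  have hdm : MemLp (fun x => f (x + v) - f x) 2 volume := (memLp_comp_add hf.1 v).sub hf.1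
  -- the real-linear coordinate version
  have key : ∀ L : ℂ →L[ℝ] ℝ, ∫ x, (L (f (x + v) - f x)) ^ 2 ≤
      ∫ x, (L (∑ i, (v i : ℂ) * weakPartial i f x)) ^ 2 := by
    intro L
    have hLf : MemLp (fun x => L (f x)) 2 volume := hf.1.continuousLinearMap_comp L
    have hLg : MemLp (fun x => L (∑ i, (v i : ℂ) * weakPartial i f x)) 2 volume :=
      hsm.continuousLinearMap_comp L
    have := TwoComponentBEC.integral_translate_sub_sq_le hLf hLg v ?_
    · simpa only [map_sub] using this
    intro η hη hc
    have hη2 := memLp_of_contDiff hη hc 2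
    have hLi : ∀ i, ∫ x, L (f x) * fderiv ℝ η x (EuclideanSpace.single i 1) =
        -∫ x, L (weakPartial i f x) * η x := by
      intro i
      have h1 := (hf.weakPartial_spec i).2 η hη hc
      have hd2 : MemLp (fun x => fderiv ℝ η x (EuclideanSpace.single i 1)) 2 volume :=
        ((hη.continuous_fderiv (by simp)).clm_apply continuous_const).memLp_of_hasCompactSupport
          (hc.fderiv_apply ℝ _)
      have h2 := congrArg L h1
      have i1 : Integrable fun x => f x *
          ((fderiv ℝ η x (EuclideanSpace.single i 1) : ℝ) : ℂ) := hf.1.integrable_mul hd2.ofReal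
      have i2 : Integrable fun x => weakPartial i f x * ((η x : ℝ) : ℂ) :=
        (hf.weakPartial_spec i).1.integrable_mul hη2.ofReal
      rw [map_neg, ← L.integral_comp_comm i1, ← L.integral_comp_comm i2] at h2
      have h3 : ∀ (z : ℂ) (r : ℝ), L (z * (r : ℂ)) = L z * r := by
        intro z r
        rw [mul_comm, ← Complex.real_smul, map_smul, smul_eq_mul, mul_comm]
      simpa only [h3] using h2
    have e1 : ∀ x, L (f x) * fderiv ℝ η x v =
        (∑ i, v i * fderiv ℝ η x (EuclideanSpace.single i 1)) * L (f x) := by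
      intro x
      conv_lhs => rw [← sum_smul_single v, map_sum]
      simp [mul_comm]
    have e2 : ∀ x, L (∑ i, (v i : ℂ) * weakPartial i f x) =
        ∑ i, v i * L (weakPartial i f x) := by
      intro x
      simp [← Complex.real_smul]
    simp_rw [e1, e2]
    rw [integral_sum_smul_mul, integral_sum_smul_mul, ← Finset.sum_neg_distrib]
    · refine Finset.sum_congr rfl fun i _ => ?_
      rw [← mul_neg, ← hLi i]
      simp [mul_comm]
    · intro i
      exact integrable_mul_of_memLp_two
        ((hf.weakPartial_spec i).1.continuousLinearMap_comp L) hη2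
    · intro i
      refine integrable_mul_of_memLp_two ?_ hLf
      exact ((hη.continuous_fderiv (by simp)).clm_apply
        continuous_const).memLp_of_hasCompactSupport (hc.fderiv_apply ℝ _)
  have split : ∀ {w : Space d → ℂ}, MemLp w 2 volume →
      ∫ x, ‖w x‖ ^ 2 = (∫ x, Complex.reCLM (w x) ^ 2) + ∫ x, Complex.imCLM (w x) ^ 2 := by
    intro w hw
    rw [← integral_add (hw.continuousLinearMap_comp Complex.reCLM).integrable_sq
      (hw.continuousLinearMap_comp Complex.imCLM).integrable_sq]
    congr 1; ext x
    rw [Complex.sq_norm, Complex.normSq_apply]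
    simp [sq]
  rw [split hsm, split hdm]
  exact add_le_add (key _) (key _)

theorem MemH1.integral_translate_single_le {f : Space d → ℂ} (hf : MemH1 f) (i : Fin d) (h : ℝ) :
    ∫ x, ‖f (x + h • EuclideanSpace.single i (1 : ℝ)) - f x‖ ^ 2 ≤ kin i f * h ^ 2 := by
  refine (hf.integral_translate_sub_sq_le _).trans_eq ?_
  rw [kin, ← integral_mul_const]
  congr 1; ext x
  rw [Finset.sum_eq_single i]
  · simp [mul_pow, mul_comm]
  · intro j _ hj; simp [hj]
  · simp

theorem MemH1.integral_translate_le {f : Space d → ℂ} (hf : MemH1 f) (v : Space d) :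
    ∫ x, ‖f (x + v) - f x‖ ^ 2 ≤ (∑ i, kin i f) * ‖v‖ ^ 2 := by
  refine (hf.integral_translate_sub_sq_le _).trans ?_
  unfold kin
  rw [← integral_finsetSum _ fun i _ => integrable_norm_sq (hf.weakPartial_spec i).1,
    ← integral_mul_const]
  refine integral_mono (integrable_norm_sq (memLp_finsetSum _ fun i _ =>
      (hf.weakPartial_spec i).1.const_mul _))
    ((integrable_finsetSum _ fun i _ =>
      integrable_norm_sq (hf.weakPartial_spec i).1).mul_const _) fun x => ?_
  simp only
  calc ‖∑ i, (v i : ℂ) * weakPartial i f x‖ ^ 2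
      ≤ (∑ i, ‖v i‖ * ‖weakPartial i f x‖) ^ 2 := by
        gcongr
        refine (norm_sum_le _ _).trans_eq ?_
        simp
    _ ≤ (∑ i, ‖v i‖ ^ 2) * ∑ i, ‖weakPartial i f x‖ ^ 2 := Finset.sum_mul_sq_le_sq_mul_sq _ _ _
    _ = _ := by rw [EuclideanSpace.norm_sq_eq, mul_comm]

theorem exists_isWeakPartial_toC {u : Space d → ℝ} (hu : MemLp u 2 volume) (i : Fin d) {C : ℝ}
    {h : ℕ → ℝ} (hne : ∀ n, h n ≠ 0) (h0 : Tendsto h atTop (𝓝 0))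
    (hC : ∀ n, ∫ x, (u (x + h n • EuclideanSpace.single i (1 : ℝ)) - u x) ^ 2 ≤ C * h n ^ 2) :
    (∃ g : Space d → ℂ, MemLp g 2 volume ∧ IsWeakPartial i (toC u) g) ∧ kin i (toC u) ≤ C := by
  obtain ⟨g, hg, hgC, hw⟩ := exists_weak_derivative hu _ hne h0 hC
  have h1 := isWeakPartial_toC hw
  refine ⟨⟨toC g, hg.ofReal, h1⟩, ?_⟩
  rw [kin_eq_of_isWeakPartial hg.ofReal h1]
  simpa using hgC

/-- Difference quotient bounds characterize `H¹`. -/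
theorem memH1_toC {u : Space d → ℝ} (hu : MemLp u 2 volume) {C : Fin d → ℝ}
    (hC : ∀ i (h : ℝ), ∫ x, (u (x + h • EuclideanSpace.single i (1 : ℝ)) - u x) ^ 2
      ≤ C i * h ^ 2) : MemH1 (toC u) ∧ ∀ i, kin i (toC u) ≤ C i := by
  have h := fun i => exists_isWeakPartial_toC hu i (h := fun n : ℕ => 1 / ((n : ℝ) + 1))
    (fun n => by positivity) tendsto_one_div_add_atTop_nhds_zero_nat (fun n => hC i _)
  exact ⟨⟨hu.ofReal, fun i => (h i).1⟩, fun i => (h i).2⟩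

theorem memLp_of_toC {u : Space d → ℝ} {p : ENNReal} (hu : MemLp (toC u) p volume) :
    MemLp u p volume := by
  simpa using hu.re

theorem MemH1.integral_diff_le {u : Space d → ℝ} (hu : MemH1 (toC u)) (i : Fin d) (h : ℝ) :
    ∫ x, (u (x + h • EuclideanSpace.single i (1 : ℝ)) - u x) ^ 2 ≤ kin i (toC u) * h ^ 2 := by
  have := hu.integral_translate_single_le i h
  simpa only [toC, ← Complex.ofReal_sub, Complex.norm_real, Real.norm_eq_abs, sq_abs] using this

theorem MemH1.integral_diff_le_norm {u : Space d → ℝ} (hu : MemH1 (toC u)) (v : Space d) :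
    ∫ x, (u (x + v) - u x) ^ 2 ≤ (∑ i, kin i (toC u)) * ‖v‖ ^ 2 := by
  have := hu.integral_translate_le v
  simpa only [toC, ← Complex.ofReal_sub, Complex.norm_real, Real.norm_eq_abs, sq_abs] using this

/-- The squared norms of the difference quotients converge to that of the weak derivative. -/
theorem MemH1.tendsto_diff {u : Space d → ℝ} (hu : MemH1 (toC u)) (i : Fin d) {h : ℕ → ℝ}
    (hne : ∀ n, h n ≠ 0) (h0 : Tendsto h atTop (𝓝 0)) :
    Tendsto (fun n => (∫ x, (u (x + h n • EuclideanSpace.single i (1 : ℝ)) - u x) ^ 2) / h n ^ 2)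
      atTop (𝓝 (kin i (toC u))) := by
  refine tendsto_order.2 ⟨fun c hc => ?_, fun c hc => Eventually.of_forall fun n => ?_⟩
  -- If the quotients stayed at most `c` along a subsequence, the weak derivative extracted there
  -- would have squared norm at most `c`, which is smaller than `kin`.
  · by_contra hn
    rw [not_eventually] at hn
    obtain ⟨φ, hφ, hφc⟩ := extraction_of_frequently_atTop hn
    have := (exists_isWeakPartial_toC (memLp_of_toC hu.1) i (C := c) (h := fun n => h (φ n))
      (fun n => hne _) (h0.comp hφ.tendsto_atTop) (fun n => ?_)).2
    · linarith
    · have h1 := not_lt.1 (hφc n)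
      rwa [div_le_iff₀ (by have := hne (φ n); positivity)] at h1
  · refine lt_of_le_of_lt ?_ hc
    rw [div_le_iff₀ (by have := hne n; positivity)]
    exact hu.integral_diff_le i _
end
end TwoComponentBEC

/-! ### Kinetic energy: convexity, semicontinuity, dilations and test functions. -/

namespace TwoComponentBEC
noncomputable section
variable {d : ℕ}

/-- The kinetic energy `∫ |∇f|²`. -/
def kinetic (f : Space d → ℂ) : ℝ := ∑ i, kin i f

theorem kinetic_nonneg (f : Space d → ℂ) : 0 ≤ kinetic f :=
  Finset.sum_nonneg fun i _ => kin_nonneg i f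

theorem MemH1.const_mul {f : Space d → ℂ} (h : MemH1 f) (c : ℂ) :
    MemH1 (fun x => c * f x) ∧ ∀ i, kin i (fun x => c * f x) = ‖c‖ ^ 2 * kin i f := by
  have hw : ∀ i, IsWeakPartial i (fun x => c * f x) (fun x => c * weakPartial i f x) := by
    intro i η hη hc
    simp_rw [mul_assoc, integral_const_mul, (h.weakPartial_spec i).2 η hη hc, mul_neg]
  have hm : ∀ i, MemLp (fun x => c * weakPartial i f x) 2 volume := fun i =>
    (h.weakPartial_spec i).1.const_mul c
  refine ⟨⟨h.1.const_mul c, fun i => ⟨_, hm i, hw i⟩⟩, fun i => ?_⟩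
  rw [kin_eq_of_isWeakPartial (hm i) (hw i), kin, ← integral_const_mul]
  simp [mul_pow]

theorem MemH1.const_mul_toC {u : Space d → ℝ} (h : MemH1 (toC u)) (c : ℝ) :
    MemH1 (toC fun x => c * u x) ∧ kinetic (toC fun x => c * u x) = c ^ 2 * kinetic (toC u) := by
  have h1 := h.const_mul (c : ℂ)
  have e : toC (fun x => c * u x) = fun x => (c : ℂ) * toC u x := by ext x; simp
  rw [e]
  refine ⟨h1.1, ?_⟩
  simp only [kinetic, h1.2, ← Finset.mul_sum]
  simp

/-- The diamagnetic inequality, read off from ||a| - |b|| ≤ |a - b| for increments. -/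
theorem MemH1.norm {f : Space d → ℂ} (h : MemH1 f) :
    MemH1 (toC fun x => ‖f x‖) ∧ ∀ i, kin i (toC fun x => ‖f x‖) ≤ kin i f := by
  refine memH1_toC h.1.norm fun i s => (integral_mono ?_ ?_ fun x => ?_).trans
    (h.integral_translate_single_le i s)
  · exact ((memLp_comp_add h.1.norm _).sub h.1.norm).integrable_sq
  · exact integrable_norm_sq ((memLp_comp_add h.1 _).sub h.1)
  · simp only
    rw [← sq_abs]
    gcongr
    exact abs_norm_sub_norm_le _ _

theorem MemH1.kinetic_norm_le {f : Space d → ℂ} (h : MemH1 f) :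
    kinetic (toC fun x => ‖f x‖) ≤ kinetic f := Finset.sum_le_sum fun i _ => h.norm.2 i

theorem integral_diff_sq_integrable {u : Space d → ℝ} (hu : MemLp u 2 volume) (v : Space d) :
    Integrable fun x => (u (x + v) - u x) ^ 2 :=
  ((memLp_comp_add hu v).sub hu).integrable_sq

/-- If the increments of `w` are dominated by those of `u` and `v`, then so is its kinetic
energy. -/
theorem memH1_of_increment_le {u v w : Space d → ℝ} (hu : MemH1 (toC u)) (hv : MemH1 (toC v))
    (hw : MemLp w 2 volume) {a b : ℝ} (ha : 0 ≤ a) (hb : 0 ≤ b)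
    (h : ∀ x y, (w x - w y) ^ 2 ≤ a * (u x - u y) ^ 2 + b * (v x - v y) ^ 2) :
    MemH1 (toC w) ∧ ∀ i, kin i (toC w) ≤ a * kin i (toC u) + b * kin i (toC v) := by
  have hu2 := memLp_of_toC hu.1
  have hv2 := memLp_of_toC hv.1
  refine memH1_toC hw fun i s => ?_
  calc _ ≤ ∫ x, (a * (u (x + s • EuclideanSpace.single i (1 : ℝ)) - u x) ^ 2 +
          b * (v (x + s • EuclideanSpace.single i (1 : ℝ)) - v x) ^ 2) :=
        integral_mono (integral_diff_sq_integrable hw _)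
          (((integral_diff_sq_integrable hu2 _).const_mul a).add
            ((integral_diff_sq_integrable hv2 _).const_mul b)) fun x => h _ _
    _ = a * (∫ x, (u (x + s • EuclideanSpace.single i (1 : ℝ)) - u x) ^ 2) +
          b * ∫ x, (v (x + s • EuclideanSpace.single i (1 : ℝ)) - v x) ^ 2 := by
        rw [integral_add ((integral_diff_sq_integrable hu2 _).const_mul a)
            ((integral_diff_sq_integrable hv2 _).const_mul b), integral_const_mul,
          integral_const_mul]
    _ ≤ a * (kin i (toC u) * s ^ 2) + b * (kin i (toC v) * s ^ 2) := by
        gcongr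
        · exact hu.integral_diff_le i s
        · exact hv.integral_diff_le i s
    _ = _ := by ring

theorem memH1_of_increment_le_one {u w : Space d → ℝ} (hu : MemH1 (toC u))
    (hw : MemLp w 2 volume) (h : ∀ x y, |w x - w y| ≤ |u x - u y|) :
    MemH1 (toC w) ∧ ∀ i, kin i (toC w) ≤ kin i (toC u) := by
  have := memH1_of_increment_le hu hu hw (a := 1) (b := 0) (by simp) (by simp)
    (fun x y => by simpa using sq_le_sq.2 (h x y))
  simpa using this

theorem kinetic_le_of_kin_le {u v w : Space d → ℂ} {a b : ℝ}
    (h : ∀ i, kin i w ≤ a * kin i u + b * kin i v) :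
    kinetic w ≤ a * kinetic u + b * kinetic v := by
  unfold kinetic
  rw [Finset.mul_sum, Finset.mul_sum, ← Finset.sum_add_distrib]
  exact Finset.sum_le_sum fun i _ => h i

/-- The reverse triangle inequality for the weighted Euclidean norm of (p, q). -/
theorem sqrt_increment_le {a b p q p' q' : ℝ} (ha : 0 ≤ a) (hb : 0 ≤ b) :
    (√(a * p ^ 2 + b * q ^ 2) - √(a * p' ^ 2 + b * q' ^ 2)) ^ 2 ≤
      a * (p - p') ^ 2 + b * (q - q') ^ 2 := by
  have h1 : 0 ≤ a * p ^ 2 + b * q ^ 2 := by positivity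
  have h2 : 0 ≤ a * p' ^ 2 + b * q' ^ 2 := by positivity
  have h3 : a * (p * p') + b * (q * q') ≤ √(a * p ^ 2 + b * q ^ 2) * √(a * p' ^ 2 + b * q' ^ 2) := by
    rw [← Real.sqrt_mul h1]
    apply Real.le_sqrt_of_sq_le
    nlinarith [mul_nonneg (mul_nonneg ha hb) (sq_nonneg (p * q' - q * p'))]
  nlinarith [Real.sq_sqrt h1, Real.sq_sqrt h2]

theorem memLp_sqrt_combo {α : Type*} [MeasurableSpace α] {μ : Measure α} {u v : α → ℝ}
    (hu : MemLp u 2 μ) (hv : MemLp v 2 μ) {a b : ℝ} (ha : 0 ≤ a) (hb : 0 ≤ b) :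
    MemLp (fun x => √(a * u x ^ 2 + b * v x ^ 2)) 2 μ := by
  refine (memLp_two_iff_integrable_sq ?_).2 ?_
  · exact Real.continuous_sqrt.comp_aestronglyMeasurable
      (((hu.1.pow 2).const_mul a).add ((hv.1.pow 2).const_mul b))
  · have : (fun x => √(a * u x ^ 2 + b * v x ^ 2) ^ 2) = fun x => a * u x ^ 2 + b * v x ^ 2 := by
      ext x
      rw [Real.sq_sqrt (by positivity)]
    rw [this]
    exact (hu.integrable_sq.const_mul a).add (hv.integrable_sq.const_mul b)

/-- Convexity of the kinetic energy as a function of the density. -/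
theorem MemH1.sqrt_combo {u v : Space d → ℝ} (hu : MemH1 (toC u)) (hv : MemH1 (toC v)) {a b : ℝ}
    (ha : 0 ≤ a) (hb : 0 ≤ b) : MemH1 (toC fun x => √(a * u x ^ 2 + b * v x ^ 2)) ∧
      kinetic (toC fun x => √(a * u x ^ 2 + b * v x ^ 2)) ≤
        a * kinetic (toC u) + b * kinetic (toC v) := by
  have := memH1_of_increment_le hu hv
    (memLp_sqrt_combo (memLp_of_toC hu.1) (memLp_of_toC hv.1) ha hb) ha hb
    (fun x y => sqrt_increment_le ha hb)
  exact ⟨this.1, kinetic_le_of_kin_le this.2⟩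

theorem seq_ne (n : ℕ) : 1 / ((n : ℝ) + 1) ≠ 0 := by positivity

theorem MemH1.add_toC {u v : Space d → ℝ} (hu : MemH1 (toC u)) (hv : MemH1 (toC v)) (c : ℝ) :
    MemH1 (toC fun x => u x + c * v x) := by
  refine (memH1_of_increment_le hu hv (a := 2) (b := 2 * c ^ 2)
    ((memLp_of_toC hu.1).add ((memLp_of_toC hv.1).const_mul c)) (by positivity) (by positivity)
    fun x y => ?_).1
  simp only [Pi.add_apply]
  nlinarith [sq_nonneg ((u x - u y) - c * (v x - v y))]

/-- Increments satisfy the parallelogram identity exactly; it survives the limit of vanishing step.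
Only this direction is used. -/
theorem MemH1.parallelogram {u v : Space d → ℝ} (hu : MemH1 (toC u)) (hv : MemH1 (toC v)) :
    kinetic (toC fun x => u x + v x) + kinetic (toC fun x => u x - v x) ≤
      2 * kinetic (toC u) + 2 * kinetic (toC v) := by
  have hp : MemH1 (toC fun x => u x + v x) := by simpa using hu.add_toC hv 1
  have hm : MemH1 (toC fun x => u x - v x) := by
    simpa [← sub_eq_add_neg] using hu.add_toC hv (-1)
  have hu2 := memLp_of_toC hu.1
  have hv2 := memLp_of_toC hv.1
  unfold kinetic
  rw [Finset.mul_sum, Finset.mul_sum, ← Finset.sum_add_distrib, ← Finset.sum_add_distrib]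
  refine Finset.sum_le_sum fun i _ => ?_
  have h0 := tendsto_one_div_add_atTop_nhds_zero_nat (𝕜 := ℝ)
  refine le_of_tendsto_of_tendsto' ((hp.tendsto_diff i seq_ne h0).add
    (hm.tendsto_diff i seq_ne h0)) (((hu.tendsto_diff i seq_ne h0).const_mul 2).add
    ((hv.tendsto_diff i seq_ne h0).const_mul 2)) fun n => ?_
  rw [← add_div, ← mul_div_assoc, ← mul_div_assoc, ← add_div]
  refine div_le_div_of_nonneg_right ?_ (by positivity)
  set e := (1 / ((n : ℝ) + 1)) • EuclideanSpace.single i (1 : ℝ)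
  rw [← integral_const_mul, ← integral_const_mul,
    ← integral_add (integral_diff_sq_integrable (memLp_of_toC hp.1) e)
      (integral_diff_sq_integrable (memLp_of_toC hm.1) e),
    ← integral_add ((integral_diff_sq_integrable hu2 e).const_mul 2)
      ((integral_diff_sq_integrable hv2 e).const_mul 2)]
  refine le_of_eq (integral_congr_ae (Eventually.of_forall fun x => ?_))
  simp only
  ring

/-- Convergence in `L²` implies convergence of the squared norms. -/
theorem tendsto_integral_sq {α : Type*} [MeasurableSpace α] {μ : Measure α} {u : ℕ → α → ℝ}
    {v : α → ℝ} (hu : ∀ n, MemLp (u n) 2 μ) (hv : MemLp v 2 μ)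
    (h : Tendsto (fun n => ∫ x, (u n x - v x) ^ 2 ∂μ) atTop (𝓝 0)) :
    Tendsto (fun n => ∫ x, u n x ^ 2 ∂μ) atTop (𝓝 (∫ x, v x ^ 2 ∂μ)) := by
  have h1 : Tendsto (fun n => √(∫ x, (u n x - v x) ^ 2 ∂μ)) atTop (𝓝 0) := by
    have := (Real.continuous_sqrt.tendsto 0).comp h
    rwa [Real.sqrt_zero] at this
  have h2 : Tendsto (fun n => √(∫ x, u n x ^ 2 ∂μ)) atTop (𝓝 √(∫ x, v x ^ 2 ∂μ)) := by
    rw [tendsto_iff_dist_tendsto_zero]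
    refine squeeze_zero (fun _ => dist_nonneg) (fun n => ?_) h1
    exact abs_sqrt_integral_sq_sub_le (hu n) hv
  have h3 := h2.pow 2
  have e : ∀ w : α → ℝ, √(∫ x, w x ^ 2 ∂μ) ^ 2 = ∫ x, w x ^ 2 ∂μ := fun w =>
    Real.sq_sqrt (integral_nonneg fun x => sq_nonneg _)
  simpa only [e] using h3

theorem tendsto_integral_diff_sq {u : ℕ → Space d → ℝ} {v : Space d → ℝ}
    (hu : ∀ n, MemLp (u n) 2 volume) (hv : MemLp v 2 volume)
    (h : Tendsto (fun n => ∫ x, (u n x - v x) ^ 2) atTop (𝓝 0)) (z : Space d) :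
    Tendsto (fun n => ∫ x, (u n (x + z) - u n x) ^ 2) atTop
      (𝓝 (∫ x, (v (x + z) - v x) ^ 2)) := by
  refine tendsto_integral_sq (fun n => (memLp_comp_add (hu n) z).sub (hu n))
    ((memLp_comp_add hv z).sub hv) ?_
  have h1 : Tendsto (fun n => 4 * ∫ x, (u n x - v x) ^ 2) atTop (𝓝 0) := by
    simpa using h.const_mul 4
  refine squeeze_zero (fun n => integral_nonneg fun x => sq_nonneg _) (fun n => ?_) h1
  have hd : MemLp (fun x => u n x - v x) 2 volume := (hu n).sub hv
  have hd' := memLp_comp_add hd z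
  have e : 4 * ∫ x, (u n x - v x) ^ 2 =
      ∫ x, (2 * (u n (x + z) - v (x + z)) ^ 2 + 2 * (u n x - v x) ^ 2) := by
    rw [integral_add (hd'.integrable_sq.const_mul 2) (hd.integrable_sq.const_mul 2),
      integral_const_mul, integral_const_mul,
      integral_add_right_eq_self (fun x => (u n x - v x) ^ 2) z]
    ring
  rw [e]
  refine integral_mono (((memLp_comp_add (hu n) z).sub (hu n)).sub
    ((memLp_comp_add hv z).sub hv)).integrable_sq
    ((hd'.integrable_sq.const_mul 2).add (hd.integrable_sq.const_mul 2)) fun x => ?_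
  simp only
  nlinarith [sq_nonneg ((u n (x + z) - v (x + z)) + (u n x - v x))]

/-- Lower semicontinuity of the kinetic energy under convergence in `L²`. -/
theorem kinetic_le_of_tendsto {u : ℕ → Space d → ℝ} {v : Space d → ℝ}
    (hu : ∀ n, MemH1 (toC (u n))) (hv : MemLp v 2 volume)
    (h : Tendsto (fun n => ∫ x, (u n x - v x) ^ 2) atTop (𝓝 0)) {C : ℕ → ℝ} {C' : ℝ}
    (hC : ∀ n, kinetic (toC (u n)) ≤ C n) (hC' : Tendsto C atTop (𝓝 C')) :
    MemH1 (toC v) ∧ kinetic (toC v) ≤ C' := by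
  -- For a fixed step `s` the increments converge in L² and all directions are kept in one sum; `s`
  -- tends to zero only afterwards. This bounds the total kinetic energy by `C'`, not each direction
  -- separately.
  have key : ∀ s : ℝ, ∑ i, ∫ x, (v (x + s • EuclideanSpace.single i (1 : ℝ)) - v x) ^ 2 ≤
      C' * s ^ 2 := by
    intro s
    refine le_of_tendsto_of_tendsto' (tendsto_finsetSum _ fun i _ =>
      tendsto_integral_diff_sq (fun n => memLp_of_toC (hu n).1) hv h
        (s • EuclideanSpace.single i (1 : ℝ))) (hC'.mul_const (s ^ 2)) fun n => ?_
    calc _ ≤ ∑ i, kin i (toC (u n)) * s ^ 2 :=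
          Finset.sum_le_sum fun i _ => (hu n).integral_diff_le i s
      _ = kinetic (toC (u n)) * s ^ 2 := by rw [kinetic, Finset.sum_mul]
      _ ≤ _ := by gcongr; exact hC n
  have hm : MemH1 (toC v) := (memH1_toC hv (C := fun _ => C') fun i s =>
    (Finset.single_le_sum (f := fun i => ∫ x, (v (x + s • EuclideanSpace.single i (1 : ℝ)) -
      v x) ^ 2) (fun i _ => integral_nonneg fun x => sq_nonneg _)
      (Finset.mem_univ i)).trans (key s)).1
  refine ⟨hm, ?_⟩
  have h0 := tendsto_one_div_add_atTop_nhds_zero_nat (𝕜 := ℝ)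
  refine le_of_tendsto' (tendsto_finsetSum _ fun i _ => hm.tendsto_diff i seq_ne h0) fun n => ?_
  rw [← Finset.sum_div, div_le_iff₀ (by positivity)]
  exact key _

/-- Test functions belong to `H¹`, with the classical derivative. -/
theorem memH1_of_contDiff {w : Space d → ℝ} (hw : ContDiff ℝ ∞ w) (hc : HasCompactSupport w) :
    MemH1 (toC w) ∧ ∀ i, kin i (toC w) = ∫ x, fderiv ℝ w x (EuclideanSpace.single i 1) ^ 2 := by
  have hd2 : ∀ i, MemLp (fun x => fderiv ℝ w x (EuclideanSpace.single i 1)) 2 volume := fun i =>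
    ((hw.continuous_fderiv (by simp)).clm_apply continuous_const).memLp_of_hasCompactSupport
      (hc.fderiv_apply ℝ _)
  have hw2 := memLp_of_contDiff hw hc 2
  have hp : ∀ i, IsWeakPartial i (toC w)
      (toC fun x => fderiv ℝ w x (EuclideanSpace.single i 1)) := by
    intro i
    refine isWeakPartial_toC fun η hη hcη => ?_
    have hη2 := memLp_of_contDiff hη hcη 2
    refine integral_mul_fderiv_eq_neg_fderiv_mul_of_integrable
      (integrable_mul_of_memLp_two (hd2 i) hη2) (integrable_mul_of_memLp_two hw2 ?_)
      (integrable_mul_of_memLp_two hw2 hη2) (fun x _ => (hw.differentiable (by simp)) x)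
      (fun x _ => (hη.differentiable (by simp)) x)
    exact ((hη.continuous_fderiv (by simp)).clm_apply
      continuous_const).memLp_of_hasCompactSupport (hcη.fderiv_apply ℝ _)
  refine ⟨⟨hw2.ofReal, fun i => ⟨_, (hd2 i).ofReal, hp i⟩⟩, fun i => ?_⟩
  rw [kin_eq_of_isWeakPartial (hd2 i).ofReal (hp i)]
  simp

theorem kinetic_of_contDiff {w : Space d → ℝ} (hw : ContDiff ℝ ∞ w) (hc : HasCompactSupport w) :
    kinetic (toC w) = ∫ x, ‖fderiv ℝ w x‖ ^ 2 := by
  have hd2 : ∀ i, MemLp (fun x => fderiv ℝ w x (EuclideanSpace.single i 1)) 2 volume := fun i =>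
    ((hw.continuous_fderiv (by simp)).clm_apply continuous_const).memLp_of_hasCompactSupport
      (hc.fderiv_apply ℝ _)
  unfold kinetic
  simp_rw [(memH1_of_contDiff hw hc).2]
  rw [← integral_finsetSum _ fun i _ => (hd2 i).integrable_sq]
  congr 1; ext x
  set L := fderiv ℝ w x
  have h1 := (InnerProductSpace.toDual ℝ (Space d)).symm.norm_map L
  rw [← h1, EuclideanSpace.norm_sq_eq]
  refine Finset.sum_congr rfl fun i _ => ?_
  have h2 : L (EuclideanSpace.single i 1) =
      inner ℝ ((InnerProductSpace.toDual ℝ (Space d)).symm L) (EuclideanSpace.single i 1) := by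
    rw [InnerProductSpace.toDual_symm_apply]
  rw [h2, EuclideanSpace.inner_single_right]
  simp

theorem MemH1.comp_add {u : Space d → ℝ} (hu : MemH1 (toC u)) (z : Space d) :
    MemH1 (toC fun x => u (x + z)) ∧ kinetic (toC fun x => u (x + z)) ≤ kinetic (toC u) := by
  have := memH1_toC (memLp_comp_add (memLp_of_toC hu.1) z) (C := fun i => kin i (toC u))
    fun i s => ?_
  · exact ⟨this.1, Finset.sum_le_sum fun i _ => this.2 i⟩
  · refine le_trans (le_of_eq ?_) (hu.integral_diff_le i s)
    rw [← integral_add_right_eq_self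
      (fun x => (u (x + s • EuclideanSpace.single i (1 : ℝ)) - u x) ^ 2) z]
    congr 1; ext x; simp only [add_right_comm]

theorem integral_comp_smul_pos (f : Space d → ℝ) {l : ℝ} (hl : 0 < l) :
    ∫ x, f (l • x) = (l ^ d)⁻¹ * ∫ x, f x := by
  rw [Measure.integral_comp_smul, finrank_euclideanSpace_fin, abs_of_pos (by positivity),
    smul_eq_mul]

theorem memLp_comp_smul {u : Space d → ℝ} (hu : MemLp u 2 volume) {l : ℝ} (hl : 0 < l) :
    MemLp (fun x => u (l • x)) 2 volume := by
  refine (memLp_two_iff_integrable_sq ?_).2 (hu.integrable_sq.comp_smul hl.ne')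
  exact hu.1.comp_quasiMeasurePreserving
    (Measure.quasiMeasurePreserving_smul _ hl.ne')

/-- The factor (l^d)⁻¹ comes from the change of variables, the factor l² from a step that is `l`
times as long. -/
theorem MemH1.comp_smul {u : Space d → ℝ} (hu : MemH1 (toC u)) {l : ℝ} (hl : 0 < l) :
    MemH1 (toC fun x => u (l • x)) ∧
      kinetic (toC fun x => u (l • x)) ≤ (l ^ d)⁻¹ * l ^ 2 * kinetic (toC u) := by
  have := memH1_toC (memLp_comp_smul (memLp_of_toC hu.1) hl)
    (C := fun i => (l ^ d)⁻¹ * l ^ 2 * kin i (toC u)) fun i s => ?_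
  · refine ⟨this.1, ?_⟩
    unfold kinetic
    rw [Finset.mul_sum]
    exact Finset.sum_le_sum fun i _ => this.2 i
  · have h1 := integral_comp_smul_pos
      (fun x => (u (x + (l * s) • EuclideanSpace.single i (1 : ℝ)) - u x) ^ 2) hl
    simp only [mul_smul, ← smul_add] at h1
    rw [h1]
    have h2 := hu.integral_diff_le i (l * s)
    rw [mul_smul] at h2
    calc _ ≤ (l ^ d)⁻¹ * (kin i (toC u) * (l * s) ^ 2) := by gcongr
      _ = _ := by ring

end
end TwoComponentBEC

/-! ### Mollification and compactness in a trap. -/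

namespace TwoComponentBEC
noncomputable section
variable {d : ℕ}

/-- A mollifier of radius `δ`. -/
structure IsMollifier (ρ : Space d → ℝ) (δ : ℝ) : Prop where
  smooth : ContDiff ℝ ∞ ρ
  compact : HasCompactSupport ρ
  nonneg : ∀ t, 0 ≤ ρ t
  integral : ∫ t, ρ t = 1
  radius : ∀ t, ρ t ≠ 0 → ‖t‖ ≤ δ

theorem exists_isMollifier {δ : ℝ} (hδ : 0 < δ) : ∃ ρ : Space d → ℝ, IsMollifier ρ δ := by
  let b : ContDiffBump (0 : Space d) := ⟨δ / 2, δ, by positivity, by linarith⟩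
  refine ⟨b.normed volume, b.contDiff_normed, b.hasCompactSupport_normed, b.nonneg_normed,
    b.integral_normed, fun t ht => ?_⟩
  have : t ∈ Function.support (b.normed volume) := ht
  rw [b.support_normed_eq] at this
  simpa using (Metric.mem_ball.1 this).le

/-- The convolution with a mollifier. -/
def mollify (ρ u : Space d → ℝ) (x : Space d) : ℝ := ∫ t, ρ t * u (x - t)

/-- Jensen's inequality for the probability density ρ, from the nonnegativity of the variance. -/
theorem sq_integral_mul_le {α : Type*} [MeasurableSpace α] {μ : Measure α} {ρ F : α → ℝ}
    (h0 : ∀ t, 0 ≤ ρ t) (h1 : ∫ t, ρ t ∂μ = 1) (hF : Integrable (fun t => ρ t * F t) μ)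
    (hF2 : Integrable (fun t => ρ t * F t ^ 2) μ) :
    (∫ t, ρ t * F t ∂μ) ^ 2 ≤ ∫ t, ρ t * F t ^ 2 ∂μ := by
  have hρ : Integrable ρ μ := by
    by_contra h
    rw [integral_undef h] at h1
    exact zero_ne_one h1
  set a := ∫ t, ρ t * F t ∂μ with ha
  have e : ∫ t, ρ t * (F t - a) ^ 2 ∂μ = ∫ t, ρ t * F t ^ 2 ∂μ - a ^ 2 := by
    have : ∀ t, ρ t * (F t - a) ^ 2 = ρ t * F t ^ 2 - 2 * a * (ρ t * F t) + a ^ 2 * ρ t := by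
      intro t; ring
    simp_rw [this]
    have hF3 : Integrable (fun t => ρ t * F t ^ 2 - 2 * a * (ρ t * F t)) μ :=
      hF2.sub (hF.const_mul _)
    rw [integral_add hF3 (hρ.const_mul _),
      integral_sub hF2 (hF.const_mul _), integral_const_mul, integral_const_mul, h1, ← ha]
    ring
  have : 0 ≤ ∫ t, ρ t * (F t - a) ^ 2 ∂μ :=
    integral_nonneg fun t => mul_nonneg (h0 t) (sq_nonneg _)
  linarith

theorem IsMollifier.integrable {ρ : Space d → ℝ} {δ : ℝ} (hρ : IsMollifier ρ δ) :
    Integrable ρ := hρ.smooth.continuous.integrable_of_hasCompactSupport hρ.compact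

theorem memLp_comp_sub_left {u : Space d → ℝ} (hu : MemLp u 2 volume) (x : Space d) :
    MemLp (fun t => u (x - t)) 2 volume :=
  hu.comp_measurePreserving (Measure.measurePreserving_sub_left volume x)

theorem IsMollifier.bdd_mul {ρ : Space d → ℝ} {δ : ℝ} (hρ : IsMollifier ρ δ) {F : Space d → ℝ}
    (hF : Integrable F) : Integrable fun t => ρ t * F t := by
  obtain ⟨M, hM⟩ := hρ.compact.exists_bound_of_continuous hρ.smooth.continuous
  exact hF.bdd_mul hρ.smooth.continuous.aestronglyMeasurable (Eventually.of_forall hM)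

/-- Jensen in `t`, then Fubini. The parameter `c` serves two purposes: c = 0 bounds the
mollification in L², c = 1 its distance from `u`. Genuine measurability of `u` is needed on the
product space, so the applications pass to a measurable representative. -/
theorem IsMollifier.integral_sq_le {ρ : Space d → ℝ} {δ : ℝ} (hρ : IsMollifier ρ δ)
    {u : Space d → ℝ} (hm : Measurable u) (hu : MemLp u 2 volume) (c : ℝ) :
    Integrable (fun x => (∫ t, ρ t * (u (x - t) - c * u x)) ^ 2) ∧
    Integrable (fun t => ρ t * ∫ x, (u (x - t) - c * u x) ^ 2) ∧
    ∫ x, (∫ t, ρ t * (u (x - t) - c * u x)) ^ 2 ≤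
      ∫ t, ρ t * ∫ x, (u (x - t) - c * u x) ^ 2 := by
  have hρm : Measurable ρ := hρ.smooth.continuous.measurable
  have hG : Measurable fun p : Space d × Space d => u (p.1 - p.2) - c * u p.1 :=
    (hm.comp (measurable_fst.sub measurable_snd)).sub ((hm.comp measurable_fst).const_mul c)
  have hprod : Integrable (fun p : Space d × Space d =>
      ρ p.2 * (u (p.1 - p.2) - c * u p.1) ^ 2) (volume.prod volume) := by
    have i1 := Integrable.convolution_integrand (ContinuousLinearMap.mul ℝ ℝ) hρ.integrable
      hu.integrable_sq (μ := volume)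
    have i2 : Integrable (fun p : Space d × Space d => u p.1 ^ 2 * ρ p.2)
      (volume.prod volume) := hu.integrable_sq.mul_prod hρ.integrable
    refine ((i1.const_mul 2).add (i2.const_mul (2 * c ^ 2))).mono'
      ((hρm.comp measurable_snd).mul (hG.pow_const 2)).aestronglyMeasurable
      (Eventually.of_forall fun p => ?_)
    rw [Real.norm_of_nonneg (mul_nonneg (hρ.nonneg _) (sq_nonneg _))]
    simp only [ContinuousLinearMap.mul_apply', Pi.add_apply]
    nlinarith [mul_nonneg (hρ.nonneg p.2) (sq_nonneg (u (p.1 - p.2) + c * u p.1))]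
  have hpt : ∀ x, (∫ t, ρ t * (u (x - t) - c * u x)) ^ 2 ≤
      ∫ t, ρ t * (u (x - t) - c * u x) ^ 2 := by
    intro x
    have h2 := memLp_comp_sub_left hu x
    have i0 : Integrable fun t => ρ t * u (x - t) :=
      integrable_mul_of_memLp_two (memLp_of_contDiff hρ.smooth hρ.compact 2) h2
    have i1 : Integrable fun t => ρ t * u (x - t) ^ 2 := hρ.bdd_mul h2.integrable_sq
    refine sq_integral_mul_le hρ.nonneg hρ.integral ?_ ?_
    · have := i0.sub (hρ.integrable.mul_const (c * u x))
      refine this.congr (Eventually.of_forall fun t => ?_)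
      simp only [Pi.sub_apply]; ring
    · have := (i1.sub (i0.const_mul (2 * (c * u x)))).add
        (hρ.integrable.const_mul ((c * u x) ^ 2))
      refine this.congr (Eventually.of_forall fun t => ?_)
      simp only [Pi.sub_apply, Pi.add_apply]; ring
  have hmeas : AEStronglyMeasurable (fun x => (∫ t, ρ t * (u (x - t) - c * u x)) ^ 2) volume := by
    have : StronglyMeasurable fun x => ∫ t, ρ t * (u (x - t) - c * u x) :=
      StronglyMeasurable.integral_prod_right
        (f := fun x t : Space d => ρ t * (u (x - t) - c * u x))
        ((hρm.comp measurable_snd).mul hG).stronglyMeasurable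
    exact (this.pow 2).aestronglyMeasurable
  have hint : Integrable (fun x => (∫ t, ρ t * (u (x - t) - c * u x)) ^ 2) :=
    hprod.integral_prod_left.mono' hmeas (Eventually.of_forall fun x => by
      rw [Real.norm_of_nonneg (sq_nonneg _)]; exact hpt x)
  refine ⟨hint, ?_, ?_⟩
  · have := hprod.integral_prod_right
    simpa only [integral_const_mul] using this
  · refine (integral_mono hint hprod.integral_prod_left hpt).trans_eq ?_
    rw [integral_integral_swap hprod]
    simp only [integral_const_mul]

theorem mollify_congr {ρ u u' : Space d → ℝ} (h : u =ᵐ[volume] u') : mollify ρ u = mollify ρ u' := by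
  ext x
  refine integral_congr_ae ?_
  have := (Measure.measurePreserving_sub_left volume x).quasiMeasurePreserving.ae_eq_comp h
  filter_upwards [this] with t ht
  simp only [Function.comp_apply] at ht
  rw [ht]

theorem IsMollifier.contDiff_mollify {ρ : Space d → ℝ} {δ : ℝ} (hρ : IsMollifier ρ δ)
    {u : Space d → ℝ} (hu : MemLp u 2 volume) : ContDiff ℝ ∞ (mollify ρ u) :=
  HasCompactSupport.contDiff_convolution_left (ContinuousLinearMap.mul ℝ ℝ) hρ.compact
    (n := ⊤) hρ.smooth (hu.locallyIntegrable (by norm_num))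

theorem IsMollifier.mollify_memLp {ρ : Space d → ℝ} {δ : ℝ} (hρ : IsMollifier ρ δ)
    {u : Space d → ℝ} (hu : MemLp u 2 volume) :
    MemLp (mollify ρ u) 2 volume ∧ ∫ x, mollify ρ u x ^ 2 ≤ ∫ x, u x ^ 2 := by
  have hae := hu.1.ae_eq_mk
  have hu' := hu.ae_eq hae
  have h := hρ.integral_sq_le hu.1.stronglyMeasurable_mk.measurable hu' 0
  simp only [zero_mul, sub_zero] at h
  rw [mollify_congr hae]
  refine ⟨(memLp_two_iff_integrable_sq
    (hρ.contDiff_mollify hu').continuous.aestronglyMeasurable).2 h.1, h.2.2.trans_eq ?_⟩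
  have : ∀ t, ∫ x, hu.1.mk u (x - t) ^ 2 = ∫ x, u x ^ 2 := by
    intro t
    rw [integral_sub_right_eq_self (fun x => hu.1.mk u x ^ 2) t]
    exact integral_congr_ae (hae.mono fun x hx => by simp [hx])
  simp_rw [this, integral_mul_const, hρ.integral, one_mul]

theorem IsMollifier.mollify_sub_le {ρ : Space d → ℝ} {δ : ℝ} (hρ : IsMollifier ρ δ)
    {u : Space d → ℝ} (hu : MemLp u 2 volume) {C : ℝ} (hC0 : 0 ≤ C)
    (hC : ∀ z, ∫ x, (u (x + z) - u x) ^ 2 ≤ C * ‖z‖ ^ 2) :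
    ∫ x, (mollify ρ u x - u x) ^ 2 ≤ C * δ ^ 2 := by
  have hae := hu.1.ae_eq_mk
  have hu' := hu.ae_eq hae
  have h := hρ.integral_sq_le hu.1.stronglyMeasurable_mk.measurable hu' 1
  simp only [one_mul] at h
  rw [mollify_congr hae]
  have e : ∫ x, (mollify ρ (hu.1.mk u) x - u x) ^ 2 =
      ∫ x, (∫ t, ρ t * (hu.1.mk u (x - t) - hu.1.mk u x)) ^ 2 := by
    refine integral_congr_ae (hae.mono fun x hx => ?_)
    simp only [mul_sub]
    rw [integral_sub (integrable_mul_of_memLp_two (memLp_of_contDiff hρ.smooth hρ.compact 2)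
      (memLp_comp_sub_left hu' x)) (hρ.integrable.mul_const _), integral_mul_const, hρ.integral,
      one_mul, hx]
    rfl
  rw [e]
  refine h.2.2.trans ?_
  have h2 : ∀ t, ρ t * ∫ x, (hu.1.mk u (x - t) - hu.1.mk u x) ^ 2 ≤ ρ t * (C * δ ^ 2) := by
    intro t
    by_cases ht : ρ t = 0
    · simp [ht]
    refine mul_le_mul_of_nonneg_left ?_ (hρ.nonneg t)
    have e2 : ∫ x, (hu.1.mk u (x - t) - hu.1.mk u x) ^ 2 = ∫ x, (u (x + -t) - u x) ^ 2 := by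
      have h3 := (measurePreserving_add_right volume (-t)).quasiMeasurePreserving.ae_eq_comp hae
      refine integral_congr_ae ?_
      filter_upwards [h3, hae] with x h4 h5
      simp only [Function.comp_apply] at h4
      rw [sub_eq_add_neg x t, ← h4, ← h5]
    rw [e2]
    refine (hC _).trans ?_
    have := hρ.radius t ht
    rw [norm_neg]
    gcongr
  calc _ ≤ ∫ t, ρ t * (C * δ ^ 2) :=
        integral_mono h.2.1 (hρ.integrable.mul_const _) h2
    _ = C * δ ^ 2 := by rw [integral_mul_const, hρ.integral, one_mul]


theorem mollify_sub {ρ u v : Space d → ℝ} {δ : ℝ} (hρ : IsMollifier ρ δ) (hu : MemLp u 2 volume)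
    (hv : MemLp v 2 volume) (x : Space d) :
    mollify ρ (fun y => u y - v y) x = mollify ρ u x - mollify ρ v x := by
  have hρ2 := memLp_of_contDiff hρ.smooth hρ.compact 2
  unfold mollify
  rw [← integral_sub (integrable_mul_of_memLp_two hρ2 (memLp_comp_sub_left hu x))
    (integrable_mul_of_memLp_two hρ2 (memLp_comp_sub_left hv x))]
  congr 1; ext t; ring

theorem IsMollifier.memH1_mollify {ρ : Space d → ℝ} {δ : ℝ} (hρ : IsMollifier ρ δ)
    {u : Space d → ℝ} (hu : MemH1 (toC u)) :
    MemH1 (toC (mollify ρ u)) ∧ ∀ i, kin i (toC (mollify ρ u)) ≤ kin i (toC u) := by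
  have hu2 := memLp_of_toC hu.1
  refine memH1_toC (hρ.mollify_memLp hu2).1 fun i s => le_trans ?_ (hu.integral_diff_le i s)
  set e := s • EuclideanSpace.single i (1 : ℝ)
  have h1 := (hρ.mollify_memLp ((memLp_comp_add hu2 e).sub hu2)).2
  refine le_trans (le_of_eq ?_) h1
  congr 1; ext x
  have h2 := mollify_sub hρ (memLp_comp_add hu2 e) hu2 x
  have h3 : mollify ρ (fun x => u (x + e)) x = mollify ρ u (x + e) := by
    unfold mollify
    congr 1; ext t
    simp only [sub_add_eq_add_sub]
  rw [← h3, ← h2]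
  rfl

theorem mollify_eq_integral {ρ u : Space d → ℝ} (x : Space d) :
    mollify ρ u x = ∫ t, u t * ρ (x - t) := by
  unfold mollify
  rw [← integral_sub_left_eq_self (fun t => u t * ρ (x - t)) volume x]
  congr 1; ext t
  simp [mul_comm]

/-- A Rellich type compactness theorem: bounded kinetic energy together with bounded energy in a
trapping potential yields a subsequence converging in `L²`. -/
theorem exists_tendsto_subseq {u : ℕ → Space d → ℝ} (hu : ∀ n, MemH1 (toC (u n))) {C : ℝ}
    (hmass : ∀ n, ∫ x, u n x ^ 2 ≤ C) (hkin : ∀ n, kinetic (toC (u n)) ≤ C) {V : Space d → ℝ}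
    (hV0 : ∀ x, 0 ≤ V x) (hV : Tendsto V (cocompact (Space d)) atTop)
    (hVi : ∀ n, Integrable fun x => V x * u n x ^ 2) (hVC : ∀ n, ∫ x, V x * u n x ^ 2 ≤ C) :
    ∃ v : Space d → ℝ, MemLp v 2 volume ∧ ∃ φ : ℕ → ℕ, StrictMono φ ∧
      Tendsto (fun n => ∫ x, (u (φ n) x - v x) ^ 2) atTop (𝓝 0) := by
  have hu2 := fun n => memLp_of_toC (hu n).1
  have hC0 : 0 ≤ C := (integral_nonneg fun x => sq_nonneg _).trans (hmass 0)
  obtain ⟨v, hv, φ, hφ, hw⟩ := exists_weak_subseq hu2 hmass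
  refine ⟨v, hv, φ, hφ, ?_⟩
  have hdiff : ∀ n z, ∫ x, (u n (x + z) - u n x) ^ 2 ≤ C * ‖z‖ ^ 2 := fun n z =>
    ((hu n).integral_diff_le_norm z).trans (by gcongr; exact hkin n)
  -- Translation bounds pass to the weak limit, because the pairing of an increment with a function
  -- is a pairing of the original function.
  have hvdiff : ∀ z, ∫ x, (v (x + z) - v x) ^ 2 ≤ C * ‖z‖ ^ 2 := by
    intro z
    have hdv : MemLp (fun x => v (x + z) - v x) 2 volume := (memLp_comp_add hv z).sub hv
    have hpair : ∀ {p w : Space d → ℝ}, MemLp p 2 volume → MemLp w 2 volume →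
        ∫ x, (p (x + z) - p x) * w x = (∫ x, p x * w (x + -z)) - ∫ x, p x * w x := by
      intro p w hp hw
      rw [← integral_add_right_eq_self (fun x => p x * w (x + -z)) z, ← integral_sub]
      · congr 1; ext x; simp; ring
      · simpa using integrable_mul_of_memLp_two (memLp_comp_add hp z) hw
      · exact integrable_mul_of_memLp_two hp hw
    refine integral_sq_le_of_forall_weak (u := fun n x => u (φ n) (x + z) - u (φ n) x)
      (fun n => (memLp_comp_add (hu2 (φ n)) z).sub (hu2 (φ n))) hdv (fun n => hdiff (φ n) z) ?_
    simp_rw [fun n => hpair (hu2 (φ n)) hdv, hpair hv hdv]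
    exact (hw _ (memLp_comp_add hdv (-z))).sub (hw _ hdv)
  set g : ℕ → Space d → ℝ := fun n x => u (φ n) x - v x with hg
  have hg2 : ∀ n, MemLp (g n) 2 volume := fun n => (hu2 (φ n)).sub hv
  have hgdiff : ∀ n z, ∫ x, (g n (x + z) - g n x) ^ 2 ≤ 4 * C * ‖z‖ ^ 2 := by
    intro n z
    have a1 : MemLp (fun x => u (φ n) (x + z) - u (φ n) x) 2 volume :=
      (memLp_comp_add (hu2 (φ n)) z).sub (hu2 (φ n))
    have a2 : MemLp (fun x => v (x + z) - v x) 2 volume := (memLp_comp_add hv z).sub hv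
    calc _ ≤ ∫ x, (2 * (u (φ n) (x + z) - u (φ n) x) ^ 2 + 2 * (v (x + z) - v x) ^ 2) := by
          refine integral_mono (integral_diff_sq_integrable (hg2 n) z)
            ((a1.integrable_sq.const_mul 2).add (a2.integrable_sq.const_mul 2)) fun x => ?_
          simp only [hg]
          nlinarith [sq_nonneg ((u (φ n) (x + z) - u (φ n) x) + (v (x + z) - v x))]
      _ = 2 * (∫ x, (u (φ n) (x + z) - u (φ n) x) ^ 2) + 2 * ∫ x, (v (x + z) - v x) ^ 2 := by
          rw [integral_add (a1.integrable_sq.const_mul 2) (a2.integrable_sq.const_mul 2),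
            integral_const_mul, integral_const_mul]
      _ ≤ _ := by linarith [hdiff (φ n) z, hvdiff z]
  have hgmass : ∀ n, √(∫ x, g n x ^ 2) ≤ √C + √(∫ x, v x ^ 2) := fun n =>
    (sqrt_integral_sub_sq_le (hu2 (φ n)) hv).trans (by gcongr; exact hmass _)
  -- tails
  have htail : ∀ ε > 0, ∃ R : ℝ, ∀ n, ∫ x in (Metric.closedBall 0 R)ᶜ, g n x ^ 2 ≤ ε := by
    intro ε hε
    have ht : Tendsto (fun n : ℕ => ∫ x in (Metric.closedBall (0 : Space d) n)ᶜ, v x ^ 2) atTop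
        (𝓝 0) := by
      have := tendsto_setIntegral_of_antitone (μ := volume) (f := fun x => v x ^ 2)
        (s := fun n : ℕ => (Metric.closedBall (0 : Space d) n)ᶜ)
        (fun n => Metric.isClosed_closedBall.measurableSet.compl)
        (fun m n hmn => Set.compl_subset_compl.2
          (Metric.closedBall_subset_closedBall (by exact_mod_cast hmn)))
        ⟨0, hv.integrable_sq.integrableOn⟩
      have he : (⋂ n : ℕ, (Metric.closedBall (0 : Space d) n)ᶜ) = ∅ := by
        rw [← Set.compl_iUnion, Metric.iUnion_closedBall_nat, Set.compl_univ]
      simpa [he] using this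
    -- Where V ≥ 4C/ε + 1, the bound on the potential energy leaves mass at most ε/4; the summand 1
    -- keeps the factor positive if C = 0.
    have hA : ∀ᶠ n : ℕ in atTop, ∀ x ∈ (Metric.closedBall (0 : Space d) n)ᶜ,
        4 * C / ε + 1 ≤ V x := by
      have h1 := hV.eventually_ge_atTop (4 * C / ε + 1)
      rw [Filter.Eventually, Metric.cobounded_eq_cocompact.symm,
        (Metric.hasBasis_cobounded_compl_closedBall (0 : Space d)).mem_iff] at h1
      obtain ⟨r, -, hr⟩ := h1
      filter_upwards [eventually_ge_atTop ⌈r⌉₊] with n hn x hx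
      refine hr (Set.compl_subset_compl.2 (Metric.closedBall_subset_closedBall ?_) hx)
      exact (Nat.le_ceil r).trans (by exact_mod_cast hn)
    obtain ⟨n0, hn1, hn2⟩ := ((ht.eventually (gt_mem_nhds
      (show (0 : ℝ) < ε / 4 by positivity))).and hA).exists
    refine ⟨n0, fun n => ?_⟩
    set S := (Metric.closedBall (0 : Space d) n0)ᶜ
    have hS : MeasurableSet S := Metric.isClosed_closedBall.measurableSet.compl
    have iu := (hu2 (φ n)).integrable_sq.integrableOn (s := S)
    have iv := hv.integrable_sq.integrableOn (s := S)
    have b1 : ∫ x in S, u (φ n) x ^ 2 ≤ ε / 4 := by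
      have hpos : 0 < 4 * C / ε + 1 := by positivity
      have : (4 * C / ε + 1) * ∫ x in S, u (φ n) x ^ 2 ≤ C := by
        rw [← integral_const_mul]
        calc _ ≤ ∫ x in S, V x * u (φ n) x ^ 2 :=
              setIntegral_mono_on (iu.const_mul _) (hVi (φ n)).integrableOn hS fun x hx =>
                mul_le_mul_of_nonneg_right (hn2 x hx) (sq_nonneg _)
          _ ≤ ∫ x, V x * u (φ n) x ^ 2 :=
              setIntegral_le_integral (hVi (φ n)) (Eventually.of_forall fun x =>
                mul_nonneg (hV0 x) (sq_nonneg _))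
          _ ≤ C := hVC _
      have h0 : 0 ≤ ∫ x in S, u (φ n) x ^ 2 := integral_nonneg fun x => sq_nonneg _
      have h4 : 4 * C / ε * (∫ x in S, u (φ n) x ^ 2) ≤ C := by nlinarith
      by_cases hCz : C = 0
      · rw [hCz] at this
        simp only [mul_zero, zero_div, zero_add, one_mul] at this
        linarith
      · have hCp : 0 < C := lt_of_le_of_ne hC0 (Ne.symm hCz)
        rw [div_mul_eq_mul_div, div_le_iff₀ hε] at h4
        nlinarith
    calc ∫ x in S, g n x ^ 2 ≤ ∫ x in S, (2 * u (φ n) x ^ 2 + 2 * v x ^ 2) := by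
          refine setIntegral_mono_on (hg2 n).integrable_sq.integrableOn
            ((iu.const_mul 2).add (iv.const_mul 2)) hS fun x _ => ?_
          simp only [hg]
          nlinarith [sq_nonneg (u (φ n) x + v x)]
      _ = 2 * (∫ x in S, u (φ n) x ^ 2) + 2 * ∫ x in S, v x ^ 2 := by
          rw [integral_add (iu.const_mul 2) (iv.const_mul 2), integral_const_mul,
            integral_const_mul]
      _ ≤ ε := by linarith
  -- local convergence of mollifications
  have hloc : ∀ {ρ : Space d → ℝ} {δ : ℝ}, IsMollifier ρ δ → ∀ R : ℝ,
      Tendsto (fun n => ∫ x in Metric.closedBall 0 R, mollify ρ (g n) x ^ 2) atTop (𝓝 0) := by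
    intro ρ δ hρ R
    have hρ2 := memLp_of_contDiff hρ.smooth hρ.compact 2
    set M := (√C + √(∫ x, v x ^ 2)) * √(∫ x, ρ x ^ 2)
    have : Tendsto (fun n => ∫ x in Metric.closedBall 0 R, mollify ρ (g n) x ^ 2) atTop
        (𝓝 (∫ x in Metric.closedBall (0 : Space d) R, (0 : ℝ))) := by
      refine tendsto_integral_of_dominated_convergence (fun _ => M ^ 2)
        (fun n => ((hρ.contDiff_mollify (hg2 n)).continuous.pow 2).aestronglyMeasurable) ?_
        (fun n => Eventually.of_forall fun x => ?_) (Eventually.of_forall fun x => ?_)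
      · exact integrableOn_const (measure_closedBall_lt_top.ne)
      · rw [Real.norm_of_nonneg (sq_nonneg _), ← sq_abs]
        gcongr
        rw [mollify_eq_integral]
        have h1 := abs_integral_mul_le (hg2 n) (memLp_comp_sub_left hρ2 x)
        rw [integral_sub_left_eq_self (fun t => ρ t ^ 2) volume x] at h1
        exact h1.trans (mul_le_mul_of_nonneg_right (hgmass n) (Real.sqrt_nonneg _))
      · have h2 := memLp_comp_sub_left hρ2 x
        have h3 := (hw _ h2).sub_const (∫ t, v t * ρ (x - t))
        rw [sub_self] at h3
        have h4 : ∀ n, mollify ρ (g n) x =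
            (∫ t, u (φ n) t * ρ (x - t)) - ∫ t, v t * ρ (x - t) := by
          intro n
          rw [mollify_eq_integral, ← integral_sub (integrable_mul_of_memLp_two (hu2 (φ n)) h2)
            (integrable_mul_of_memLp_two hv h2)]
          congr 1; ext t; simp only [hg]; ring
        simp_rw [h4]
        simpa using h3.pow 2
    simpa using this
  rw [Metric.tendsto_atTop]
  intro ε hε
  obtain ⟨R, hR⟩ := htail (ε / 4) (by positivity)
  -- The L² mass of `g n` is at most ε/4 from the tail, 2 · ε/8 from its mollification on the ball,
  -- and 2 · 4C δ² ≤ ε/4 from the mollification error.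
  set δ := √(ε / (32 * (C + 1)))
  have hδ : 0 < δ := by positivity
  have hδ2 : 8 * C * δ ^ 2 ≤ ε / 4 := by
    rw [Real.sq_sqrt (by positivity)]
    rw [mul_div_assoc', div_le_div_iff₀ (by positivity) (by norm_num)]
    nlinarith
  obtain ⟨ρ, hρ⟩ := exists_isMollifier (d := d) hδ
  obtain ⟨N, hN⟩ := Metric.tendsto_atTop.1 (hloc hρ R) (ε / 8) (by positivity)
  refine ⟨N, fun n hn => ?_⟩
  have hnn : 0 ≤ ∫ x, g n x ^ 2 := integral_nonneg fun x => sq_nonneg _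
  have hN' := hN n hn
  rw [Real.dist_eq, sub_zero] at hN' ⊢
  rw [abs_of_nonneg hnn]
  have hB : MeasurableSet (Metric.closedBall (0 : Space d) R) :=
    Metric.isClosed_closedBall.measurableSet
  have im := (hρ.mollify_memLp (hg2 n)).1
  have im2 : MemLp (fun x => mollify ρ (g n) x - g n x) 2 volume := im.sub (hg2 n)
  have h1 : ∫ x in Metric.closedBall 0 R, g n x ^ 2 ≤
      2 * (∫ x in Metric.closedBall 0 R, mollify ρ (g n) x ^ 2) +
        2 * ∫ x, (mollify ρ (g n) x - g n x) ^ 2 := by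
    calc _ ≤ ∫ x in Metric.closedBall 0 R,
          (2 * mollify ρ (g n) x ^ 2 + 2 * (mollify ρ (g n) x - g n x) ^ 2) := by
          refine setIntegral_mono_on (hg2 n).integrable_sq.integrableOn
            ((im.integrable_sq.integrableOn.const_mul 2).add
              (im2.integrable_sq.integrableOn.const_mul 2)) hB fun x _ => ?_
          nlinarith [sq_nonneg (2 * mollify ρ (g n) x - g n x)]
      _ = 2 * (∫ x in Metric.closedBall 0 R, mollify ρ (g n) x ^ 2) +
          2 * ∫ x in Metric.closedBall 0 R, (mollify ρ (g n) x - g n x) ^ 2 := by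
          rw [integral_add (im.integrable_sq.integrableOn.const_mul 2)
            (im2.integrable_sq.integrableOn.const_mul 2), integral_const_mul, integral_const_mul]
      _ ≤ _ := by
          have := setIntegral_le_integral (s := Metric.closedBall 0 R) im2.integrable_sq
            (Eventually.of_forall fun x => sq_nonneg _)
          linarith
  have h2 := hρ.mollify_sub_le (hg2 n) (by positivity) (hgdiff n)
  have h3 := integral_add_compl hB (hg2 n).integrable_sq
  have h4 := hR n
  have h5 := (abs_lt.1 hN').2
  linarith

end
end TwoComponentBEC

/-! ### Fatou's lemma and density of test functions. -/

namespace TwoComponentBEC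
noncomputable section
variable {d : ℕ}

/-- Fatou's lemma for Bochner integrals of nonnegative functions. -/
theorem integral_le_of_tendsto_ae {α : Type*} [MeasurableSpace α] {μ : Measure α}
    {f : ℕ → α → ℝ} {g : α → ℝ} (hf : ∀ n, Integrable (f n) μ) (hf0 : ∀ n x, 0 ≤ f n x)
    (hlim : ∀ᵐ x ∂μ, Tendsto (fun n => f n x) atTop (𝓝 (g x))) {B : ℕ → ℝ} {B' : ℝ}
    (hB : ∀ n, ∫ x, f n x ∂μ ≤ B n) (hB' : Tendsto B atTop (𝓝 B')) :
    Integrable g μ ∧ ∫ x, g x ∂μ ≤ B' := by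
  have hgm : AEStronglyMeasurable g μ :=
    aestronglyMeasurable_of_tendsto_ae atTop (fun n => (hf n).1) hlim
  have hg0 : 0 ≤ᵐ[μ] g := hlim.mono fun x hx => ge_of_tendsto' hx fun n => hf0 n x
  have hB0 : 0 ≤ B' := ge_of_tendsto' hB' fun n => (integral_nonneg (hf0 n)).trans (hB n)
  have h1 : ∫⁻ x, ENNReal.ofReal (g x) ∂μ ≤ ENNReal.ofReal B' := by
    calc ∫⁻ x, ENNReal.ofReal (g x) ∂μ
        = ∫⁻ x, liminf (fun n => ENNReal.ofReal (f n x)) atTop ∂μ := by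
          refine lintegral_congr_ae (hlim.mono fun x hx => ?_)
          exact ((ENNReal.continuous_ofReal.tendsto _).comp hx).liminf_eq.symm
      _ ≤ liminf (fun n => ∫⁻ x, ENNReal.ofReal (f n x) ∂μ) atTop :=
          lintegral_liminf_le' fun n => (hf n).1.aemeasurable.ennreal_ofReal
      _ ≤ liminf (fun n => ENNReal.ofReal (B n)) atTop := by
          refine liminf_le_liminf (Eventually.of_forall fun n => ?_)
          rw [← ofReal_integral_eq_lintegral_ofReal (hf n) (Eventually.of_forall (hf0 n))]
          exact ENNReal.ofReal_le_ofReal (hB n)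
      _ = ENNReal.ofReal B' := ((ENNReal.continuous_ofReal.tendsto _).comp hB').liminf_eq
  refine ⟨⟨hgm, ?_⟩, ?_⟩
  · rw [hasFiniteIntegral_iff_ofReal hg0]
    exact h1.trans_lt ENNReal.ofReal_lt_top
  · rw [integral_eq_lintegral_of_nonneg_ae hg0 hgm]
    exact ENNReal.toReal_le_of_le_ofReal hB0 h1

theorem exists_subseq_tendsto_ae {α : Type*} [MeasurableSpace α] {μ : Measure α}
    {u : ℕ → α → ℝ} {v : α → ℝ} (hu : ∀ n, MemLp (u n) 2 μ) (hv : MemLp v 2 μ)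
    (h : Tendsto (fun n => ∫ x, (u n x - v x) ^ 2 ∂μ) atTop (𝓝 0)) :
    ∃ φ : ℕ → ℕ, StrictMono φ ∧ ∀ᵐ x ∂μ, Tendsto (fun n => u (φ n) x) atTop (𝓝 (v x)) := by
  refine (tendstoInMeasure_of_tendsto_eLpNorm (p := 2) (by simp) (fun n => (hu n).1) hv.1
    ?_).exists_seq_tendsto_ae
  have e : ∀ n, eLpNorm (u n - v) 2 μ = ENNReal.ofReal √(∫ x, (u n x - v x) ^ 2 ∂μ) := by
    intro n
    have h1 := norm_toLp_two ((hu n).sub hv)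
    rw [Lp.norm_toLp] at h1
    simp only [Pi.sub_apply] at h1
    rw [← h1, ENNReal.ofReal_toReal ((hu n).sub hv).2.ne]
  simp_rw [e]
  have := (ENNReal.continuous_ofReal.comp Real.continuous_sqrt).tendsto 0
  have h2 := this.comp h
  simpa [Function.comp_def] using h2

theorem exists_cutoff : ∃ (χ : Space d → ℝ) (L : ℝ), 0 ≤ L ∧ ContDiff ℝ ∞ χ ∧
    HasCompactSupport χ ∧ (∀ x, 0 ≤ χ x) ∧ (∀ x, χ x ≤ 1) ∧ (∀ x, ‖x‖ ≤ 1 → χ x = 1) ∧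
    (∀ x, 2 ≤ ‖x‖ → χ x = 0) ∧ ∀ x y, |χ x - χ y| ≤ L * ‖x - y‖ := by
  let b : ContDiffBump (0 : Space d) := ⟨1, 2, by norm_num, by norm_num⟩
  obtain ⟨L, hL⟩ := b.contDiff.lipschitzWith_of_hasCompactSupport (𝕂 := ℝ) (n := 1)
    b.hasCompactSupport (by simp)
  refine ⟨b, L, L.2, b.contDiff, b.hasCompactSupport, fun x => b.nonneg, fun x => b.le_one,
    fun x hx => b.one_of_mem_closedBall (by simpa using hx),
    fun x hx => b.zero_of_le_dist (by simpa using hx), fun x y => ?_⟩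
  simpa [Real.dist_eq, dist_eq_norm] using hL.dist_le_mul x y

/-- Mollifying does not raise the kinetic energy, and a cutoff at a large radius costs a term
proportional to the inverse radius. The bounds are one-sided in the kinetic energy; strong
convergence of gradients is never needed. -/
theorem exists_contDiff_approx {u : Space d → ℝ} (hu : MemH1 (toC u)) {ε : ℝ} (hε : 0 < ε) :
    ∃ w : Space d → ℝ, ContDiff ℝ ∞ w ∧ HasCompactSupport w ∧ √(∫ x, (w x - u x) ^ 2) ≤ ε ∧
      ∀ i, √(kin i (toC w)) ≤ √(kin i (toC u)) + ε := by
  have hu2 := memLp_of_toC hu.1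
  set δ := ε / (2 * (√(kinetic (toC u)) + 1)) with hδdef
  have hδ : 0 < δ := by positivity
  obtain ⟨ρ, hρ⟩ := exists_isMollifier (d := d) hδ
  set v := mollify ρ u with hv
  have hv2 := (hρ.mollify_memLp hu2).1
  have hvH := hρ.memH1_mollify hu
  have hvu : √(∫ x, (v x - u x) ^ 2) ≤ ε / 2 := by
    have h1 := hρ.mollify_sub_le hu2 (kinetic_nonneg (toC u)) (fun z => hu.integral_diff_le_norm z)
    refine (Real.sqrt_le_sqrt h1).trans ?_
    rw [Real.sqrt_mul (kinetic_nonneg _), Real.sqrt_sq hδ.le, hδdef]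
    rw [mul_div_assoc', div_le_div_iff₀ (by positivity) (by norm_num)]
    nlinarith [Real.sqrt_nonneg (kinetic (toC u))]
  obtain ⟨χ, L, hL0, hχs, hχc, hχ0, hχ1, hχin, hχout, hχL⟩ := exists_cutoff (d := d)
  -- cut off at radius `n + 1`
  set r : ℕ → ℝ := fun n => 1 / ((n : ℝ) + 1) with hr
  have hr0 : ∀ n, 0 < r n := fun n => by simp only [hr]; positivity
  have hrlim : Tendsto r atTop (𝓝 0) := tendsto_one_div_add_atTop_nhds_zero_nat
  set w : ℕ → Space d → ℝ := fun n x => χ (r n • x) * v x with hw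
  have hχr : ∀ n, ContDiff ℝ ∞ (fun x => χ (r n • x)) := fun n =>
    hχs.comp (contDiff_const_smul (r n))
  have hws : ∀ n, ContDiff ℝ ∞ (w n) := fun n => (hχr n).mul (hρ.contDiff_mollify hu2)
  have hwc : ∀ n, HasCompactSupport (w n) := fun n =>
    HasCompactSupport.mul_right (hχc.comp_homeomorph (Homeomorph.smulOfNeZero (r n) (hr0 n).ne'))
  have hw2 : ∀ n, MemLp (w n) 2 volume := fun n => memLp_of_contDiff (hws n) (hwc n) 2
  have hlim : Tendsto (fun n => ∫ x, (w n x - v x) ^ 2) atTop (𝓝 0) := by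
    have : Tendsto (fun n => ∫ x, (w n x - v x) ^ 2) atTop (𝓝 (∫ _ : Space d, (0 : ℝ))) := by
      refine tendsto_integral_of_dominated_convergence (fun x => v x ^ 2)
        (fun n => ((hw2 n).sub hv2).integrable_sq.1) hv2.integrable_sq
        (fun n => Eventually.of_forall fun x => ?_) (Eventually.of_forall fun x => ?_)
      · rw [Real.norm_of_nonneg (sq_nonneg _)]
        simp only [hw]
        have h1 := hχ0 (r n • x)
        have h2 := hχ1 (r n • x)
        have h3 : (χ (r n • x) * v x - v x) ^ 2 = (1 - χ (r n • x)) ^ 2 * v x ^ 2 := by ring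
        rw [h3]
        exact mul_le_of_le_one_left (sq_nonneg _) (by nlinarith)
      · have h1 : ∀ᶠ n in atTop, ‖r n • x‖ ≤ 1 := by
          have : Tendsto (fun n => ‖r n • x‖) atTop (𝓝 ‖(0 : ℝ) • x‖) :=
            (hrlim.smul_const x).norm
          rw [zero_smul, norm_zero] at this
          exact (this.eventually (gt_mem_nhds one_pos)).mono fun n hn => hn.le
        refine tendsto_const_nhds.congr' (h1.mono fun n hn => ?_)
        simp [hw, hχin _ hn]
    simpa using this
  have hsq : Tendsto (fun n => √(∫ x, (w n x - v x) ^ 2)) atTop (𝓝 0) := by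
    have := (Real.continuous_sqrt.tendsto 0).comp hlim
    rwa [Real.sqrt_zero] at this
  have hkin : ∀ n i, √(kin i (toC (w n))) ≤ √(kin i (toC v)) + L * r n * √(∫ x, v x ^ 2) := by
    intro n i
    have h0 : 0 ≤ L * r n := mul_nonneg hL0 (hr0 n).le
    refine Real.sqrt_le_iff.2 ⟨by positivity, ?_⟩
    refine (exists_isWeakPartial_toC (hw2 n) i seq_ne
      tendsto_one_div_add_atTop_nhds_zero_nat fun m => ?_).2
    set s : ℝ := 1 / ((m : ℝ) + 1)
    have hs : 0 < s := by positivity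
    set e := s • EuclideanSpace.single i (1 : ℝ)
    have he : ‖e‖ = s := by
      rw [norm_smul, PiLp.norm_single, norm_one, mul_one, Real.norm_of_nonneg hs.le]
    have hdv : MemLp (fun x => |v (x + e) - v x|) 2 volume :=
      ((memLp_comp_add hv2 e).sub hv2).abs
    have hvv : MemLp (fun x => L * r n * s * |v x|) 2 volume := hv2.abs.const_mul _
    have h2 : ∫ x, (w n (x + e) - w n x) ^ 2 ≤
        ∫ x, (|v (x + e) - v x| + L * r n * s * |v x|) ^ 2 := by
      refine integral_mono (integral_diff_sq_integrable (hw2 n) e)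
        (hdv.add hvv).integrable_sq fun x => ?_
      simp only [← sq_abs (w n (x + e) - w n x)]
      gcongr
      -- The Leibniz rule for increments, with the Lipschitz constant `L * r n` of the dilated
      -- cutoff.
      have h3 : w n (x + e) - w n x = χ (r n • (x + e)) * (v (x + e) - v x) +
          (χ (r n • (x + e)) - χ (r n • x)) * v x := by simp only [hw]; ring
      rw [h3]
      refine (abs_add_le _ _).trans ?_
      rw [abs_mul, abs_mul]
      have h4 := hχL (r n • (x + e)) (r n • x)
      rw [← smul_sub, add_sub_cancel_left, norm_smul, he, Real.norm_of_nonneg (hr0 n).le] at h4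
      gcongr
      · rw [abs_of_nonneg (hχ0 _)]
        exact mul_le_of_le_one_left (abs_nonneg _) (hχ1 _)
      · linarith
    refine h2.trans ((integral_add_sq_le hdv hvv).trans ?_)
    have h5 : √(∫ x, |v (x + e) - v x| ^ 2) ≤ √(kin i (toC v)) * s := by
      rw [← Real.sqrt_sq hs.le, ← Real.sqrt_mul (kin_nonneg _ _)]
      simp_rw [sq_abs]
      exact Real.sqrt_le_sqrt (hvH.1.integral_diff_le i s)
    have h6 : √(∫ x, (L * r n * s * |v x|) ^ 2) = L * r n * s * √(∫ x, v x ^ 2) := by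
      simp_rw [mul_pow (L * r n * s), sq_abs, integral_const_mul]
      rw [Real.sqrt_mul (sq_nonneg _), Real.sqrt_sq (by positivity)]
    rw [h6, ← mul_pow]
    gcongr
    calc _ ≤ √(kin i (toC v)) * s + L * r n * s * √(∫ x, v x ^ 2) := by gcongr
      _ = _ := by ring
  have hlim2 : Tendsto (fun n => L * r n * √(∫ x, v x ^ 2)) atTop (𝓝 0) := by
    simpa using (hrlim.const_mul L).mul_const √(∫ x, v x ^ 2)
  obtain ⟨n, hn1, hn2⟩ := ((hsq.eventually (gt_mem_nhds (half_pos hε))).and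
    (hlim2.eventually (gt_mem_nhds hε))).exists
  refine ⟨w n, hws n, hwc n, ?_, fun i => ?_⟩
  · have h7 := sqrt_integral_add_sq_le ((hw2 n).sub hv2) (hv2.sub hu2)
    simp only [Pi.sub_apply, sub_add_sub_cancel] at h7
    linarith
  · have := Real.sqrt_le_sqrt (hvH.2 i)
    linarith [hkin n i]

/-- The sequence `K` only dominates the kinetic energies, which is what passing to the limit in an
inequality with the kinetic energy on the larger side requires. -/
theorem exists_contDiff_seq {u : Space d → ℝ} (hu : MemH1 (toC u)) :
    ∃ (w : ℕ → Space d → ℝ) (K : ℕ → ℝ), (∀ n, ContDiff ℝ ∞ (w n)) ∧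
      (∀ n, HasCompactSupport (w n)) ∧
      Tendsto (fun n => ∫ x, (w n x - u x) ^ 2) atTop (𝓝 0) ∧
      (∀ᵐ x, Tendsto (fun n => w n x) atTop (𝓝 (u x))) ∧
      (∀ n, kinetic (toC (w n)) ≤ K n) ∧ Tendsto K atTop (𝓝 (kinetic (toC u))) := by
  choose w hws hwc hwu hwk using fun n : ℕ =>
    exists_contDiff_approx hu (ε := 1 / ((n : ℝ) + 1)) (by positivity)
  have h0 := tendsto_one_div_add_atTop_nhds_zero_nat (𝕜 := ℝ)
  have hlim : Tendsto (fun n => ∫ x, (w n x - u x) ^ 2) atTop (𝓝 0) := by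
    have h1 := h0.pow 2
    rw [zero_pow two_ne_zero] at h1
    refine squeeze_zero (fun n => integral_nonneg fun x => sq_nonneg _) (fun n => ?_) h1
    exact (Real.sqrt_le_left (by positivity)).1 (hwu n)
  have hK : Tendsto (fun n : ℕ => ∑ i, (√(kin i (toC u)) + 1 / ((n : ℝ) + 1)) ^ 2) atTop
      (𝓝 (kinetic (toC u))) := by
    refine tendsto_finsetSum _ fun i _ => ?_
    have := (h0.const_add √(kin i (toC u))).pow 2
    rwa [add_zero, Real.sq_sqrt (kin_nonneg _ _)] at this
  obtain ⟨φ, hφ, hae⟩ := exists_subseq_tendsto_ae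
    (fun n => memLp_of_contDiff (hws n) (hwc n) 2) (memLp_of_toC hu.1) hlim
  refine ⟨fun n => w (φ n), fun n => ∑ i, (√(kin i (toC u)) + 1 / (((φ n : ℕ) : ℝ) + 1)) ^ 2,
    fun n => hws _, fun n => hwc _, hlim.comp hφ.tendsto_atTop, hae, fun n => ?_,
    hK.comp hφ.tendsto_atTop⟩
  refine Finset.sum_le_sum fun i _ => ?_
  exact (Real.sqrt_le_left (by positivity)).1 (hwk (φ n) i)

end
end TwoComponentBEC

/-! ### Gagliardo–Nirenberg inequalities for d = 1, 2, 3. -/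

namespace TwoComponentBEC
noncomputable section
variable {d : ℕ}

/-- From ∇(w²) = 2 w ∇w and Cauchy–Schwarz; it feeds w² into the W^{1,1} embeddings for d = 1 and d
= 2. -/
theorem integral_mul_fderiv_le {w : Space d → ℝ} (hw : ContDiff ℝ ∞ w) (hc : HasCompactSupport w) :
    ∫ x, ‖fderiv ℝ (fun y => w y ^ 2) x‖ ≤ 2 * (√(∫ x, w x ^ 2) * √(kinetic (toC w))) := by
  have hw2 := memLp_of_contDiff hw hc 2
  have hd2 : MemLp (fun x => ‖fderiv ℝ w x‖) 2 volume :=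
    (hw.continuous_fderiv (by simp)).norm.memLp_of_hasCompactSupport (hc.fderiv ℝ).norm
  have e : ∀ x, ‖fderiv ℝ (fun y => w y ^ 2) x‖ = 2 * (|w x| * ‖fderiv ℝ w x‖) := by
    intro x
    have h1 := ((hw.differentiable (by simp)).differentiableAt (x := x)).hasFDerivAt.pow 2
    rw [h1.fderiv]
    simp [norm_smul, mul_assoc]
  simp_rw [e]
  rw [integral_const_mul, kinetic_of_contDiff hw hc]
  have ha : MemLp (fun x => |w x|) 2 volume := hw2.abs
  have := abs_integral_mul_le ha hd2
  simp only [sq_abs] at this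
  linarith [le_abs_self (∫ x, |w x| * ‖fderiv ℝ w x‖)]

theorem hasCompactSupport_sq {w : Space d → ℝ} (hc : HasCompactSupport w) :
    HasCompactSupport fun x => w x ^ 2 :=
  hc.comp_left (g := fun t : ℝ => t ^ 2) (by simp)

/-- The embedding `W^{1,1}(ℝ²) ⊂ L²`. -/
theorem exists_integral_sq_le_two : ∃ C : ℝ, 0 ≤ C ∧ ∀ v : Space 2 → ℝ, ContDiff ℝ ∞ v →
    HasCompactSupport v → ∫ x, v x ^ 2 ≤ C * (∫ x, ‖fderiv ℝ v x‖) ^ 2 := by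
  refine ⟨lintegralPowLePowLIntegralFDerivConst (volume : Measure (Space 2)) 2,
    NNReal.coe_nonneg _, fun v hv hc => ?_⟩
  have hp : Real.HolderConjugate (Module.finrank ℝ (Space 2)) 2 := by
    simp only [finrank_euclideanSpace_fin, Nat.cast_ofNat]
    exact Real.HolderConjugate.two_two
  have h := lintegral_pow_le_pow_lintegral_fderiv volume (hv.of_le (by simp) : ContDiff ℝ 1 v)
    hc hp
  have hv2 := memLp_of_contDiff hv hc 2
  have hd : Integrable (fun x => ‖fderiv ℝ v x‖) :=
    (hv.continuous_fderiv (by simp)).norm.integrable_of_hasCompactSupport (hc.fderiv ℝ).norm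
  have e1 : ∫⁻ x, ‖v x‖ₑ ^ (2 : ℝ) = ENNReal.ofReal (∫ x, v x ^ 2) := by
    rw [ofReal_integral_eq_lintegral_ofReal hv2.integrable_sq
      (Eventually.of_forall fun x => sq_nonneg _)]
    refine lintegral_congr fun x => ?_
    rw [← ofReal_norm, ENNReal.ofReal_rpow_of_nonneg (norm_nonneg _) (by norm_num)]
    simp
  have e2 : ∫⁻ x, ‖fderiv ℝ v x‖ₑ = ENNReal.ofReal (∫ x, ‖fderiv ℝ v x‖) := by
    rw [ofReal_integral_eq_lintegral_ofReal hd (Eventually.of_forall fun x => norm_nonneg _)]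
    simp_rw [ofReal_norm]
  have h0 : 0 ≤ ∫ x, ‖fderiv ℝ v x‖ := integral_nonneg fun x => norm_nonneg _
  rw [e1, e2, ENNReal.ofReal_rpow_of_nonneg h0 (by norm_num), ← ENNReal.ofReal_coe_nnreal,
    ← ENNReal.ofReal_mul (NNReal.coe_nonneg _), ENNReal.ofReal_le_ofReal_iff (by positivity)] at h
  simpa using h

/-- Ladyzhenskaya's argument: the W^{1,1} embedding applied to w². The inequality is squared so that
all dimensions share the form C m^(4-d) K^d. -/
theorem gagliardo_two : ∃ C : ℝ, 0 ≤ C ∧ ∀ w : Space 2 → ℝ, ContDiff ℝ ∞ w →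
    HasCompactSupport w →
      (∫ x, w x ^ 4) ^ 2 ≤ C * ((∫ x, w x ^ 2) ^ 2 * kinetic (toC w) ^ 2) := by
  obtain ⟨C, hC0, hC⟩ := exists_integral_sq_le_two
  refine ⟨16 * C ^ 2, by positivity, fun w hw hc => ?_⟩
  have h1 := hC (fun x => w x ^ 2) (hw.pow 2) (hasCompactSupport_sq hc)
  have h2 := integral_mul_fderiv_le hw hc
  have e : ∀ x, (w x ^ 2) ^ 2 = w x ^ 4 := fun x => by ring
  simp_rw [e] at h1
  have hm : 0 ≤ ∫ x, w x ^ 2 := integral_nonneg fun x => sq_nonneg _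
  have hK := kinetic_nonneg (toC w)
  have h3 : ∫ x, w x ^ 4 ≤ 4 * C * ((∫ x, w x ^ 2) * kinetic (toC w)) := by
    calc _ ≤ C * (2 * (√(∫ x, w x ^ 2) * √(kinetic (toC w)))) ^ 2 := by
          refine h1.trans ?_
          gcongr
      _ = _ := by rw [mul_pow, mul_pow, Real.sq_sqrt hm, Real.sq_sqrt hK]; ring
  have h4 : 0 ≤ ∫ x, w x ^ 4 := integral_nonneg fun x => by positivity
  calc _ ≤ (4 * C * ((∫ x, w x ^ 2) * kinetic (toC w))) ^ 2 := by gcongr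
    _ = _ := by ring

/-- The Sobolev embedding into L⁶, and ∫ w⁴ = ∫ w · w³ ≤ ‖w‖₂ ‖w‖₆³. -/
theorem gagliardo_three : ∃ C : ℝ, 0 ≤ C ∧ ∀ w : Space 3 → ℝ, ContDiff ℝ ∞ w →
    HasCompactSupport w →
      (∫ x, w x ^ 4) ^ 2 ≤ C * ((∫ x, w x ^ 2) ^ 1 * kinetic (toC w) ^ 3) := by
  set A := SNormLESNormFDerivOfEqConst ℝ (volume : Measure (Space 3)) 2
  refine ⟨(A : ℝ) ^ 6, by positivity, fun w hw hc => ?_⟩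
  have hK := kinetic_nonneg (toC w)
  have h := eLpNorm_le_eLpNorm_fderiv_of_eq (F := ℝ) volume
    (hw.of_le (by simp) : ContDiff ℝ 1 w) hc (p := 2) (p' := 6) (by norm_num) (by simp)
    (by simp; norm_num)
  have hw6 := memLp_of_contDiff hw hc 6
  have hd2 : MemLp (fun x => fderiv ℝ w x) 2 volume :=
    (hw.continuous_fderiv (by simp)).memLp_of_hasCompactSupport (hc.fderiv ℝ)
  have h6 : 0 ≤ ∫ x, w x ^ 6 := integral_nonneg fun x => by positivity
  have key : ∫ x, w x ^ 6 ≤ (A : ℝ) ^ 6 * kinetic (toC w) ^ 3 := by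
    rw [show ((6 : NNReal) : ENNReal) = 6 by rfl, show ((2 : NNReal) : ENNReal) = 2 by rfl,
      hw6.eLpNorm_eq_integral_rpow_norm (by simp) (by simp),
      hd2.eLpNorm_eq_integral_rpow_norm (by simp) (by simp), ← ENNReal.ofReal_coe_nnreal,
      ← ENNReal.ofReal_mul (NNReal.coe_nonneg _),
      ENNReal.ofReal_le_ofReal_iff (by positivity)] at h
    have e6 : ∀ x, ‖w x‖ ^ (ENNReal.toReal 6) = w x ^ 6 := by
      intro x
      rw [show ENNReal.toReal 6 = ((6 : ℕ) : ℝ) by simp, Real.rpow_natCast, Real.norm_eq_abs]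
      exact Even.pow_abs (by decide) _
    have e2 : ∀ x, ‖fderiv ℝ w x‖ ^ (ENNReal.toReal 2) = ‖fderiv ℝ w x‖ ^ 2 := by
      intro x
      rw [show ENNReal.toReal 2 = ((2 : ℕ) : ℝ) by simp, Real.rpow_natCast]
    simp_rw [e6, e2, ← kinetic_of_contDiff hw hc] at h
    have h7 := pow_le_pow_left₀ (by positivity) h 6
    rw [mul_pow, ← Real.rpow_natCast, ← Real.rpow_mul h6, ← Real.rpow_natCast
      (kinetic (toC w) ^ _), ← Real.rpow_mul hK] at h7
    have a1 : (ENNReal.toReal 6)⁻¹ * ((6 : ℕ) : ℝ) = 1 := by simp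
    have a2 : (ENNReal.toReal 2)⁻¹ * ((6 : ℕ) : ℝ) = ((3 : ℕ) : ℝ) := by norm_num
    rw [a1, a2, Real.rpow_one, Real.rpow_natCast] at h7
    exact h7
  have hw2 := memLp_of_contDiff hw hc 2
  have hw3 : MemLp (fun x => w x ^ 3) 2 volume :=
    memLp_of_contDiff (hw.pow 3) (hc.comp_left (g := fun t : ℝ => t ^ 3) (by simp)) 2
  have h8 := abs_integral_mul_le hw2 hw3
  have e3 : ∀ x, w x * w x ^ 3 = w x ^ 4 := fun x => by ring
  have e4 : ∀ x, (w x ^ 3) ^ 2 = w x ^ 6 := fun x => by ring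
  simp_rw [e3, e4] at h8
  have hm : 0 ≤ ∫ x, w x ^ 2 := integral_nonneg fun x => sq_nonneg _
  calc (∫ x, w x ^ 4) ^ 2 = |∫ x, w x ^ 4| ^ 2 := (sq_abs _).symm
    _ ≤ (√(∫ x, w x ^ 2) * √(∫ x, w x ^ 6)) ^ 2 := by gcongr
    _ = (∫ x, w x ^ 2) * ∫ x, w x ^ 6 := by rw [mul_pow, Real.sq_sqrt hm, Real.sq_sqrt h6]
    _ ≤ (∫ x, w x ^ 2) * ((A : ℝ) ^ 6 * kinetic (toC w) ^ 3) := by gcongr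
    _ = _ := by ring

/-- The embedding `W^{1,1}(ℝ) ⊂ L^∞`. -/
theorem abs_le_integral_fderiv_one {v : Space 1 → ℝ} (hv : ContDiff ℝ ∞ v)
    (hc : HasCompactSupport v) (x : Space 1) : |v x| ≤ ∫ y, ‖fderiv ℝ v y‖ := by
  -- `Space 1` is a function space on one index; this measure preserving closed embedding transports
  -- the one-variable fundamental theorem of calculus.
  set ι : ℝ → Space 1 := fun t => t • EuclideanSpace.single 0 (1 : ℝ) with hι
  have hιs : ContDiff ℝ ∞ ι := contDiff_id.smul contDiff_const
  have hmp : MeasurePreserving ι volume volume := by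
    have h1 := ((EuclideanSpace.volume_preserving_symm_measurableEquiv_toLp (Fin 1)).symm _).comp
      ((volume_preserving_funUnique (Fin 1) ℝ).symm _)
    have h2 : ι = (MeasurableEquiv.toLp 2 (Fin 1 → ℝ)).symm.symm ∘
        (MeasurableEquiv.funUnique (Fin 1) ℝ).symm := by
      funext t
      ext i
      fin_cases i
      simp [hι, MeasurableEquiv.funUnique]
    rw [h2]
    exact h1
  have hemb : IsClosedEmbedding ι := by
    refine (LinearMap.isClosedEmbedding_of_injective (f := LinearMap.toSpanSingleton ℝ (Space 1)
      (EuclideanSpace.single 0 (1 : ℝ))) ?_)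
    exact LinearMap.ker_toSpanSingleton ℝ (by simp)
  have h1 := HasCompactSupport.enorm_le_lintegral_Ici_deriv
    ((hv.comp hιs).of_le (by simp)) (hc.comp_isClosedEmbedding hemb) (x 0)
  have hx : ι (x 0) = x := by
    ext i
    fin_cases i
    simp [hι]
  have hd : Integrable (fun x => ‖fderiv ℝ v x‖) :=
    (hv.continuous_fderiv (by simp)).norm.integrable_of_hasCompactSupport (hc.fderiv ℝ).norm
  have h2 : ∀ t, ‖deriv (v ∘ ι) t‖ₑ ≤ ‖fderiv ℝ v (ι t)‖ₑ := by
    intro t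
    have h3 : HasDerivAt ι (EuclideanSpace.single 0 (1 : ℝ)) t := by
      simpa using (hasDerivAt_id t).smul_const (EuclideanSpace.single (0 : Fin 1) (1 : ℝ))
    have h4 := ((hv.differentiable (by simp)).differentiableAt (x := ι t)).hasFDerivAt.comp_hasDerivAt
      t h3
    rw [h4.deriv, enorm_le_iff_norm_le]
    refine ((fderiv ℝ v (ι t)).le_opNorm _).trans ?_
    simp
  have h5 : ‖v x‖ₑ ≤ ENNReal.ofReal (∫ y, ‖fderiv ℝ v y‖) := by
    calc ‖v x‖ₑ = ‖(v ∘ ι) (x 0)‖ₑ := by rw [Function.comp_apply, hx]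
      _ ≤ ∫⁻ y in Set.Iic (x 0), ‖deriv (v ∘ ι) y‖ₑ := h1
      _ ≤ ∫⁻ y, ‖deriv (v ∘ ι) y‖ₑ := setLIntegral_le_lintegral _ _
      _ ≤ ∫⁻ y, ‖fderiv ℝ v (ι y)‖ₑ := lintegral_mono h2
      _ = ∫⁻ y, ‖fderiv ℝ v y‖ₑ :=
          hmp.lintegral_comp (hv.continuous_fderiv (by simp)).enorm.measurable
      _ = _ := by
          rw [ofReal_integral_eq_lintegral_ofReal hd (Eventually.of_forall fun x => norm_nonneg _)]
          simp_rw [ofReal_norm]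
  rw [← ofReal_norm, ENNReal.ofReal_le_ofReal_iff
    (integral_nonneg fun x => norm_nonneg _)] at h5
  simpa using h5

theorem gagliardo_one {w : Space 1 → ℝ} (hw : ContDiff ℝ ∞ w) (hc : HasCompactSupport w) :
    (∫ x, w x ^ 4) ^ 2 ≤ 4 * ((∫ x, w x ^ 2) ^ 3 * kinetic (toC w) ^ 1) := by
  have hw2 := memLp_of_contDiff hw hc 2
  have hm : 0 ≤ ∫ x, w x ^ 2 := integral_nonneg fun x => sq_nonneg _
  have hK := kinetic_nonneg (toC w)
  have h1 := integral_mul_fderiv_le hw hc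
  set B := 2 * (√(∫ x, w x ^ 2) * √(kinetic (toC w))) with hB
  have h2 : ∀ x, w x ^ 2 ≤ B := fun x =>
    (le_abs_self _).trans ((abs_le_integral_fderiv_one (hw.pow 2) (hasCompactSupport_sq hc) x).trans
      h1)
  have h3 : ∫ x, w x ^ 4 ≤ B * ∫ x, w x ^ 2 := by
    rw [← integral_const_mul]
    refine integral_mono_of_nonneg (Eventually.of_forall fun x => by positivity)
      (hw2.integrable_sq.const_mul B) (Eventually.of_forall fun x => ?_)
    have := mul_le_mul_of_nonneg_right (h2 x) (sq_nonneg (w x))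
    simp only
    linarith [show w x ^ 4 = w x ^ 2 * w x ^ 2 by ring]
  have h4 : 0 ≤ ∫ x, w x ^ 4 := integral_nonneg fun x => by positivity
  calc _ ≤ (B * ∫ x, w x ^ 2) ^ 2 := by gcongr
    _ = _ := by
      rw [hB, mul_pow, mul_pow, mul_pow, Real.sq_sqrt hm, Real.sq_sqrt hK]; ring

/-- The Gagliardo–Nirenberg inequality in dimensions one to three. -/
theorem exists_gagliardo_nirenberg (hd1 : 1 ≤ d) (hd3 : d ≤ 3) : ∃ C : ℝ, 0 ≤ C ∧
    ∀ u : Space d → ℝ, MemH1 (toC u) → Integrable (fun x => u x ^ 4) ∧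
      (∫ x, u x ^ 4) ^ 2 ≤ C * ((∫ x, u x ^ 2) ^ (4 - d) * kinetic (toC u) ^ d) := by
  have hsmooth : ∃ C : ℝ, 0 ≤ C ∧ ∀ w : Space d → ℝ, ContDiff ℝ ∞ w → HasCompactSupport w →
      (∫ x, w x ^ 4) ^ 2 ≤ C * ((∫ x, w x ^ 2) ^ (4 - d) * kinetic (toC w) ^ d) := by
    interval_cases d
    · exact ⟨4, by norm_num, fun w hw hc => gagliardo_one hw hc⟩
    · exact gagliardo_two
    · exact gagliardo_three
  obtain ⟨C, hC0, hC⟩ := hsmooth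
  refine ⟨C, hC0, fun u hu => ?_⟩
  obtain ⟨w, K, hws, hwc, hlim, hae, hK, hKlim⟩ := exists_contDiff_seq hu
  have hu2 := memLp_of_toC hu.1
  have hm := tendsto_integral_sq (fun n => memLp_of_contDiff (hws n) (hwc n) 2) hu2 hlim
  set B : ℕ → ℝ := fun n => √(C * ((∫ x, w n x ^ 2) ^ (4 - d) * K n ^ d))
  have hB : Tendsto B atTop (𝓝 √(C * ((∫ x, u x ^ 2) ^ (4 - d) * kinetic (toC u) ^ d))) :=
    (Real.continuous_sqrt.tendsto _).comp (((hm.pow _).mul (hKlim.pow _)).const_mul C)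
  -- Fatou's lemma gives at once the integrability of u⁴ and the inequality for the limit.
  have h1 := integral_le_of_tendsto_ae (f := fun n x => w n x ^ 4) (g := fun x => u x ^ 4) (B := B)
    (fun n => ((hws n).pow 4).continuous.integrable_of_hasCompactSupport
      ((hwc n).comp_left (g := fun t : ℝ => t ^ 4) (by simp)))
    (fun n x => by positivity) (hae.mono fun x hx => hx.pow 4) (fun n => ?_) hB
  · refine ⟨h1.1, ?_⟩
    have h2 : 0 ≤ ∫ x, u x ^ 4 := integral_nonneg fun x => by positivity
    have h3 : 0 ≤ C * ((∫ x, u x ^ 2) ^ (4 - d) * kinetic (toC u) ^ d) := by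
      have := kinetic_nonneg (toC u)
      have : 0 ≤ ∫ x, u x ^ 2 := integral_nonneg fun x => sq_nonneg _
      positivity
    rw [← Real.sq_sqrt h3]
    gcongr
    exact h1.2
  · refine Real.le_sqrt_of_sq_le ((hC (w n) (hws n) (hwc n)).trans ?_)
    have : 0 ≤ ∫ x, w n x ^ 2 := integral_nonneg fun x => sq_nonneg _
    have := kinetic_nonneg (toC (w n))
    gcongr
    exact hK n

end
end TwoComponentBEC

/-! ### Reduction to real pairs, and the direct method. -/

namespace TwoComponentBEC
noncomputable section
variable {d : ℕ}

/-- The real one-component constraint set. -/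
structure Adm (V : Space d → ℝ) (m : ℝ) (u : Space d → ℝ) : Prop where
  memH1 : MemH1 (toC u)
  pot : Integrable fun x => V x * u x ^ 2
  mass : ∫ x, u x ^ 2 = m

theorem Adm.memLp {V : Space d → ℝ} {m : ℝ} {u : Space d → ℝ} (h : Adm V m u) :
    MemLp u 2 volume := memLp_of_toC h.memH1.1

/-- The energy of a pair of real functions, written as a sum of its parts. -/
def realEnergy (Vu Vd : Space d → ℝ) (βuu βud βdd : ℝ) (u v : Space d → ℝ) : ℝ :=
  (1 / 2) * kinetic (toC u) + (∫ x, Vu x * u x ^ 2) + ((1 / 2) * kinetic (toC v) +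
    ∫ x, Vd x * v x ^ 2) + (1 / 2) * βuu * (∫ x, u x ^ 4) + (1 / 2) * βdd * (∫ x, v x ^ 4) +
    βud * ∫ x, u x ^ 2 * v x ^ 2

/-- Minimizing pairs of real functions. -/
structure IsMin (Vu Vd : Space d → ℝ) (βuu βud βdd ν : ℝ) (u v : Space d → ℝ) : Prop where
  admu : Adm Vu ν u
  admv : Adm Vd (1 - ν) v
  le : ∀ u' v', Adm Vu ν u' → Adm Vd (1 - ν) v' →
    realEnergy Vu Vd βuu βud βdd u v ≤ realEnergy Vu Vd βuu βud βdd u' v'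

theorem realEnergy_swap (Vu Vd : Space d → ℝ) (βuu βud βdd : ℝ) (u v : Space d → ℝ) :
    realEnergy Vd Vu βdd βud βuu v u = realEnergy Vu Vd βuu βud βdd u v := by
  unfold realEnergy
  simp_rw [mul_comm (v _ ^ 2) (u _ ^ 2)]
  ring

/-- Exchanging the components replaces ν by 1 - ν, so whatever is shown for the first component
holds for the second. -/
theorem IsMin.swap {Vu Vd : Space d → ℝ} {βuu βud βdd ν : ℝ} {u v : Space d → ℝ}
    (h : IsMin Vu Vd βuu βud βdd ν u v) : IsMin Vd Vu βdd βud βuu (1 - ν) v u where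
  admu := h.admv
  admv := by simpa using h.admu
  le u' v' hu hv := by
    rw [realEnergy_swap Vu Vd, realEnergy_swap Vu Vd]
    exact h.le _ _ (by simpa using hv) hu

theorem memLp_sq_of_integrable {α : Type*} [MeasurableSpace α] {μ : Measure α} {u : α → ℝ}
    (hu : AEStronglyMeasurable u μ) (h4 : Integrable (fun x => u x ^ 4) μ) :
    MemLp (fun x => u x ^ 2) 2 μ := by
  refine (memLp_two_iff_integrable_sq (hu.pow 2)).2 (h4.congr (Eventually.of_forall fun x => ?_))
  simp only [Pi.pow_apply]
  ring

theorem MemH1.memLp_sq {u : Space d → ℝ} (hd1 : 1 ≤ d) (hd3 : d ≤ 3) (hu : MemH1 (toC u)) :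
    MemLp (fun x => u x ^ 2) 2 volume := by
  obtain ⟨C, -, hC⟩ := exists_gagliardo_nirenberg hd1 hd3
  exact memLp_sq_of_integrable (memLp_of_toC hu.1).1 (hC u hu).1

theorem integrable_four {α : Type*} [MeasurableSpace α] {μ : Measure α} {u : α → ℝ}
    (h : MemLp (fun x => u x ^ 2) 2 μ) : Integrable (fun x => u x ^ 4) μ :=
  h.integrable_sq.congr (Eventually.of_forall fun x => by simp only; ring)

theorem MemH1.integral_gradSq {f : Space d → ℂ} (hf : MemH1 f) :
    Integrable (gradSq f) ∧ ∫ x, gradSq f x = kinetic f := by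
  have h := fun i => integrable_norm_sq (hf.weakPartial_spec i).1
  refine ⟨integrable_finsetSum _ fun i _ => h i, ?_⟩
  unfold gradSq kinetic kin
  exact integral_finsetSum _ fun i _ => h i

/-- The single integral splits only if each term is integrable; for the quartic terms this is
Gagliardo–Nirenberg, hence the restriction on `d`. -/
theorem energy_eq (hd1 : 1 ≤ d) (hd3 : d ≤ 3) {Vu Vd : Space d → ℝ} (βuu βud βdd : ℝ) {ν : ℝ}
    {Φ : (Space d → ℂ) × (Space d → ℂ)} (hΦ : Φ ∈ admissible Vu Vd ν) :
    energy Vu Vd βuu βud βdd Φ = (1 / 2) * kinetic Φ.1 + (∫ x, Vu x * ‖Φ.1 x‖ ^ 2) +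
      ((1 / 2) * kinetic Φ.2 + ∫ x, Vd x * ‖Φ.2 x‖ ^ 2) + (1 / 2) * βuu * (∫ x, ‖Φ.1 x‖ ^ 4) +
      (1 / 2) * βdd * (∫ x, ‖Φ.2 x‖ ^ 4) + βud * ∫ x, ‖Φ.1 x‖ ^ 2 * ‖Φ.2 x‖ ^ 2 := by
  obtain ⟨h1, h2, hp1, hp2, -, -⟩ := hΦ
  have q1 := h1.norm.1.memLp_sq hd1 hd3
  have q2 := h2.norm.1.memLp_sq hd1 hd3
  have k1 := h1.integral_gradSq
  have k2 := h2.integral_gradSq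
  have i1 : Integrable fun x => (1 / 2) * gradSq Φ.1 x + Vu x * ‖Φ.1 x‖ ^ 2 :=
    (k1.1.const_mul _).add hp1
  have i2 : Integrable fun x => (1 / 2) * gradSq Φ.2 x + Vd x * ‖Φ.2 x‖ ^ 2 :=
    (k2.1.const_mul _).add hp2
  have i3 : Integrable fun x => (1 / 2) * βuu * ‖Φ.1 x‖ ^ 4 := (integrable_four q1).const_mul _
  have i4 : Integrable fun x => (1 / 2) * βdd * ‖Φ.2 x‖ ^ 4 := (integrable_four q2).const_mul _
  have i5 : Integrable fun x => βud * (‖Φ.1 x‖ ^ 2 * ‖Φ.2 x‖ ^ 2) :=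
    (integrable_mul_of_memLp_two q1 q2).const_mul _
  unfold energy
  have i6 := i1.add i2
  have i7 := i6.add i3
  have i8 := i7.add i4
  simp only [Pi.add_def] at i6 i7 i8
  rw [integral_add i8 i5, integral_add i7 i4, integral_add i6 i3, integral_add i1 i2, integral_add (k1.1.const_mul _) hp1,
    integral_add (k2.1.const_mul _) hp2]
  simp only [integral_const_mul, k1.2, k2.2]

theorem admissible_norm {Vu Vd : Space d → ℝ} {ν : ℝ}
    {Φ : (Space d → ℂ) × (Space d → ℂ)} (hΦ : Φ ∈ admissible Vu Vd ν) :
    Adm Vu ν (fun x => ‖Φ.1 x‖) ∧ Adm Vd (1 - ν) (fun x => ‖Φ.2 x‖) := by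
  obtain ⟨h1, h2, hp1, hp2, hm1, hm2⟩ := hΦ
  exact ⟨⟨h1.norm.1, hp1, hm1⟩, ⟨h2.norm.1, hp2, hm2⟩⟩

theorem realEnergy_norm_le (hd1 : 1 ≤ d) (hd3 : d ≤ 3) {Vu Vd : Space d → ℝ} (βuu βud βdd : ℝ)
    {ν : ℝ} {Φ : (Space d → ℂ) × (Space d → ℂ)} (hΦ : Φ ∈ admissible Vu Vd ν) :
    realEnergy Vu Vd βuu βud βdd (fun x => ‖Φ.1 x‖) (fun x => ‖Φ.2 x‖) ≤
      energy Vu Vd βuu βud βdd Φ := by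
  rw [energy_eq hd1 hd3 βuu βud βdd hΦ, realEnergy]
  have h1 := hΦ.1.kinetic_norm_le
  have h2 := hΦ.2.1.kinetic_norm_le
  linarith

theorem admissible_phase {Vu Vd : Space d → ℝ} {ν : ℝ} {u v : Space d → ℝ} (hu : Adm Vu ν u)
    (hv : Adm Vd (1 - ν) v) {a b : ℂ} (ha : ‖a‖ = 1) (hb : ‖b‖ = 1) :
    ((fun x => a * toC u x, fun x => b * toC v x) : (Space d → ℂ) × (Space d → ℂ)) ∈
      admissible Vu Vd ν := by
  refine ⟨(hu.memH1.const_mul a).1, (hv.memH1.const_mul b).1, ?_, ?_, ?_, ?_⟩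
  · simpa [ha] using hu.pot
  · simpa [hb] using hv.pot
  · simpa [ha] using hu.mass
  · simpa [hb] using hv.mass

theorem energy_phase (hd1 : 1 ≤ d) (hd3 : d ≤ 3) {Vu Vd : Space d → ℝ} (βuu βud βdd : ℝ) {ν : ℝ}
    {u v : Space d → ℝ} (hu : Adm Vu ν u) (hv : Adm Vd (1 - ν) v) {a b : ℂ} (ha : ‖a‖ = 1)
    (hb : ‖b‖ = 1) :
    energy Vu Vd βuu βud βdd (fun x => a * toC u x, fun x => b * toC v x) =
      realEnergy Vu Vd βuu βud βdd u v := by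
  rw [energy_eq hd1 hd3 βuu βud βdd (admissible_phase hu hv ha hb), realEnergy]
  have e1 : kinetic (fun x => a * toC u x) = kinetic (toC u) := by
    unfold kinetic
    simp only [(hu.memH1.const_mul a).2, ha, one_pow, one_mul]
  have e2 : kinetic (fun x => b * toC v x) = kinetic (toC v) := by
    unfold kinetic
    simp only [(hv.memH1.const_mul b).2, hb, one_pow, one_mul]
  have e4 : ∀ t : ℝ, |t| ^ 4 = t ^ 4 := fun t => Even.pow_abs (by decide) t
  simp [e1, e2, ha, hb, e4]

/-- Any real competitor is an admissible complex pair of the same energy, while the moduli of Φ have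
at most the energy of Φ. With `isGroundState_of_isMin` this gives the assertion about phases. -/
theorem isMin_norm_of_isGroundState (hd1 : 1 ≤ d) (hd3 : d ≤ 3) {Vu Vd : Space d → ℝ}
    {βuu βud βdd ν : ℝ} {Φ : (Space d → ℂ) × (Space d → ℂ)}
    (h : IsGroundState Vu Vd βuu βud βdd ν Φ) :
    IsMin Vu Vd βuu βud βdd ν (fun x => ‖Φ.1 x‖) (fun x => ‖Φ.2 x‖) where
  admu := (admissible_norm h.1).1
  admv := (admissible_norm h.1).2
  le u' v' hu hv := by
    refine (realEnergy_norm_le hd1 hd3 βuu βud βdd h.1).trans ?_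
    rw [← energy_phase hd1 hd3 βuu βud βdd hu hv norm_one norm_one]
    exact h.2 _ (admissible_phase hu hv norm_one norm_one)

theorem isGroundState_of_isMin (hd1 : 1 ≤ d) (hd3 : d ≤ 3) {Vu Vd : Space d → ℝ}
    {βuu βud βdd ν : ℝ} {u v : Space d → ℝ} (h : IsMin Vu Vd βuu βud βdd ν u v) {a b : ℂ}
    (ha : ‖a‖ = 1) (hb : ‖b‖ = 1) :
    IsGroundState Vu Vd βuu βud βdd ν (fun x => a * toC u x, fun x => b * toC v x) := by
  refine ⟨admissible_phase h.admu h.admv ha hb, fun Ψ hΨ => ?_⟩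
  rw [energy_phase hd1 hd3 βuu βud βdd h.admu h.admv ha hb]
  exact (h.le _ _ (admissible_norm hΨ).1 (admissible_norm hΨ).2).trans
    (realEnergy_norm_le hd1 hd3 βuu βud βdd hΨ)

theorem integrable_mul_sq_of_contDiff {V : Space d → ℝ} (hV : LocallyIntegrable V volume)
    {w : Space d → ℝ} (hw : Continuous w) (hc : HasCompactSupport w) :
    Integrable fun x => V x * w x ^ 2 := by
  have := hV.integrable_smul_right_of_hasCompactSupport (hw.pow 2) (hasCompactSupport_sq hc)
  simpa using this

theorem exists_adm {V : Space d → ℝ} (hV : LocallyIntegrable V volume) {m : ℝ} (hm : 0 ≤ m) :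
    ∃ u, Adm V m u := by
  obtain ⟨χ, L, -, hs, hc, h0, -, h1, -, -⟩ := exists_cutoff (d := d)
  have hpos : 0 < ∫ x, χ x ^ 2 := by
    have hχ2 := (memLp_of_contDiff hs hc 2).integrable_sq
    rw [integral_pos_iff_support_of_nonneg (fun x => sq_nonneg _) hχ2]
    refine lt_of_lt_of_le (Metric.measure_ball_pos volume (0 : Space d) one_pos)
      (measure_mono fun x hx => ?_)
    have : χ x = 1 := h1 x (by simpa using (Metric.mem_ball.1 hx).le)
    simp [Function.mem_support, this]
  set c := √(m / ∫ x, χ x ^ 2)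
  refine ⟨fun x => c * χ x, ((memH1_of_contDiff hs hc).1.const_mul_toC c).1, ?_, ?_⟩
  · have := (integrable_mul_sq_of_contDiff hV hs.continuous hc).const_mul (c ^ 2)
    refine this.congr (Eventually.of_forall fun x => ?_)
    simp only
    ring
  · simp only [mul_pow]
    rw [integral_const_mul, Real.sq_sqrt (by positivity)]
    field_simp

/-- Convergence in `L²` with bounded kinetic energy implies convergence of the squares in `L²`. -/
theorem tendsto_sq_sub_sq (hd1 : 1 ≤ d) (hd3 : d ≤ 3) {u : ℕ → Space d → ℝ} {v : Space d → ℝ}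
    (hu : ∀ n, MemH1 (toC (u n))) (hv : MemH1 (toC v)) {C : ℝ}
    (hC : ∀ n, kinetic (toC (u n)) ≤ C)
    (h : Tendsto (fun n => ∫ x, (u n x - v x) ^ 2) atTop (𝓝 0)) :
    Tendsto (fun n => ∫ x, (u n x ^ 2 - v x ^ 2) ^ 2) atTop (𝓝 0) := by
  obtain ⟨A, hA0, hA⟩ := exists_gagliardo_nirenberg hd1 hd3
  have hu2 := fun n => memLp_of_toC (hu n).1
  have hv2 := memLp_of_toC hv.1
  have hC0 : 0 ≤ C := (kinetic_nonneg _).trans (hC 0)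
  have hm : ∀ n, MemH1 (toC fun x => u n x - v x) := fun n => by
    simpa [← sub_eq_add_neg] using (hu n).add_toC hv (-1)
  have hp : ∀ n, MemH1 (toC fun x => u n x + v x) := fun n => by
    simpa using (hu n).add_toC hv 1
  set K := 2 * C + 2 * kinetic (toC v)
  have hK0 : 0 ≤ K := by have := kinetic_nonneg (toC v); positivity
  have hpar : ∀ n, kinetic (toC fun x => u n x + v x) ≤ K ∧
      kinetic (toC fun x => u n x - v x) ≤ K := fun n => by
    have h1 := (hu n).parallelogram hv
    have h2 := kinetic_nonneg (toC fun x => u n x + v x)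
    have h3 := kinetic_nonneg (toC fun x => u n x - v x)
    have := hC n
    constructor <;> simp only [K] <;> linarith
  set a : ℕ → ℝ := fun n => ∫ x, (u n x - v x) ^ 2 with ha
  have ha0 : ∀ n, 0 ≤ a n := fun n => integral_nonneg fun x => sq_nonneg _
  set b : ℕ → ℝ := fun n => ∫ x, (u n x + v x) ^ 2 with hb
  have hb0 : ∀ n, 0 ≤ b n := fun n => integral_nonneg fun x => sq_nonneg _
  have hblim : Tendsto b atTop (𝓝 (∫ x, (v x + v x) ^ 2)) := by
    refine tendsto_integral_sq (fun n => (hu2 n).add hv2) (hv2.add hv2) ?_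
    simpa using h
  -- u² - v² = (u - v)(u + v): Cauchy–Schwarz in L², then Gagliardo–Nirenberg for each factor, with
  -- kinetic energies bounded through the parallelogram inequality.
  have hbound : ∀ n, ∫ x, (u n x ^ 2 - v x ^ 2) ^ 2 ≤
      √√(A * (a n ^ (4 - d) * K ^ d)) * √√(A * (b n ^ (4 - d) * K ^ d)) := by
    intro n
    have q1 := (hm n).memLp_sq hd1 hd3
    have q2 := (hp n).memLp_sq hd1 hd3
    have h1 := abs_integral_mul_le q1 q2
    have e : ∀ x, (u n x - v x) ^ 2 * (u n x + v x) ^ 2 = (u n x ^ 2 - v x ^ 2) ^ 2 :=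
      fun x => by ring
    have e4 : ∀ t : ℝ, (t ^ 2) ^ 2 = t ^ 4 := fun t => by ring
    simp only [e, e4] at h1
    refine (le_abs_self _).trans (h1.trans ?_)
    have b1 := (hA _ (hm n)).2
    have b2 := (hA _ (hp n)).2
    have n1 := kinetic_nonneg (toC fun x => u n x - v x)
    have n2 := kinetic_nonneg (toC fun x => u n x + v x)
    gcongr
    · refine Real.le_sqrt_of_sq_le (b1.trans ?_)
      have := ha0 n
      gcongr
      exact (hpar n).2
    · refine Real.le_sqrt_of_sq_le (b2.trans ?_)
      have := hb0 n
      gcongr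
      exact (hpar n).1
  refine squeeze_zero (fun n => integral_nonneg fun x => sq_nonneg _) hbound ?_
  have l1 : Tendsto (fun n => √√(A * (a n ^ (4 - d) * K ^ d))) atTop (𝓝 0) := by
    have hcont : Continuous fun t : ℝ => √√(A * (t ^ (4 - d) * K ^ d)) := by fun_prop
    have := (hcont.tendsto 0).comp h
    -- The exponent 4 - d is positive since d ≤ 3, so vanishing L² distance makes this factor
    -- vanish.
    rw [zero_pow (by omega), zero_mul, mul_zero, Real.sqrt_zero, Real.sqrt_zero] at this
    exact this
  have l2 : Tendsto (fun n => √√(A * (b n ^ (4 - d) * K ^ d))) atTop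
      (𝓝 √√(A * ((∫ x, (v x + v x) ^ 2) ^ (4 - d) * K ^ d))) := by
    have hcont : Continuous fun t : ℝ => √√(A * (t ^ (4 - d) * K ^ d)) := by fun_prop
    exact (hcont.tendsto _).comp hblim
  simpa using l1.mul l2

theorem integral_cross_eq {α : Type*} [MeasurableSpace α] {μ : Measure α} {p q : α → ℝ}
    (hp : MemLp p 2 μ) (hq : MemLp q 2 μ) :
    ∫ x, p x * q x ∂μ =
      (1 / 2) * ((∫ x, (p x + q x) ^ 2 ∂μ) - (∫ x, p x ^ 2 ∂μ) - ∫ x, q x ^ 2 ∂μ) := by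
  have i : Integrable (fun x => p x ^ 2 + q x ^ 2) μ := hp.integrable_sq.add hq.integrable_sq
  have e : ∀ x, (p x + q x) ^ 2 = (p x ^ 2 + q x ^ 2) + 2 * (p x * q x) := fun x => by ring
  simp_rw [e]
  rw [integral_add i ((integrable_mul_of_memLp_two hp hq).const_mul 2),
    integral_add hp.integrable_sq hq.integrable_sq, integral_const_mul]
  ring

theorem tendsto_integral_mul {α : Type*} [MeasurableSpace α] {μ : Measure α} {p q : ℕ → α → ℝ}
    {p' q' : α → ℝ} (hp : ∀ n, MemLp (p n) 2 μ) (hq : ∀ n, MemLp (q n) 2 μ) (hp' : MemLp p' 2 μ)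
    (hq' : MemLp q' 2 μ) (h1 : Tendsto (fun n => ∫ x, (p n x - p' x) ^ 2 ∂μ) atTop (𝓝 0))
    (h2 : Tendsto (fun n => ∫ x, (q n x - q' x) ^ 2 ∂μ) atTop (𝓝 0)) :
    Tendsto (fun n => ∫ x, p n x * q n x ∂μ) atTop (𝓝 (∫ x, p' x * q' x ∂μ)) := by
  have l1 := tendsto_integral_sq hp hp' h1
  have l2 := tendsto_integral_sq hq hq' h2
  have l3 : Tendsto (fun n => ∫ x, (p n x + q n x) ^ 2 ∂μ) atTop
      (𝓝 (∫ x, (p' x + q' x) ^ 2 ∂μ)) := by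
    refine tendsto_integral_sq (fun n => (hp n).add (hq n)) (hp'.add hq') ?_
    have hs : Tendsto (fun n => 2 * (∫ x, (p n x - p' x) ^ 2 ∂μ) +
        2 * ∫ x, (q n x - q' x) ^ 2 ∂μ) atTop (𝓝 0) := by
      simpa using (h1.const_mul 2).add (h2.const_mul 2)
    refine squeeze_zero (fun n => integral_nonneg fun x => sq_nonneg _) (fun n => ?_) hs
    have i1 : Integrable (fun x => 2 * (p n x - p' x) ^ 2) μ :=
      ((hp n).sub hp').integrable_sq.const_mul 2
    have i2 : Integrable (fun x => 2 * (q n x - q' x) ^ 2) μ :=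
      ((hq n).sub hq').integrable_sq.const_mul 2
    rw [← integral_const_mul, ← integral_const_mul, ← integral_add i1 i2]
    refine integral_mono (((hp n).add (hq n)).sub (hp'.add hq')).integrable_sq (i1.add i2)
      fun x => ?_
    simp only
    nlinarith [sq_nonneg ((p n x - p' x) - (q n x - q' x))]
  simp_rw [fun n => integral_cross_eq (hp n) (hq n), integral_cross_eq hp' hq']
  exact ((l3.sub l1).sub l2).const_mul _

theorem integral_mul_sq_nonneg {V u : Space d → ℝ} (hV : ∀ x, 0 ≤ V x) :
    0 ≤ ∫ x, V x * u x ^ 2 := integral_nonneg fun x => mul_nonneg (hV x) (sq_nonneg _)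

/-- A lower bound of the energy in terms of a bound of the quartic terms. -/
theorem le_realEnergy (hd1 : 1 ≤ d) (hd3 : d ≤ 3) {Vu Vd : Space d → ℝ} (βuu βud βdd : ℝ)
    {u v : Space d → ℝ} (hu : MemH1 (toC u)) (hv : MemH1 (toC v)) {C : ℝ}
    (hCu : ∫ x, u x ^ 4 ≤ C) (hCv : ∫ x, v x ^ 4 ≤ C) :
    (1 / 2) * kinetic (toC u) + (∫ x, Vu x * u x ^ 2) + ((1 / 2) * kinetic (toC v) +
      ∫ x, Vd x * v x ^ 2) - (|βuu| + |βdd| + |βud|) * C ≤ realEnergy Vu Vd βuu βud βdd u v := by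
  have q1 := hu.memLp_sq hd1 hd3
  have q2 := hv.memLp_sq hd1 hd3
  have n1 : 0 ≤ ∫ x, u x ^ 4 := integral_nonneg fun x => by positivity
  have n2 : 0 ≤ ∫ x, v x ^ 4 := integral_nonneg fun x => by positivity
  have n3 : 0 ≤ ∫ x, u x ^ 2 * v x ^ 2 := integral_nonneg fun x => by positivity
  have h3 : ∫ x, u x ^ 2 * v x ^ 2 ≤ C := by
    have h := abs_integral_mul_le q1 q2
    have e4 : ∀ t : ℝ, (t ^ 2) ^ 2 = t ^ 4 := fun t => by ring
    simp only [e4] at h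
    have s1 := Real.sqrt_le_sqrt hCu
    have s2 := Real.sqrt_le_sqrt hCv
    calc _ ≤ √(∫ x, u x ^ 4) * √(∫ x, v x ^ 4) := (le_abs_self _).trans h
      _ ≤ √C * √C := by gcongr
      _ = C := Real.mul_self_sqrt (n1.trans hCu)
  have bound : ∀ β t : ℝ, 0 ≤ t → t ≤ C → -(|β| * C) ≤ β * t := by
    intro β t h0 h1
    have := neg_abs_le β
    nlinarith [abs_nonneg β]
  have b1 := bound βuu _ n1 hCu
  have b2 := bound βdd _ n2 hCv
  have b3 := bound βud _ n3 h3
  have hC0 : 0 ≤ C := n1.trans hCu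
  have := mul_nonneg (abs_nonneg βuu) hC0
  have := mul_nonneg (abs_nonneg βdd) hC0
  unfold realEnergy
  nlinarith

/-- Existence of minimizers when the quartic terms are controlled by the energy. -/
theorem exists_isMin (hd1 : 1 ≤ d) (hd3 : d ≤ 3) {Vu Vd : Space d → ℝ}
    (hVu_int : LocallyIntegrable Vu volume) (hVd_int : LocallyIntegrable Vd volume)
    (hVu_nonneg : ∀ x, 0 ≤ Vu x) (hVd_nonneg : ∀ x, 0 ≤ Vd x)
    (hVu_lim : Tendsto Vu (cocompact (Space d)) atTop)
    (hVd_lim : Tendsto Vd (cocompact (Space d)) atTop)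
    {βuu βud βdd ν : ℝ} (hν : ν ∈ Set.Ioo (0 : ℝ) 1)
    (hQ : ∀ M : ℝ, ∃ C : ℝ, ∀ u v, Adm Vu ν u → Adm Vd (1 - ν) v →
      realEnergy Vu Vd βuu βud βdd u v ≤ M → ∫ x, u x ^ 4 ≤ C ∧ ∫ x, v x ^ 4 ≤ C) :
    ∃ u v, IsMin Vu Vd βuu βud βdd ν u v := by
  obtain ⟨u₀, hu₀⟩ := exists_adm hVu_int hν.1.le
  obtain ⟨v₀, hv₀⟩ := exists_adm hVd_int (sub_nonneg.2 hν.2.le)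
  -- The extra 1 puts the infimum strictly below `M`, so a minimizing sequence eventually has energy
  -- at most `M` and obeys the quartic bound.
  set M := realEnergy Vu Vd βuu βud βdd u₀ v₀ + 1
  obtain ⟨C, hC⟩ := hQ M
  set B := (|βuu| + |βdd| + |βud|) * C
  have hlow : ∀ u v, Adm Vu ν u → Adm Vd (1 - ν) v → realEnergy Vu Vd βuu βud βdd u v ≤ M →
      (1 / 2) * kinetic (toC u) + (∫ x, Vu x * u x ^ 2) + ((1 / 2) * kinetic (toC v) +
        ∫ x, Vd x * v x ^ 2) - B ≤ realEnergy Vu Vd βuu βud βdd u v := fun u v hu hv h =>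
    le_realEnergy hd1 hd3 βuu βud βdd hu.memH1 hv.memH1 (hC u v hu hv h).1 (hC u v hu hv h).2
  set S : Set ℝ := {r | ∃ u v, Adm Vu ν u ∧ Adm Vd (1 - ν) v ∧
    r = realEnergy Vu Vd βuu βud βdd u v}
  have hSne : S.Nonempty := ⟨_, u₀, v₀, hu₀, hv₀, rfl⟩
  have hSb : BddBelow S := by
    refine ⟨min M (-B), ?_⟩
    rintro r ⟨u, v, hu, hv, rfl⟩
    by_cases h : realEnergy Vu Vd βuu βud βdd u v ≤ M
    · have h1 := hlow u v hu hv h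
      have h2 := kinetic_nonneg (toC u)
      have h3 := kinetic_nonneg (toC v)
      have h4 := integral_mul_sq_nonneg (u := u) hVu_nonneg
      have h5 := integral_mul_sq_nonneg (u := v) hVd_nonneg
      exact (min_le_right _ _).trans (by linarith)
    · exact (min_le_left _ _).trans (not_le.1 h).le
  obtain ⟨r, hr_anti, hr_lim, hrS⟩ := exists_seq_tendsto_sInf hSne hSb
  have hIM : sInf S < M := lt_of_le_of_lt (csInf_le hSb ⟨u₀, v₀, hu₀, hv₀, rfl⟩)
    (by simp [M])
  obtain ⟨N, hN⟩ := (hr_lim.eventually (gt_mem_nhds hIM)).exists_forall_of_atTop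
  choose u v hu hv hruv using fun n => hrS (N + n)
  have hE : Tendsto (fun n => realEnergy Vu Vd βuu βud βdd (u n) (v n)) atTop (𝓝 (sInf S)) := by
    have := hr_lim.comp (tendsto_add_atTop_nat N)
    refine this.congr fun n => ?_
    simp only [Function.comp_apply]
    rw [add_comm n N, hruv]
  have hEM : ∀ n, realEnergy Vu Vd βuu βud βdd (u n) (v n) ≤ M := fun n => by
    rw [← hruv]; exact (hN _ (Nat.le_add_right _ _)).le
  set D := max 1 (2 * (M + B))
  have hpieces : ∀ n, kinetic (toC (u n)) ≤ D ∧ kinetic (toC (v n)) ≤ D ∧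
      ∫ x, Vu x * u n x ^ 2 ≤ D ∧ ∫ x, Vd x * v n x ^ 2 ≤ D := by
    intro n
    have h1 := hlow _ _ (hu n) (hv n) (hEM n)
    have h0 := hEM n
    have h2 := kinetic_nonneg (toC (u n))
    have h3 := kinetic_nonneg (toC (v n))
    have h4 := integral_mul_sq_nonneg (u := u n) hVu_nonneg
    have h5 := integral_mul_sq_nonneg (u := v n) hVd_nonneg
    have h6 : 2 * (M + B) ≤ D := le_max_right _ _
    refine ⟨?_, ?_, ?_, ?_⟩ <;> linarith
  have hD1 : 1 ≤ D := le_max_left _ _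
  -- compactness
  obtain ⟨u', hu', φ₁, hφ₁, hlim₁⟩ := exists_tendsto_subseq (fun n => (hu n).memH1) (C := D)
    (fun n => by rw [(hu n).mass]; linarith [hν.2]) (fun n => (hpieces n).1) hVu_nonneg hVu_lim
    (fun n => (hu n).pot) (fun n => (hpieces n).2.2.1)
  obtain ⟨v', hv', φ₂, hφ₂, hlim₂⟩ := exists_tendsto_subseq
    (u := fun n => v (φ₁ n)) (fun n => (hv _).memH1) (C := D)
    (fun n => by rw [(hv _).mass]; linarith [hν.1]) (fun n => (hpieces _).2.1) hVd_nonneg hVd_lim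
    (fun n => (hv _).pot) (fun n => (hpieces _).2.2.2)
  obtain ⟨φ₃, hφ₃, hae₁⟩ := exists_subseq_tendsto_ae (u := fun n => u (φ₁ (φ₂ n)))
    (fun n => (hu _).memLp) hu' (hlim₁.comp hφ₂.tendsto_atTop)
  obtain ⟨φ₄, hφ₄, hae₂⟩ := exists_subseq_tendsto_ae (u := fun n => v (φ₁ (φ₂ (φ₃ n))))
    (fun n => (hv _).memLp) hv' (hlim₂.comp hφ₃.tendsto_atTop)
  set ψ : ℕ → ℕ := fun n => φ₁ (φ₂ (φ₃ (φ₄ n)))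
  have hψ : StrictMono ψ := hφ₁.comp (hφ₂.comp (hφ₃.comp hφ₄))
  -- convergence of the parts of the energy
  set F : ℕ → ℝ × ℝ × ℝ × ℝ := fun n => (kinetic (toC (u (ψ n))), kinetic (toC (v (ψ n))),
    ∫ x, Vu x * u (ψ n) x ^ 2, ∫ x, Vd x * v (ψ n) x ^ 2)
  have hF : ∀ n, F n ∈ Set.Icc (0 : ℝ × ℝ × ℝ × ℝ) (D, D, D, D) := fun n =>
    ⟨⟨kinetic_nonneg _, kinetic_nonneg _, integral_mul_sq_nonneg hVu_nonneg,
      integral_mul_sq_nonneg hVd_nonneg⟩,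
      ⟨(hpieces _).1, (hpieces _).2.1, (hpieces _).2.2.1, (hpieces _).2.2.2⟩⟩
  obtain ⟨⟨k₁, k₂, p₁, p₂⟩, -, φ, hφ, hFlim⟩ := isCompact_Icc.tendsto_subseq hF
  have hk₁ := (continuous_fst.tendsto _).comp hFlim
  have hk₂ := (continuous_fst.tendsto _).comp ((continuous_snd.tendsto _).comp hFlim)
  have hp₁ := (continuous_fst.tendsto _).comp
    ((continuous_snd.tendsto _).comp ((continuous_snd.tendsto _).comp hFlim))
  have hp₂ := (continuous_snd.tendsto _).comp
    ((continuous_snd.tendsto _).comp ((continuous_snd.tendsto _).comp hFlim))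
  set τ : ℕ → ℕ := fun n => ψ (φ n) with hτ
  have hτ_mono : StrictMono τ := hψ.comp hφ
  have L₁ : Tendsto (fun n => ∫ x, (u (τ n) x - u' x) ^ 2) atTop (𝓝 0) :=
    hlim₁.comp ((hφ₂.comp (hφ₃.comp (hφ₄.comp hφ))).tendsto_atTop)
  have L₂ : Tendsto (fun n => ∫ x, (v (τ n) x - v' x) ^ 2) atTop (𝓝 0) :=
    hlim₂.comp ((hφ₃.comp (hφ₄.comp hφ)).tendsto_atTop)
  have A₁ : ∀ᵐ x, Tendsto (fun n => u (τ n) x) atTop (𝓝 (u' x)) :=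
    hae₁.mono fun x hx => hx.comp ((hφ₄.comp hφ).tendsto_atTop)
  have A₂ : ∀ᵐ x, Tendsto (fun n => v (τ n) x) atTop (𝓝 (v' x)) :=
    hae₂.mono fun x hx => hx.comp hφ.tendsto_atTop
  have K₁ := kinetic_le_of_tendsto (fun n => (hu (τ n)).memH1) hu' L₁ (fun n => le_rfl) hk₁
  have K₂ := kinetic_le_of_tendsto (fun n => (hv (τ n)).memH1) hv' L₂ (fun n => le_rfl) hk₂
  have P₁ := integral_le_of_tendsto_ae (f := fun n x => Vu x * u (τ n) x ^ 2)
    (g := fun x => Vu x * u' x ^ 2) (fun n => (hu (τ n)).pot)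
    (fun n x => mul_nonneg (hVu_nonneg x) (sq_nonneg _))
    (A₁.mono fun x hx => (hx.pow 2).const_mul _) (fun n => le_rfl) hp₁
  have P₂ := integral_le_of_tendsto_ae (f := fun n x => Vd x * v (τ n) x ^ 2)
    (g := fun x => Vd x * v' x ^ 2) (fun n => (hv (τ n)).pot)
    (fun n x => mul_nonneg (hVd_nonneg x) (sq_nonneg _))
    (A₂.mono fun x hx => (hx.pow 2).const_mul _) (fun n => le_rfl) hp₂
  have au : Adm Vu ν u' := ⟨K₁.1, P₁.1, by
    refine tendsto_nhds_unique (tendsto_integral_sq (fun n => (hu (τ n)).memLp) hu' L₁) ?_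
    simp [(hu _).mass]⟩
  have av : Adm Vd (1 - ν) v' := ⟨K₂.1, P₂.1, by
    refine tendsto_nhds_unique (tendsto_integral_sq (fun n => (hv (τ n)).memLp) hv' L₂) ?_
    simp [(hv _).mass]⟩
  have S₁ := tendsto_sq_sub_sq hd1 hd3 (fun n => (hu (τ n)).memH1) au.memH1
    (fun n => (hpieces _).1) L₁
  have S₂ := tendsto_sq_sub_sq hd1 hd3 (fun n => (hv (τ n)).memH1) av.memH1
    (fun n => (hpieces _).2.1) L₂
  have e4 : ∀ t : ℝ, t ^ 2 * t ^ 2 = t ^ 4 := fun t => by ring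
  have qu := fun n => (hu (τ n)).memH1.memLp_sq hd1 hd3
  have qv := fun n => (hv (τ n)).memH1.memLp_sq hd1 hd3
  have qu' := au.memH1.memLp_sq hd1 hd3
  have qv' := av.memH1.memLp_sq hd1 hd3
  have Q₁ := tendsto_integral_mul qu qu qu' qu' S₁ S₁
  have Q₂ := tendsto_integral_mul qv qv qv' qv' S₂ S₂
  have Q₃ := tendsto_integral_mul qu qv qu' qv' S₁ S₂
  simp only [e4] at Q₁ Q₂
  have hlimE : Tendsto (fun n => realEnergy Vu Vd βuu βud βdd (u (τ n)) (v (τ n))) atTop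
      (𝓝 ((1 / 2) * k₁ + p₁ + ((1 / 2) * k₂ + p₂) + (1 / 2) * βuu * (∫ x, u' x ^ 4) +
        (1 / 2) * βdd * (∫ x, v' x ^ 4) + βud * ∫ x, u' x ^ 2 * v' x ^ 2)) :=
    (((((hk₁.const_mul (1 / 2)).add hp₁).add ((hk₂.const_mul (1 / 2)).add hp₂)).add
      (Q₁.const_mul _)).add (Q₂.const_mul _)).add (Q₃.const_mul _)
  have hI := tendsto_nhds_unique hlimE (hE.comp hτ_mono.tendsto_atTop)
  refine ⟨u', v', au, av, fun u₁ v₁ hu₁ hv₁ => ?_⟩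
  refine le_trans ?_ (csInf_le hSb ⟨u₁, v₁, hu₁, hv₁, rfl⟩)
  rw [← hI, realEnergy]
  have := K₁.2
  have := K₂.2
  have := P₁.2
  have := P₂.2
  linarith

end
end TwoComponentBEC

/-! ### A strong maximum principle without regularity theory. -/

namespace TwoComponentBEC
noncomputable section
variable {d : ℕ}

section Linear

variable {α : Type*} [MeasurableSpace α] {μ : Measure α} {f g h : α → ℝ}

theorem integral_lin_two (a b : ℝ) (hf : Integrable f μ) (hg : Integrable g μ) :
    Integrable (fun x => a * f x + b * g x) μ ∧
      ∫ x, (a * f x + b * g x) ∂μ = a * (∫ x, f x ∂μ) + b * ∫ x, g x ∂μ := by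
  refine ⟨(hf.const_mul a).add (hg.const_mul b), ?_⟩
  rw [integral_add (hf.const_mul a) (hg.const_mul b), integral_const_mul, integral_const_mul]

theorem integral_lin_three (a b c : ℝ) (hf : Integrable f μ) (hg : Integrable g μ)
    (hh : Integrable h μ) : Integrable (fun x => a * f x + b * g x + c * h x) μ ∧
      ∫ x, (a * f x + b * g x + c * h x) ∂μ =
        a * (∫ x, f x ∂μ) + b * (∫ x, g x ∂μ) + c * ∫ x, h x ∂μ := by
  have h2 := integral_lin_two a b hf hg
  refine ⟨h2.1.add (hh.const_mul c), ?_⟩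
  rw [integral_add h2.1 (hh.const_mul c), h2.2, integral_const_mul]

end Linear

/-- The deficit of the increment of `√(f² + ε²)` controls the increment of `f / √(f² + ε²)`. -/
theorem sq_angle_increment_le {a b ε : ℝ} (hε : 0 < ε) :
    ε ^ 2 * (a / √(a ^ 2 + ε ^ 2) - b / √(b ^ 2 + ε ^ 2)) ^ 2 ≤
      (a - b) ^ 2 - (√(a ^ 2 + ε ^ 2) - √(b ^ 2 + ε ^ 2)) ^ 2 := by
  have hA2 : √(a ^ 2 + ε ^ 2) ^ 2 = a ^ 2 + ε ^ 2 := Real.sq_sqrt (by positivity)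
  have hB2 : √(b ^ 2 + ε ^ 2) ^ 2 = b ^ 2 + ε ^ 2 := Real.sq_sqrt (by positivity)
  have hA : ε ≤ √(a ^ 2 + ε ^ 2) := Real.le_sqrt_of_sq_le (by nlinarith [sq_nonneg a])
  have hB : ε ≤ √(b ^ 2 + ε ^ 2) := Real.le_sqrt_of_sq_le (by nlinarith [sq_nonneg b])
  set A := √(a ^ 2 + ε ^ 2)
  set B := √(b ^ 2 + ε ^ 2)
  have hA0 : 0 < A := hε.trans_le hA
  have hB0 : 0 < B := hε.trans_le hB
  -- For vectors p = (a, ε) and q = (b, ε) this is |p - q|² - (|p| - |q|)² = |p| |q| |p/|p| -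
  -- q/|q||²; the second coordinates cancel in p - q.
  have e : (a - b) ^ 2 - (A - B) ^ 2 = A * B * ((a / A - b / B) ^ 2 + (ε / A - ε / B) ^ 2) := by
    have h1 : (a / A - b / B) ^ 2 + (ε / A - ε / B) ^ 2 =
        (a ^ 2 + ε ^ 2) / A ^ 2 + (b ^ 2 + ε ^ 2) / B ^ 2 - 2 * (a * b + ε ^ 2) / (A * B) := by
      field_simp; ring
    rw [h1, ← hA2, ← hB2, div_self (by positivity), div_self (by positivity)]
    field_simp
    nlinarith
  rw [e]
  have h2 : ε ^ 2 ≤ A * B := by nlinarith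
  nlinarith [mul_le_mul_of_nonneg_right h2 (sq_nonneg (a / A - b / B)),
    mul_nonneg (mul_pos hA0 hB0).le (sq_nonneg (ε / A - ε / B))]

theorem exists_cutoff_eq_one (R : ℝ) : ∃ χ : Space d → ℝ, ContDiff ℝ ∞ χ ∧ HasCompactSupport χ ∧
    (∀ x, 0 ≤ χ x) ∧ (∀ x, χ x ≤ 1) ∧ ∀ x, ‖x‖ ≤ R → χ x = 1 := by
  obtain ⟨χ, L, -, hs, hc, h0, h1, hone, -, -⟩ := exists_cutoff (d := d)
  have hR : 0 < |R| + 1 := by positivity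
  refine ⟨fun x => χ ((|R| + 1)⁻¹ • x), hs.comp (contDiff_const_smul _),
    hc.comp_homeomorph (Homeomorph.smulOfNeZero _ (inv_ne_zero hR.ne')), fun x => h0 _,
    fun x => h1 _, fun x hx => hone _ ?_⟩
  rw [norm_smul, Real.norm_of_nonneg (by positivity), inv_mul_le_iff₀ hR]
  linarith [le_abs_self R]

theorem tendsto_slope_integral_test {f : Space d → ℝ} (hf : LocallyIntegrable f volume)
    {η : Space d → ℝ} (hη : ContDiff ℝ ∞ η) (hc : HasCompactSupport η) (v : Space d) {h : ℕ → ℝ}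
    (hne : ∀ n, h n ≠ 0) (h0 : Tendsto h atTop (𝓝 0)) :
    Tendsto (fun n => (h n)⁻¹ * ((∫ x, f x * η (x - h n • v)) - ∫ x, f x * η x)) atTop
      (𝓝 (-∫ x, f x * fderiv ℝ η x v)) := by
  have h1 := (hasDerivAt_integral_test hf hη hc v 0).tendsto_slope_zero
  simp only [zero_smul, sub_zero, zero_add, smul_eq_mul] at h1
  exact h1.comp (tendsto_nhdsWithin_iff.2 ⟨h0, Eventually.of_forall hne⟩)

theorem integral_translate_test {f : Space d → ℝ} (hf : LocallyIntegrable f volume)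
    {η : Space d → ℝ} (hη : ContDiff ℝ ∞ η) (hc : HasCompactSupport η) (v : Space d) :
    (∫ x, f x * η (x - v)) - ∫ x, f x * η x = ∫ x, (f (x + v) - f x) * η x ∧
      Integrable fun x => (f (x + v) - f x) * η x := by
  have i0 : Integrable fun x => f x * η x := by
    simpa using hf.integrable_smul_right_of_hasCompactSupport hη.continuous hc
  have hc' : HasCompactSupport fun x => η (x - v) := hc.comp_homeomorph (Homeomorph.subRight v)
  have i1 : Integrable fun x => f x * η (x - v) := by
    simpa using hf.integrable_smul_right_of_hasCompactSupport
      (hη.continuous.comp (continuous_id.sub continuous_const)) hc'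
  have i2 : Integrable fun x => f (x + v) * η x := by
    simpa using i1.comp_add_right v
  have e : ∫ x, f x * η (x - v) = ∫ x, f (x + v) * η x := by
    rw [← integral_add_right_eq_self _ v]; simp
  rw [e, ← integral_sub i2 i0]
  have e2 : ∀ x, (f (x + v) - f x) * η x = f (x + v) * η x - f x * η x := fun x => by ring
  simp_rw [e2]
  exact ⟨trivial, i2.sub i0⟩

theorem locallyIntegrable_of_bound {f : Space d → ℝ} (hf : AEStronglyMeasurable f volume) {M : ℝ}
    (hM : ∀ x, |f x| ≤ M) : LocallyIntegrable f volume :=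
  (memLp_top_of_bound hf M (Eventually.of_forall hM)).locallyIntegrable (by simp)

theorem memLp_mul_of_bound {f g : Space d → ℝ} (hg : MemLp g 2 volume)
    (hf : AEStronglyMeasurable f volume) (h1 : ∀ x, |f x| ≤ 1) :
    MemLp (fun x => f x * g x) 2 volume := by
  refine hg.of_le (hf.mul hg.1) (Eventually.of_forall fun x => ?_)
  rw [norm_mul]
  exact mul_le_of_le_one_left (norm_nonneg _) (h1 x)

theorem abs_angle_le {a ε : ℝ} : |a / √(a ^ 2 + ε ^ 2)| ≤ 1 := by
  rw [abs_div, abs_of_nonneg (Real.sqrt_nonneg _)]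
  refine div_le_one_of_le₀ (Real.le_sqrt_of_sq_le ?_) (Real.sqrt_nonneg _)
  rw [sq_abs]; nlinarith [sq_nonneg ε]

/-- Since η = 1 on the ball of radius R + 1, increments of √(f² + ε² η²) over steps at most 1 are
those of √(f² + ε²) on the support of ζ. The kinetic deficit is at most (C + kinetic η) ε² and
dominates ε² times the squared increments of f/√(f² + ε²); ε cancels, so the bound is uniform as ε
tends to 0. -/
theorem abs_integral_angle_le {f η ζ : Space d → ℝ} (hf : MemH1 (toC f))
    (hη : ContDiff ℝ ∞ η) (hηc : HasCompactSupport η) {R : ℝ}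
    (hη1 : ∀ x, ‖x‖ ≤ R + 1 → η x = 1) {C ε : ℝ} (hε : 0 < ε)
    (hC : kinetic (toC f) - kinetic (toC fun x => √(1 * f x ^ 2 + ε ^ 2 * η x ^ 2)) ≤ C * ε ^ 2)
    (hζ : ContDiff ℝ ∞ ζ) (hζc : HasCompactSupport ζ) (hζR : ∀ x, ζ x ≠ 0 → ‖x‖ ≤ R)
    (i : Fin d) :
    |∫ x, f x / √(f x ^ 2 + ε ^ 2) * fderiv ℝ ζ x (EuclideanSpace.single i 1)| ≤
      √(C + kinetic (toC η)) * √(∫ x, ζ x ^ 2) := by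
  have hf2 := memLp_of_toC hf.1
  have hη2 := memLp_of_contDiff hη hηc 2
  have hζ2 := memLp_of_contDiff hζ hζc 2
  have hηH := (memH1_of_contDiff hη hηc).1
  set g : Space d → ℝ := fun x => √(1 * f x ^ 2 + ε ^ 2 * η x ^ 2) with hg
  have hgi := memH1_of_increment_le hf hηH
    (memLp_sqrt_combo hf2 hη2 zero_le_one (sq_nonneg ε)) zero_le_one (sq_nonneg ε)
    (fun x y => sqrt_increment_le zero_le_one (sq_nonneg ε))
  have hg2 := memLp_of_toC hgi.1.1
  set s : Space d → ℝ := fun x => f x / √(f x ^ 2 + ε ^ 2) with hs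
  have hsm : AEStronglyMeasurable s volume := by
    have : Measurable fun t : ℝ => t / √(t ^ 2 + ε ^ 2) := by fun_prop
    exact (this.comp_aemeasurable hf2.1.aemeasurable).aestronglyMeasurable
  have hsl := locallyIntegrable_of_bound hsm (M := 1) fun x => abs_angle_le
  set e : Space d := EuclideanSpace.single i 1 with he
  set δ : ℝ → Space d → ℝ := fun h x => 1 * (f (x + h • e) - f x) ^ 2 +
    ε ^ 2 * (η (x + h • e) - η x) ^ 2 - (g (x + h • e) - g x) ^ 2 with hδ
  have hδ0 : ∀ h x, 0 ≤ δ h x := fun h x => by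
    have := sqrt_increment_le (p := f (x + h • e)) (q := η (x + h • e)) (p' := f x) (q' := η x)
      zero_le_one (sq_nonneg ε)
    simp only [hδ, hg]; linarith
  have i1 := fun h : ℝ => (integral_diff_sq_integrable hf2 (h • e)).const_mul 1
  have i2 := fun h : ℝ => (integral_diff_sq_integrable hη2 (h • e)).const_mul (ε ^ 2)
  have i3 := fun h : ℝ => integral_diff_sq_integrable hg2 (h • e)
  have hδi : ∀ h, Integrable (δ h) := fun h => ((i1 h).add (i2 h)).sub (i3 h)
  have hδe : ∀ h, ∫ x, δ h x = 1 * (∫ x, (f (x + h • e) - f x) ^ 2) +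
      ε ^ 2 * (∫ x, (η (x + h • e) - η x) ^ 2) - ∫ x, (g (x + h • e) - g x) ^ 2 := fun h => by
    have := integral_lin_three 1 (ε ^ 2) (-1) (integral_diff_sq_integrable hf2 (h • e))
      (integral_diff_sq_integrable hη2 (h • e)) (i3 h)
    simpa [hδ, hg, sub_eq_add_neg] using this.2
  have hδs : ∀ h : ℝ, |h| ≤ 1 → ∀ x, ‖x‖ ≤ R → ε * |s (x + h • e) - s x| ≤ √(δ h x) := by
    intro h hh x hx
    have hx' : ‖x + h • e‖ ≤ R + 1 := by
      refine (norm_add_le _ _).trans (add_le_add hx ?_)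
      rw [norm_smul]; simpa [he] using hh
    have e1 := hη1 x (by linarith)
    have e2 := hη1 _ hx'
    refine Real.le_sqrt_of_sq_le ?_
    rw [mul_pow, sq_abs]
    have := sq_angle_increment_le (a := f (x + h • e)) (b := f x) hε
    simpa [hδ, hg, hs, e1, e2] using this
  set h : ℕ → ℝ := fun n => 1 / ((n : ℝ) + 1) with hh
  have hh0 : Tendsto h atTop (𝓝 0) := tendsto_one_div_add_atTop_nhds_zero_nat
  have hhp : ∀ n, 0 < h n := fun n => by positivity
  have hh1 : ∀ n, |h n| ≤ 1 := fun n => by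
    rw [abs_of_pos (hhp n)]
    exact div_le_one_of_le₀ (by simp) (by positivity)
  have hlim := (tendsto_slope_integral_test hsl hζ hζc e (fun n => (hhp n).ne') hh0).abs
  have hlim2 : Tendsto (fun n => (∫ x, δ (h n) x) / h n ^ 2) atTop
      (𝓝 (1 * kin i (toC f) + ε ^ 2 * kin i (toC η) - kin i (toC g))) := by
    have := (((hf.tendsto_diff i (fun n => (hhp n).ne') hh0).const_mul 1).add
      ((hηH.tendsto_diff i (fun n => (hhp n).ne') hh0).const_mul (ε ^ 2))).sub
      (hgi.1.tendsto_diff i (fun n => (hhp n).ne') hh0)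
    refine this.congr fun n => ?_
    rw [hδe]; simp only [hg, ← he]; ring
  -- Each direction has a nonnegative deficit, so a single one is bounded by the sum, which the
  -- hypothesis controls.
  have hkin : 1 * kin i (toC f) + ε ^ 2 * kin i (toC η) - kin i (toC g) ≤
      (C + kinetic (toC η)) * ε ^ 2 := by
    have h1 : 1 * kin i (toC f) + ε ^ 2 * kin i (toC η) - kin i (toC g) ≤
        ∑ j, (1 * kin j (toC f) + ε ^ 2 * kin j (toC η) - kin j (toC g)) :=
      Finset.single_le_sum (f := fun j => 1 * kin j (toC f) + ε ^ 2 * kin j (toC η) -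
        kin j (toC g)) (fun j _ => sub_nonneg.2 (hgi.2 j)) (Finset.mem_univ i)
    rw [Finset.sum_sub_distrib, Finset.sum_add_distrib, ← Finset.mul_sum, ← Finset.mul_sum] at h1
    have h2 : (∑ j, kin j (toC f)) - ∑ j, kin j (toC g) ≤ C * ε ^ 2 := hC
    have h3 : kinetic (toC η) = ∑ j, kin j (toC η) := rfl
    rw [h3]; linarith
  have hb : ∀ n, |(h n)⁻¹ * ((∫ x, s x * ζ (x - h n • e)) - ∫ x, s x * ζ x)| ≤
      ε⁻¹ * √((∫ x, δ (h n) x) / h n ^ 2) * √(∫ x, ζ x ^ 2) := by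
    intro n
    have hsd : MemLp (fun x => √(δ (h n) x)) 2 volume := by
      refine (memLp_two_iff_integrable_sq
        (Real.continuous_sqrt.comp_aestronglyMeasurable (hδi _).1)).2 ?_
      simpa only [Real.sq_sqrt (hδ0 _ _)] using hδi (h n)
    have h1 := abs_integral_mul_le (v := fun x => |ζ x|) hsd hζ2.abs
    simp only [Real.sq_sqrt (hδ0 _ _), sq_abs] at h1
    have h2 := integral_translate_test hsl hζ hζc (h n • e)
    rw [h2.1, abs_mul, abs_of_pos (inv_pos.2 (hhp n)), Real.sqrt_div' _ (sq_nonneg _),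
      Real.sqrt_sq (hhp n).le]
    have h3 : ε * |∫ x, (s (x + h n • e) - s x) * ζ x| ≤ ∫ x, √(δ (h n) x) * |ζ x| := by
      rw [← abs_of_pos hε, ← abs_mul, ← integral_const_mul]
      refine (abs_integral_le_integral_abs).trans (integral_mono (h2.2.const_mul ε).abs
        (integrable_mul_of_memLp_two hsd hζ2.abs) fun x => ?_)
      simp only
      by_cases hx : ζ x = 0
      · simp [hx]
      rw [abs_mul, abs_mul, abs_of_pos hε, ← mul_assoc]
      exact mul_le_mul_of_nonneg_right (hδs _ (hh1 n) x (hζR x hx)) (abs_nonneg _)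
    have h4 : |∫ x, (s (x + h n • e) - s x) * ζ x| ≤
        ε⁻¹ * (√(∫ x, δ (h n) x) * √(∫ x, ζ x ^ 2)) := by
      rw [le_inv_mul_iff₀ hε]
      exact h3.trans ((le_abs_self _).trans h1)
    calc _ ≤ (h n)⁻¹ * (ε⁻¹ * (√(∫ x, δ (h n) x) * √(∫ x, ζ x ^ 2))) := by
          gcongr
      _ = _ := by rw [div_eq_mul_inv]; ring
  have hfin := le_of_tendsto_of_tendsto' hlim
    ((((Real.continuous_sqrt.tendsto _).comp hlim2).const_mul ε⁻¹).mul_const _) hb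
  rw [abs_neg] at hfin
  refine hfin.trans ?_
  gcongr
  rw [inv_mul_le_iff₀ hε]
  refine (Real.sqrt_le_sqrt hkin).trans_eq ?_
  rw [Real.sqrt_mul' _ (sq_nonneg _), Real.sqrt_sq hε.le, mul_comm]

/-- As the step vanishes, the angle variable becomes the indicator of positivity. -/
theorem tendsto_angle {a : ℝ} (ha : 0 ≤ a) {h : ℕ → ℝ} (h0 : Tendsto h atTop (𝓝 0)) :
    Tendsto (fun n => a / √(a ^ 2 + h n ^ 2)) atTop (𝓝 (if 0 < a then 1 else 0)) := by
  split_ifs with hp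
  · have h1 : Tendsto (fun n => √(a ^ 2 + h n ^ 2)) atTop (𝓝 √(a ^ 2 + 0 ^ 2)) :=
      (Real.continuous_sqrt.tendsto _).comp (tendsto_const_nhds.add (h0.pow 2))
    have e : √(a ^ 2 + 0 ^ 2) = a := by simp [Real.sqrt_sq ha]
    rw [e] at h1
    have h2 := (tendsto_const_nhds (x := a)).div h1 hp.ne'
    rwa [div_self hp.ne'] at h2
  · have : a = 0 := le_antisymm (not_lt.1 hp) ha
    simp [this]

/-- A measurable set whose indicator has a locally square integrable gradient has a locally
constant indicator. -/
theorem integral_indicator_fderiv_eq_zero {χ : Space d → ℝ} (hm : AEStronglyMeasurable χ volume)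
    (h01 : ∀ x, χ x = 0 ∨ χ x = 1) (hb : ∀ R : ℝ, ∃ D : ℝ, 0 ≤ D ∧ ∀ ζ : Space d → ℝ,
      ContDiff ℝ ∞ ζ → HasCompactSupport ζ → (∀ x, ζ x ≠ 0 → ‖x‖ ≤ R) → ∀ i,
      |∫ x, χ x * fderiv ℝ ζ x (EuclideanSpace.single i 1)| ≤ D * √(∫ x, ζ x ^ 2))
    {ζ : Space d → ℝ} (hζ : ContDiff ℝ ∞ ζ) (hζc : HasCompactSupport ζ) (i : Fin d) :
    ∫ x, χ x * fderiv ℝ ζ x (EuclideanSpace.single i 1) = 0 := by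
  have hχ1 : ∀ x, |χ x| ≤ 1 := fun x => by rcases h01 x with h | h <;> simp [h]
  have hχl := locallyIntegrable_of_bound hm hχ1
  obtain ⟨R, hR⟩ := hζc.isCompact.isBounded.exists_norm_le
  have hζR : ∀ x, ζ x ≠ 0 → ‖x‖ ≤ R := fun x hx => hR x (subset_tsupport _ hx)
  obtain ⟨Z, hZ⟩ := hζc.exists_bound_of_continuous hζ.continuous
  have hZ0 : 0 ≤ Z := (norm_nonneg _).trans (hZ 0)
  obtain ⟨η, hη, hηc, hη0, hη1, hηR⟩ := exists_cutoff_eq_one (d := d) (R + 1)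
  obtain ⟨R', hR'⟩ := hηc.isCompact.isBounded.exists_norm_le
  have hηR' : ∀ x, η x ≠ 0 → ‖x‖ ≤ R' := fun x hx => hR' x (subset_tsupport _ hx)
  obtain ⟨D, hD0, hD⟩ := hb R'
  set e : Space d := EuclideanSpace.single i 1 with he
  set F : Space d → ℝ := fun x => χ x * η x with hF
  have hη2 := memLp_of_contDiff hη hηc 2
  have hF2 : MemLp F 2 volume :=
    memLp_mul_of_bound hη2 hm hχ1
  have hdη2 : MemLp (fun x => fderiv ℝ η x e) 2 volume :=
    ((hη.continuous_fderiv (by simp)).clm_apply continuous_const).memLp_of_hasCompactSupport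
      (hηc.fderiv_apply ℝ _)
  have hG2 : MemLp (fun x => χ x * fderiv ℝ η x e) 2 volume :=
    memLp_mul_of_bound hdη2 hm hχ1
  set G := √(∫ x, (χ x * fderiv ℝ η x e) ^ 2) with hG
  -- The cutoff η makes the local bound global: χη has a weak derivative in L², by the Leibniz rule
  -- on the side of the test functions.
  have hFb : ∀ ξ : Space d → ℝ, ContDiff ℝ ∞ ξ → HasCompactSupport ξ →
      |∫ x, F x * fderiv ℝ ξ x e| ≤ (D + G) * √(∫ x, ξ x ^ 2) := by
    intro ξ hξ hξc
    have hξ2 := memLp_of_contDiff hξ hξc 2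
    have hprod := hD (fun x => η x * ξ x) (hη.mul hξ) hηc.mul_right
      (fun x hx => hηR' x (left_ne_zero_of_mul hx)) i
    have hd : ∀ x, fderiv ℝ (fun x => η x * ξ x) x e =
        η x * fderiv ℝ ξ x e + ξ x * fderiv ℝ η x e := by
      intro x
      have h1 := ((hη.differentiable (by simp)).differentiableAt (x := x)).hasFDerivAt.mul
        ((hξ.differentiable (by simp)).differentiableAt (x := x)).hasFDerivAt
      rw [show (fun x => η x * ξ x) = η * ξ from rfl, h1.fderiv]
      simp
    have hdξ2 : MemLp (fun x => fderiv ℝ ξ x e) 2 volume :=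
      ((hξ.continuous_fderiv (by simp)).clm_apply continuous_const).memLp_of_hasCompactSupport
        (hξc.fderiv_apply ℝ _)
    have e1 : ∫ x, F x * fderiv ℝ ξ x e = (∫ x, χ x * fderiv ℝ (fun x => η x * ξ x) x e) -
        ∫ x, (χ x * fderiv ℝ η x e) * ξ x := by
      have i1 := integrable_mul_of_memLp_two hF2 hdξ2
      have i2 := integrable_mul_of_memLp_two hG2 hξ2
      rw [eq_sub_iff_add_eq, ← integral_add i1 i2]
      congr 1; ext x
      rw [hd]; simp only [hF]; ring
    have h2 := abs_integral_mul_le hG2 hξ2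
    have h3 : √(∫ x, (η x * ξ x) ^ 2) ≤ √(∫ x, ξ x ^ 2) := by
      refine Real.sqrt_le_sqrt (integral_mono_of_nonneg (Eventually.of_forall fun x => sq_nonneg _)
        hξ2.integrable_sq (Eventually.of_forall fun x => ?_))
      simp only [mul_pow]
      exact mul_le_of_le_one_left (sq_nonneg _) (pow_le_one₀ (hη0 x) (hη1 x))
    rw [e1]
    calc _ ≤ _ := abs_sub _ _
      _ ≤ D * √(∫ x, ξ x ^ 2) + G * √(∫ x, ξ x ^ 2) :=
        add_le_add (hprod.trans (mul_le_mul_of_nonneg_left h3 hD0)) h2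
      _ = _ := by ring
  have hFd : ∀ h : ℝ, 0 < h → ∫ x, (F (x + h • e) - F x) ^ 2 ≤ (h * (D + G)) ^ 2 := by
    intro h hh
    refine integral_translate_sub_sq_le_of_bound hF2 (h • e) fun ξ hξ hξc => ?_
    have e1 : ∀ x, F x * fderiv ℝ ξ x (h • e) = h * (F x * fderiv ℝ ξ x e) := fun x => by
      rw [map_smul, smul_eq_mul]; ring
    simp_rw [e1]
    rw [integral_const_mul, abs_mul, abs_of_pos hh, mul_assoc]
    exact mul_le_mul_of_nonneg_left (hFb ξ hξ hξc) hh.le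
  set h : ℕ → ℝ := fun n => 1 / ((n : ℝ) + 1) with hh
  have hh0 : Tendsto h atTop (𝓝 0) := tendsto_one_div_add_atTop_nhds_zero_nat
  have hhp : ∀ n, 0 < h n := fun n => by positivity
  have hh1 : ∀ n, h n ≤ 1 := fun n => div_le_one_of_le₀ (by simp) (by positivity)
  have hlim := (tendsto_slope_integral_test hχl hζ hζc e (fun n => (hhp n).ne') hh0).abs
  have hbd : ∀ n, |(h n)⁻¹ * ((∫ x, χ x * ζ (x - h n • e)) - ∫ x, χ x * ζ x)| ≤
      h n * (Z * (D + G) ^ 2) := by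
    intro n
    have h2 := integral_translate_test hχl hζ hζc (h n • e)
    have i1 := (integral_diff_sq_integrable hF2 (h n • e)).const_mul Z
    -- An increment of an indicator is -1, 0 or 1, so its modulus equals its square. The integral of
    -- the square is O(h²), whereas the difference quotient divides only by h; the derivative
    -- therefore vanishes.
    have h3 : |∫ x, (χ (x + h n • e) - χ x) * ζ x| ≤ Z * (h n * (D + G)) ^ 2 := by
      refine (abs_integral_le_integral_abs.trans (integral_mono h2.2.abs i1 fun x => ?_)).trans ?_
      · simp only
        by_cases hx : ζ x = 0
        · simp [hx, mul_nonneg hZ0 (sq_nonneg _)]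
        have hxR := hζR x hx
        have hx' : ‖x + h n • e‖ ≤ R + 1 := by
          refine (norm_add_le _ _).trans (add_le_add hxR ?_)
          rw [norm_smul, Real.norm_of_nonneg (hhp n).le]; simpa [he] using hh1 n
        rw [abs_mul, hF, mul_comm Z]
        simp only [hηR _ hx', hηR x (by linarith), mul_one]
        refine mul_le_mul ?_ (hZ x) (abs_nonneg _) (sq_nonneg _)
        rcases h01 x with h3 | h3 <;> rcases h01 (x + h n • e) with h4 | h4 <;> rw [h3, h4] <;> simp
      · rw [integral_const_mul]
        exact mul_le_mul_of_nonneg_left (hFd _ (hhp n)) hZ0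
    rw [h2.1, abs_mul, abs_of_pos (inv_pos.2 (hhp n)), inv_mul_le_iff₀ (hhp n)]
    refine h3.trans_eq ?_
    ring
  have hz : Tendsto (fun n => h n * (Z * (D + G) ^ 2)) atTop (𝓝 0) := by
    simpa using hh0.mul_const (Z * (D + G) ^ 2)
  have := le_of_tendsto_of_tendsto' hlim hz hbd
  rw [abs_neg] at this
  exact abs_eq_zero.1 (le_antisymm this (abs_nonneg _))

/-- Pairings with test functions are translation invariant, so every mollification of χ is constant
in space; mollifications converge to χ almost everywhere. -/
theorem ae_eq_const_of_integral_fderiv_eq_zero {χ : Space d → ℝ}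
    (hχ : LocallyIntegrable χ volume) (h : ∀ ζ : Space d → ℝ, ContDiff ℝ ∞ ζ →
      HasCompactSupport ζ → ∀ i, ∫ x, χ x * fderiv ℝ ζ x (EuclideanSpace.single i 1) = 0) :
    ∃ c : ℝ, ∀ᵐ x, χ x = c := by
  have hv : ∀ ζ : Space d → ℝ, ContDiff ℝ ∞ ζ → HasCompactSupport ζ → ∀ v : Space d,
      ∫ x, χ x * fderiv ℝ ζ x v = 0 := by
    intro ζ hζ hζc v
    have e : ∀ x, χ x * fderiv ℝ ζ x v =
        ∑ i, v i * (χ x * fderiv ℝ ζ x (EuclideanSpace.single i 1)) := by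
      intro x
      conv_lhs => rw [← sum_smul_single v]
      rw [map_sum, Finset.mul_sum]
      exact Finset.sum_congr rfl fun i _ => by rw [map_smul, smul_eq_mul]; ring
    simp_rw [e]
    have hi : ∀ i, Integrable fun x => χ x * fderiv ℝ ζ x (EuclideanSpace.single i 1) := fun i => by
      simpa using hχ.integrable_smul_right_of_hasCompactSupport
        ((hζ.continuous_fderiv (by simp)).clm_apply continuous_const)
        (hζc.fderiv_apply ℝ (EuclideanSpace.single i 1))
    rw [integral_finsetSum _ fun i _ => (hi i).const_mul _]
    simp_rw [integral_const_mul, h ζ hζ hζc, mul_zero, Finset.sum_const_zero]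
  have htr : ∀ ζ : Space d → ℝ, ContDiff ℝ ∞ ζ → HasCompactSupport ζ → ∀ v : Space d,
      ∫ x, χ x * ζ (x - v) = ∫ x, χ x * ζ x := by
    intro ζ hζ hζc v
    have hd : ∀ s : ℝ, HasDerivAt (fun s : ℝ => ∫ x, χ x * ζ (x - s • v)) 0 s := by
      intro s
      have h1 := hasDerivAt_integral_test hχ hζ hζc v s
      have h2 := hv (fun x => ζ (x - s • v)) (hζ.comp (contDiff_id.sub contDiff_const))
        (hζc.comp_homeomorph (Homeomorph.subRight (s • v))) v
      simp_rw [sub_eq_add_neg, fderiv_comp_add_right, ← sub_eq_add_neg] at h2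
      simpa [h2] using h1
    have h3 := is_const_of_deriv_eq_zero (fun s => (hd s).differentiableAt)
      (fun s => (hd s).deriv) 1 0
    simpa using h3
  let φ : ℕ → ContDiffBump (0 : Space d) := fun n =>
    ⟨1 / ((n : ℝ) + 1), 2 * (1 / ((n : ℝ) + 1)), by positivity, by
      have : 0 < 1 / ((n : ℝ) + 1) := by positivity
      linarith⟩
  have hφ : Tendsto (fun n => (φ n).rOut) atTop (𝓝 0) := by
    simpa [φ] using (tendsto_one_div_add_atTop_nhds_zero_nat (𝕜 := ℝ)).const_mul 2
  have hae := ContDiffBump.ae_convolution_tendsto_right_of_locallyIntegrable (φ := φ) (μ := volume)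
    (K := 2) hφ (Eventually.of_forall fun n => le_rfl) hχ
  have hconst : ∀ n x, convolution ((φ n).normed volume) χ (ContinuousLinearMap.lsmul ℝ ℝ) volume x
      = ∫ y, χ y * (φ n).normed volume y := by
    intro n x
    rw [← htr _ (φ n).contDiff_normed (φ n).hasCompactSupport_normed x]
    simp only [convolution_def, ContinuousLinearMap.lsmul_apply, smul_eq_mul]
    rw [← integral_sub_left_eq_self _ volume x]
    congr 1; ext t
    rw [← (φ n).normed_neg, sub_sub_cancel, neg_sub, mul_comm]
  simp_rw [hconst] at hae
  obtain ⟨x₀, hx₀⟩ := hae.exists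
  exact ⟨χ x₀, hae.mono fun x hx => tendsto_nhds_unique hx hx₀⟩

/-- A version of the strong maximum principle: a nonnegative function, whose kinetic energy
decreases by at most a multiple of `ε²` when it is changed to `√(f² + ε² η²)`, vanishes almost
everywhere or is positive almost everywhere. -/
theorem ae_eq_zero_or_ae_pos {f : Space d → ℝ} (hf : MemH1 (toC f)) (hf0 : ∀ x, 0 ≤ f x)
    (h : ∀ η : Space d → ℝ, ContDiff ℝ ∞ η → HasCompactSupport η → ∃ C : ℝ, ∀ ε : ℝ, 0 < ε →
      ε ≤ 1 → kinetic (toC f) - kinetic (toC fun x => √(1 * f x ^ 2 + ε ^ 2 * η x ^ 2)) ≤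
        C * ε ^ 2) : (∀ᵐ x, f x = 0) ∨ ∀ᵐ x, 0 < f x := by
  have hf2 := memLp_of_toC hf.1
  set χ : Space d → ℝ := fun x => if 0 < f x then 1 else 0 with hχ
  have h01 : ∀ x, χ x = 0 ∨ χ x = 1 := fun x => by
    simp only [hχ]; split_ifs <;> simp
  have hχ1 : ∀ x, |χ x| ≤ 1 := fun x => by rcases h01 x with h | h <;> simp [h]
  set e : ℕ → ℝ := fun n => 1 / ((n : ℝ) + 1) with he
  have he0 : Tendsto e atTop (𝓝 0) := tendsto_one_div_add_atTop_nhds_zero_nat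
  have hep : ∀ n, 0 < e n := fun n => by positivity
  have he1 : ∀ n, e n ≤ 1 := fun n => div_le_one_of_le₀ (by simp) (by positivity)
  have hptw : ∀ x, Tendsto (fun n => f x / √(f x ^ 2 + e n ^ 2)) atTop (𝓝 (χ x)) := fun x =>
    tendsto_angle (hf0 x) he0
  have hsm : ∀ n, AEStronglyMeasurable (fun x => f x / √(f x ^ 2 + e n ^ 2)) volume := fun n => by
    have : Measurable fun t : ℝ => t / √(t ^ 2 + e n ^ 2) := by fun_prop
    exact (this.comp_aemeasurable hf2.1.aemeasurable).aestronglyMeasurable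
  have hm : AEStronglyMeasurable χ volume :=
    aestronglyMeasurable_of_tendsto_ae atTop hsm (Eventually.of_forall hptw)
  have hb : ∀ R : ℝ, ∃ D : ℝ, 0 ≤ D ∧ ∀ ζ : Space d → ℝ, ContDiff ℝ ∞ ζ → HasCompactSupport ζ →
      (∀ x, ζ x ≠ 0 → ‖x‖ ≤ R) → ∀ i,
      |∫ x, χ x * fderiv ℝ ζ x (EuclideanSpace.single i 1)| ≤ D * √(∫ x, ζ x ^ 2) := by
    intro R
    obtain ⟨η, hη, hηc, -, -, hη1⟩ := exists_cutoff_eq_one (d := d) (R + 1)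
    obtain ⟨C, hC⟩ := h η hη hηc
    refine ⟨√(C + kinetic (toC η)), Real.sqrt_nonneg _, fun ζ hζ hζc hζR i => ?_⟩
    have hi : Integrable fun x => fderiv ℝ ζ x (EuclideanSpace.single i 1) :=
      ((hζ.continuous_fderiv (by simp)).clm_apply continuous_const).integrable_of_hasCompactSupport
        (hζc.fderiv_apply ℝ _)
    have hlim : Tendsto (fun n => ∫ x, f x / √(f x ^ 2 + e n ^ 2) *
        fderiv ℝ ζ x (EuclideanSpace.single i 1)) atTop
        (𝓝 (∫ x, χ x * fderiv ℝ ζ x (EuclideanSpace.single i 1))) := by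
      refine tendsto_integral_of_dominated_convergence _ (fun n => (hsm n).mul hi.1) hi.norm
        (fun n => Eventually.of_forall fun x => ?_)
        (Eventually.of_forall fun x => (hptw x).mul_const _)
      rw [norm_mul]
      exact mul_le_of_le_one_left (norm_nonneg _) abs_angle_le
    exact le_of_tendsto' hlim.abs fun n =>
      abs_integral_angle_le hf hη hηc hη1 (hep n) (hC _ (hep n) (he1 n)) hζ hζc hζR i
  obtain ⟨c, hc⟩ := ae_eq_const_of_integral_fderiv_eq_zero (locallyIntegrable_of_bound hm hχ1)
    fun ζ hζ hζc i => integral_indicator_fderiv_eq_zero hm h01 hb hζ hζc i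
  by_cases h1 : c = 1
  · refine Or.inr (hc.mono fun x hx => ?_)
    by_contra hn
    simp [hχ, hn, h1] at hx
  · refine Or.inl (hc.mono fun x hx => ?_)
    by_contra hn
    have : 0 < f x := lt_of_le_of_ne (hf0 x) (Ne.symm hn)
    simp only [hχ, this, if_true] at hx
    exact h1 hx.symm

end
end TwoComponentBEC

/-! ### Uniqueness of moduli for a positive semidefinite interaction. -/

namespace TwoComponentBEC
noncomputable section
variable {d : ℕ}

theorem integral_sq_eq_zero_iff {u : Space d → ℝ} (hu : MemLp u 2 volume) :
    ∫ x, u x ^ 2 = 0 ↔ ∀ᵐ x, u x = 0 := by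
  rw [integral_eq_zero_iff_of_nonneg (fun x => sq_nonneg _) hu.integrable_sq]
  refine ⟨fun h => h.mono fun x hx => ?_, fun h => h.mono fun x hx => ?_⟩
  · simpa using hx
  · simp [hx]

/-- Two nonnegative zeros of a nonnegative quadratic form `f ↦ ½ ∫ |∇f|² + ∫ (W - l) f²` with equal
masses coincide. -/
theorem ae_eq_of_linear_min {W : Space d → ℝ} (hW : LocallyIntegrable W volume) {l : ℝ}
    (hQ : ∀ f : Space d → ℝ, MemH1 (toC f) → Integrable (fun x => W x * f x ^ 2) →
      l * ∫ x, f x ^ 2 ≤ (1 / 2) * kinetic (toC f) + ∫ x, W x * f x ^ 2)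
    {u v : Space d → ℝ} (hu : MemH1 (toC u)) (hv : MemH1 (toC v))
    (hWu : Integrable fun x => W x * u x ^ 2) (hWv : Integrable fun x => W x * v x ^ 2)
    (hu0 : ∀ x, 0 ≤ u x) (hv0 : ∀ x, 0 ≤ v x)
    (hQu : (1 / 2) * kinetic (toC u) + ∫ x, W x * u x ^ 2 ≤ l * ∫ x, u x ^ 2)
    (hQv : (1 / 2) * kinetic (toC v) + ∫ x, W x * v x ^ 2 ≤ l * ∫ x, v x ^ 2)
    (hm : ∫ x, u x ^ 2 = ∫ x, v x ^ 2) : ∀ᵐ x, u x = v x := by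
  -- zeros are stable under sums and differences
  have hpar : ∀ f g : Space d → ℝ, MemH1 (toC f) → MemH1 (toC g) →
      Integrable (fun x => W x * f x ^ 2) → Integrable (fun x => W x * g x ^ 2) →
      (1 / 2) * kinetic (toC f) + ∫ x, W x * f x ^ 2 ≤ l * ∫ x, f x ^ 2 →
      (1 / 2) * kinetic (toC g) + ∫ x, W x * g x ^ 2 ≤ l * ∫ x, g x ^ 2 →
      (MemH1 (toC fun x => f x + g x) ∧ Integrable (fun x => W x * (f x + g x) ^ 2) ∧
        (1 / 2) * kinetic (toC fun x => f x + g x) + ∫ x, W x * (f x + g x) ^ 2 ≤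
          l * ∫ x, (f x + g x) ^ 2) ∧
      (MemH1 (toC fun x => f x - g x) ∧ Integrable (fun x => W x * (f x - g x) ^ 2) ∧
        (1 / 2) * kinetic (toC fun x => f x - g x) + ∫ x, W x * (f x - g x) ^ 2 ≤
          l * ∫ x, (f x - g x) ^ 2) := by
    intro f g hf hg hWf hWg hQf hQg
    have hp : MemH1 (toC fun x => f x + g x) := by simpa using hf.add_toC hg 1
    have hn : MemH1 (toC fun x => f x - g x) := by
      simpa [← sub_eq_add_neg] using hf.add_toC hg (-1)
    have hf2 := memLp_of_toC hf.1
    have hg2 := memLp_of_toC hg.1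
    have hp2 := memLp_of_toC hp.1
    have hn2 := memLp_of_toC hn.1
    have hint : ∀ s : Space d → ℝ, MemLp s 2 volume →
        (∀ x, s x ^ 2 ≤ 2 * (f x ^ 2 + g x ^ 2)) → Integrable fun x => W x * s x ^ 2 := by
      intro s hs hle
      refine ((hWf.norm.add hWg.norm).const_mul 2).mono' (hW.aestronglyMeasurable.mul (hs.1.pow 2))
        (Eventually.of_forall fun x => ?_)
      simp only [Pi.add_apply, norm_mul, norm_pow, Real.norm_eq_abs, sq_abs]
      nlinarith [mul_le_mul_of_nonneg_left (hle x) (abs_nonneg (W x))]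
    have i1 := hint _ hp2 fun x => by nlinarith [sq_nonneg (f x - g x)]
    have i2 := hint _ hn2 fun x => by nlinarith [sq_nonneg (f x + g x)]
    have h1 := hf.parallelogram hg
    have h2 := hQ _ hp i1
    have h3 := hQ _ hn i2
    have e1 : (∫ x, W x * (f x + g x) ^ 2) + ∫ x, W x * (f x - g x) ^ 2 =
        2 * (∫ x, W x * f x ^ 2) + 2 * ∫ x, W x * g x ^ 2 := by
      rw [← integral_add i1 i2, ← (integral_lin_two 2 2 hWf hWg).2]
      congr 1; ext x; ring
    have e2 : (∫ x, (f x + g x) ^ 2) + ∫ x, (f x - g x) ^ 2 =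
        2 * (∫ x, f x ^ 2) + 2 * ∫ x, g x ^ 2 := by
      rw [← integral_add hp2.integrable_sq hn2.integrable_sq,
        ← (integral_lin_two 2 2 hf2.integrable_sq hg2.integrable_sq).2]
      congr 1; ext x; ring
    have e3 := congrArg (l * ·) e2
    exact ⟨⟨hp, i1, by nlinarith⟩, ⟨hn, i2, by nlinarith⟩⟩
  -- nonnegative zeros vanish or are positive
  have hpos : ∀ p : Space d → ℝ, MemH1 (toC p) → Integrable (fun x => W x * p x ^ 2) →
      (1 / 2) * kinetic (toC p) + ∫ x, W x * p x ^ 2 ≤ l * ∫ x, p x ^ 2 → (∀ x, 0 ≤ p x) →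
      (∀ᵐ x, p x = 0) ∨ ∀ᵐ x, 0 < p x := by
    intro p hp hWp hQp hp0
    -- The constant comes from inserting √(p² + ε² η²) into the nonnegative form: mass and potential
    -- energy grow by exactly ε² times those of η, and `p` is a zero of the form.
    refine ae_eq_zero_or_ae_pos hp hp0 fun η hη hηc =>
      ⟨2 * ((∫ x, W x * η x ^ 2) - l * ∫ x, η x ^ 2), fun ε hε _ => ?_⟩
    have hWη := integrable_mul_sq_of_contDiff hW hη.continuous hηc
    have hp2 := memLp_of_toC hp.1
    have hη2 := memLp_of_contDiff hη hηc 2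
    have hg := hp.sqrt_combo (memH1_of_contDiff hη hηc).1 zero_le_one (sq_nonneg ε)
    have hs : ∀ x, √(1 * p x ^ 2 + ε ^ 2 * η x ^ 2) ^ 2 = 1 * p x ^ 2 + ε ^ 2 * η x ^ 2 :=
      fun x => Real.sq_sqrt (by positivity)
    have hs' : ∀ x, W x * (1 * p x ^ 2 + ε ^ 2 * η x ^ 2) =
        1 * (W x * p x ^ 2) + ε ^ 2 * (W x * η x ^ 2) := fun x => by ring
    have i1 := integral_lin_two 1 (ε ^ 2) hWp hWη
    have h1 := hQ _ hg.1 (by simpa only [hs, hs'] using i1.1)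
    simp_rw [hs, hs'] at h1
    rw [i1.2, (integral_lin_two 1 (ε ^ 2) hp2.integrable_sq hη2.integrable_sq).2] at h1
    nlinarith
  have hu2 := memLp_of_toC hu.1
  have hv2 := memLp_of_toC hv.1
  obtain ⟨-, hw, hWw, hQw⟩ := hpar u v hu hv hWu hWv hQu hQv
  have hw2 := memLp_of_toC hw.1
  -- The modulus of u - v is again a zero of the form, hence so are |u - v| ± (u - v). Each is
  -- nonnegative and therefore vanishes or is positive almost everywhere; positivity would order u
  -- and v strictly, against equal masses.
  have ha := memH1_of_increment_le_one hw (w := fun x => |u x - v x|) hw2.abs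
    (fun x y => abs_abs_sub_abs_le_abs_sub _ _)
  have hWa : Integrable fun x => W x * |u x - v x| ^ 2 := by simpa only [sq_abs] using hWw
  have hQa : (1 / 2) * kinetic (toC fun x => |u x - v x|) + ∫ x, W x * |u x - v x| ^ 2 ≤
      l * ∫ x, |u x - v x| ^ 2 := by
    simp_rw [sq_abs]
    have : kinetic (toC fun x => |u x - v x|) ≤ kinetic (toC fun x => u x - v x) :=
      Finset.sum_le_sum fun i _ => ha.2 i
    linarith
  obtain ⟨⟨p1, p2, p3⟩, ⟨n1, n2, n3⟩⟩ := hpar _ _ ha.1 hw hWa hWw hQa hQw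
  have hne : ∀ a b : Space d → ℝ, MemLp a 2 volume → MemLp b 2 volume → (∀ x, 0 ≤ b x) →
      (∫ x, a x ^ 2 = ∫ x, b x ^ 2) → ¬ ∀ᵐ x, b x < a x := by
    intro a b ha hb hb0 hab hlt
    have h1 : ∫ x, (a x ^ 2 - b x ^ 2) = 0 := by
      rw [integral_sub ha.integrable_sq hb.integrable_sq, hab, sub_self]
    have hi : Integrable fun x => a x ^ 2 - b x ^ 2 := ha.integrable_sq.sub hb.integrable_sq
    rw [integral_eq_zero_iff_of_nonneg_ae _ hi] at h1
    · obtain ⟨x, hx1, hx2⟩ := (h1.and hlt).exists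
      have := hb0 x
      simp only [Pi.zero_apply] at hx1
      nlinarith
    · refine hlt.mono fun x hx => ?_
      have := hb0 x
      simp only [Pi.zero_apply]
      nlinarith
  have hA : ∀ᵐ x, |u x - v x| + (u x - v x) = 0 := by
    refine (hpos _ p1 p2 p3 fun x => ?_).resolve_right fun h => hne u v hu2 hv2 hv0 hm ?_
    · linarith [neg_abs_le (u x - v x)]
    · refine h.mono fun x hx => ?_
      by_contra hn
      rw [abs_of_nonpos (by linarith)] at hx
      linarith
  have hB : ∀ᵐ x, |u x - v x| - (u x - v x) = 0 := by
    refine (hpos _ n1 n2 n3 fun x => ?_).resolve_right fun h => hne v u hv2 hu2 hu0 hm.symm ?_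
    · linarith [le_abs_self (u x - v x)]
    · refine h.mono fun x hx => ?_
      by_contra hn
      rw [abs_of_nonneg (by linarith)] at hx
      linarith
  filter_upwards [hA, hB] with x h1 h2
  linarith

/-- Exact midpoint convexity of the interaction in the densities; the term with -1/4 is the gain
that minimality forces to vanish in `IsMin.interaction_eq`. -/
theorem integral_mid_mul {α : Type*} [MeasurableSpace α] {μ : Measure α} {p p' q q' : α → ℝ}
    (hp : MemLp p 2 μ) (hp' : MemLp p' 2 μ) (hq : MemLp q 2 μ) (hq' : MemLp q' 2 μ) :
    ∫ x, ((1 / 2) * p x + (1 / 2) * p' x) * ((1 / 2) * q x + (1 / 2) * q' x) ∂μ =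
      (1 / 2) * (∫ x, p x * q x ∂μ) + (1 / 2) * (∫ x, p' x * q' x ∂μ) +
        (-(1 / 4)) * ∫ x, (p x - p' x) * (q x - q' x) ∂μ := by
  have h3 : Integrable (fun x => (p x - p' x) * (q x - q' x)) μ :=
    integrable_mul_of_memLp_two (hp.sub hp') (hq.sub hq')
  rw [← (integral_lin_three (1 / 2) (1 / 2) (-(1 / 4)) (integrable_mul_of_memLp_two hp hq)
    (integrable_mul_of_memLp_two hp' hq') h3).2]
  congr 1; ext x; ring

theorem Adm.sqrt_combo {V : Space d → ℝ} {m : ℝ} {u f : Space d → ℝ} (hu : Adm V m u)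
    (hf : Adm V m f) {a b : ℝ} (ha : 0 ≤ a) (hb : 0 ≤ b) (hab : a + b = 1) :
    Adm V m (fun x => √(a * u x ^ 2 + b * f x ^ 2)) ∧
      ∫ x, V x * √(a * u x ^ 2 + b * f x ^ 2) ^ 2 =
        a * (∫ x, V x * u x ^ 2) + b * ∫ x, V x * f x ^ 2 := by
  have hs : ∀ x, √(a * u x ^ 2 + b * f x ^ 2) ^ 2 = a * u x ^ 2 + b * f x ^ 2 :=
    fun x => Real.sq_sqrt (by positivity)
  have hs' : ∀ x, V x * (a * u x ^ 2 + b * f x ^ 2) =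
      a * (V x * u x ^ 2) + b * (V x * f x ^ 2) := fun x => by ring
  have i1 := integral_lin_two a b hu.pot hf.pot
  refine ⟨⟨(hu.memH1.sqrt_combo hf.memH1 ha hb).1, ?_, ?_⟩, ?_⟩
  · simpa only [hs, hs'] using i1.1
  · simp_rw [hs]
    rw [(integral_lin_two a b hu.memLp.integrable_sq hf.memLp.integrable_sq).2, hu.mass, hf.mass,
      ← add_mul, hab, one_mul]
  · simp_rw [hs, hs', i1.2]

/-- Moving x by a small multiple of -L, with L = a x + b y, changes the form by -t L² (2 - a t),
which would be negative unless L = 0. The choice of `t` ensures a t ≤ 1. -/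
theorem null_of_posSemidef {a b c x y : ℝ}
    (h : ∀ x y : ℝ, 0 ≤ a * x ^ 2 + 2 * b * (x * y) + c * y ^ 2)
    (h0 : a * x ^ 2 + 2 * b * (x * y) + c * y ^ 2 = 0) : a * x + b * y = 0 := by
  set L := a * x + b * y with hL
  set t := 1 / (|a| + 1) with ht
  have hp : 0 < |a| + 1 := by positivity
  have htp : 0 < t := by positivity
  have h1 := h (x - t * L) y
  have h2 : a * (x - t * L) ^ 2 + 2 * b * ((x - t * L) * y) + c * y ^ 2 =
      (a * x ^ 2 + 2 * b * (x * y) + c * y ^ 2) - t * L ^ 2 * (2 - a * t) := by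
    rw [hL]; ring
  rw [h2, h0] at h1
  have h3 : a * t ≤ 1 := by
    rw [ht, mul_one_div]
    exact div_le_one_of_le₀ (by linarith [le_abs_self a]) hp.le
  by_contra hne
  have h4 : 0 < L ^ 2 := by positivity
  nlinarith [mul_pos htp h4, mul_pos (mul_pos htp h4) (show 0 < 2 - a * t by linarith)]

section Uniqueness

variable {Vu Vd : Space d → ℝ} {βuu βud βdd ν : ℝ} {u v u' v' : Space d → ℝ}

/-- For a positive semidefinite interaction, the densities of two minimizing pairs differ by a null
vector of the interaction matrix. -/
theorem IsMin.interaction_eq (hd1 : 1 ≤ d) (hd3 : d ≤ 3)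
    (hB : ∀ a b : ℝ, 0 ≤ βuu * a ^ 2 + 2 * βud * (a * b) + βdd * b ^ 2)
    (h : IsMin Vu Vd βuu βud βdd ν u v) (h' : IsMin Vu Vd βuu βud βdd ν u' v') :
    ∀ᵐ x, βuu * u x ^ 2 + βud * v x ^ 2 = βuu * u' x ^ 2 + βud * v' x ^ 2 := by
  have pu := h.admu.memH1.memLp_sq hd1 hd3
  have pv := h.admv.memH1.memLp_sq hd1 hd3
  have pu' := h'.admu.memH1.memLp_sq hd1 hd3
  have pv' := h'.admv.memH1.memLp_sq hd1 hd3
  have hU := h.admu.sqrt_combo h'.admu (a := 1 / 2) (b := 1 / 2) (by norm_num) (by norm_num)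
    (by norm_num)
  have hV := h.admv.sqrt_combo h'.admv (a := 1 / 2) (b := 1 / 2) (by norm_num) (by norm_num)
    (by norm_num)
  have kU := (h.admu.memH1.sqrt_combo h'.admu.memH1 (a := 1 / 2) (b := 1 / 2) (by norm_num)
    (by norm_num)).2
  have kV := (h.admv.memH1.sqrt_combo h'.admv.memH1 (a := 1 / 2) (b := 1 / 2) (by norm_num)
    (by norm_num)).2
  have h1 := h.le _ _ hU.1 hV.1
  have h2 := h'.le _ _ hU.1 hV.1
  have sq : ∀ a b : ℝ, √((1 / 2) * a ^ 2 + (1 / 2) * b ^ 2) ^ 2 =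
      (1 / 2) * a ^ 2 + (1 / 2) * b ^ 2 := fun a b => Real.sq_sqrt (by positivity)
  have four : ∀ t : ℝ, t ^ 4 = t ^ 2 * t ^ 2 := fun t => by ring
  have m1 := integral_mid_mul pu pu' pu pu'
  have m2 := integral_mid_mul pv pv' pv pv'
  have m3 := integral_mid_mul pu pu' pv pv'
  unfold realEnergy at h1 h2
  rw [hU.2, hV.2] at h1 h2
  simp_rw [four, sq] at h1 h2
  rw [m1, m2, m3] at h1 h2
  have dd1 := integrable_mul_of_memLp_two (pu.sub pu') (pu.sub pu')
  have dd2 := integrable_mul_of_memLp_two (pv.sub pv') (pv.sub pv')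
  have dd3 := integrable_mul_of_memLp_two (pu.sub pu') (pv.sub pv')
  simp only [Pi.sub_apply] at dd1 dd2 dd3
  have hlin := integral_lin_three βuu (2 * βud) βdd dd1 dd3 dd2
  have hnn : ∀ x, 0 ≤ βuu * ((u x ^ 2 - u' x ^ 2) * (u x ^ 2 - u' x ^ 2)) +
      2 * βud * ((u x ^ 2 - u' x ^ 2) * (v x ^ 2 - v' x ^ 2)) +
      βdd * ((v x ^ 2 - v' x ^ 2) * (v x ^ 2 - v' x ^ 2)) := fun x => by
    simpa only [pow_two (_ - _)] using hB (u x ^ 2 - u' x ^ 2) (v x ^ 2 - v' x ^ 2)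
  have hz : ∫ x, (βuu * ((u x ^ 2 - u' x ^ 2) * (u x ^ 2 - u' x ^ 2)) +
      2 * βud * ((u x ^ 2 - u' x ^ 2) * (v x ^ 2 - v' x ^ 2)) +
      βdd * ((v x ^ 2 - v' x ^ 2) * (v x ^ 2 - v' x ^ 2))) = 0 := by
    refine le_antisymm ?_ (integral_nonneg hnn)
    rw [hlin.2]
    nlinarith
  rw [integral_eq_zero_iff_of_nonneg hnn hlin.1] at hz
  refine hz.mono fun x hx => ?_
  have := null_of_posSemidef hB (x := u x ^ 2 - u' x ^ 2) (y := v x ^ 2 - v' x ^ 2)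
    (by simpa only [pow_two (_ - _), Pi.zero_apply] using hx)
  linarith

/-- The linearized problem: a minimizing `u` also minimizes the energy in its own mean field. -/
theorem IsMin.linear_le (hd1 : 1 ≤ d) (hd3 : d ≤ 3) (h : IsMin Vu Vd βuu βud βdd ν u v)
    {f : Space d → ℝ} (hf : Adm Vu ν f) :
    (1 / 2) * kinetic (toC u) + ∫ x, (Vu x + (βuu * u x ^ 2 + βud * v x ^ 2)) * u x ^ 2 ≤
      (1 / 2) * kinetic (toC f) + ∫ x, (Vu x + (βuu * u x ^ 2 + βud * v x ^ 2)) * f x ^ 2 := by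
  have pu := h.admu.memH1.memLp_sq hd1 hd3
  have pv := h.admv.memH1.memLp_sq hd1 hd3
  have pf := hf.memH1.memLp_sq hd1 hd3
  have huu := integrable_mul_of_memLp_two pu pu
  have huf := integrable_mul_of_memLp_two pu pf
  have hff := integrable_mul_of_memLp_two pf pf
  have hvu := integrable_mul_of_memLp_two pv pu
  have hvf := integrable_mul_of_memLp_two pv pf
  have e1 : ∀ g : Space d → ℝ, ∀ x, (Vu x + (βuu * u x ^ 2 + βud * v x ^ 2)) * g x ^ 2 =
      1 * (Vu x * g x ^ 2) + βuu * (u x ^ 2 * g x ^ 2) + βud * (v x ^ 2 * g x ^ 2) :=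
    fun g x => by ring
  simp_rw [e1]
  rw [(integral_lin_three 1 βuu βud h.admu.pot huu hvu).2,
    (integral_lin_three 1 βuu βud hf.pot huf hvf).2]
  -- Minimality along the path of densities (1 - t) u² + t f², divided by t; the convex kinetic
  -- energy is bounded by its chord and the self-interaction leaves the term of order t. Letting t
  -- tend to 0 removes it.
  have key : ∀ t : ℝ, 0 < t → t ≤ 1 → 0 ≤ ((1 / 2) * kinetic (toC f) - (1 / 2) * kinetic (toC u) +
      ((∫ x, Vu x * f x ^ 2) - ∫ x, Vu x * u x ^ 2) +
      βuu * ((∫ x, u x ^ 2 * f x ^ 2) - ∫ x, u x ^ 2 * u x ^ 2) +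
      βud * ((∫ x, v x ^ 2 * f x ^ 2) - ∫ x, v x ^ 2 * u x ^ 2)) +
      t * ((1 / 2) * βuu * ((∫ x, u x ^ 2 * u x ^ 2) - 2 * (∫ x, u x ^ 2 * f x ^ 2) +
        ∫ x, f x ^ 2 * f x ^ 2)) := by
    intro t ht ht1
    have hU := h.admu.sqrt_combo hf (a := 1 - t) (b := t) (by linarith) ht.le (by ring)
    have kU := (h.admu.memH1.sqrt_combo hf.memH1 (a := 1 - t) (b := t) (by linarith) ht.le).2
    have h1 := h.le _ _ hU.1 h.admv
    have sq : ∀ a b : ℝ, √((1 - t) * a ^ 2 + t * b ^ 2) ^ 2 = (1 - t) * a ^ 2 + t * b ^ 2 :=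
      fun a b => Real.sq_sqrt (add_nonneg (mul_nonneg (by linarith) (sq_nonneg a)) (by positivity))
    have four : ∀ t : ℝ, t ^ 4 = t ^ 2 * t ^ 2 := fun t => by ring
    unfold realEnergy at h1
    rw [hU.2] at h1
    simp_rw [four, sq] at h1
    have e2 : ∫ x, ((1 - t) * u x ^ 2 + t * f x ^ 2) * ((1 - t) * u x ^ 2 + t * f x ^ 2) =
        (1 - t) ^ 2 * (∫ x, u x ^ 2 * u x ^ 2) + 2 * (1 - t) * t * (∫ x, u x ^ 2 * f x ^ 2) +
          t ^ 2 * ∫ x, f x ^ 2 * f x ^ 2 := by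
      rw [← (integral_lin_three _ _ _ huu huf hff).2]
      congr 1; ext x; ring
    have e3 : ∫ x, ((1 - t) * u x ^ 2 + t * f x ^ 2) * v x ^ 2 =
        (1 - t) * (∫ x, v x ^ 2 * u x ^ 2) + t * ∫ x, v x ^ 2 * f x ^ 2 := by
      rw [← (integral_lin_two _ _ hvu hvf).2]
      congr 1; ext x; ring
    have e4 : ∫ x, u x ^ 2 * v x ^ 2 = ∫ x, v x ^ 2 * u x ^ 2 := by
      congr 1; ext x; ring
    rw [e2, e3, e4] at h1
    have h2 : 0 ≤ t * (((1 / 2) * kinetic (toC f) - (1 / 2) * kinetic (toC u) +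
      ((∫ x, Vu x * f x ^ 2) - ∫ x, Vu x * u x ^ 2) +
      βuu * ((∫ x, u x ^ 2 * f x ^ 2) - ∫ x, u x ^ 2 * u x ^ 2) +
      βud * ((∫ x, v x ^ 2 * f x ^ 2) - ∫ x, v x ^ 2 * u x ^ 2)) +
      t * ((1 / 2) * βuu * ((∫ x, u x ^ 2 * u x ^ 2) - 2 * (∫ x, u x ^ 2 * f x ^ 2) +
        ∫ x, f x ^ 2 * f x ^ 2))) := by linarith
    exact nonneg_of_mul_nonneg_right h2 ht
  set A := ((1 / 2) * kinetic (toC f) - (1 / 2) * kinetic (toC u) +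
      ((∫ x, Vu x * f x ^ 2) - ∫ x, Vu x * u x ^ 2) +
      βuu * ((∫ x, u x ^ 2 * f x ^ 2) - ∫ x, u x ^ 2 * u x ^ 2) +
      βud * ((∫ x, v x ^ 2 * f x ^ 2) - ∫ x, v x ^ 2 * u x ^ 2)) with hA
  set D := ((1 / 2) * βuu * ((∫ x, u x ^ 2 * u x ^ 2) - 2 * (∫ x, u x ^ 2 * f x ^ 2) +
        ∫ x, f x ^ 2 * f x ^ 2))
  have hA0 : 0 ≤ A := by
    have hlim : Tendsto (fun n : ℕ => A + 1 / ((n : ℝ) + 1) * D) atTop (𝓝 (A + 0 * D)) :=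
      (tendsto_one_div_add_atTop_nhds_zero_nat.mul_const D).const_add A
    have := ge_of_tendsto' hlim fun n => key _ (by positivity)
      (div_le_one_of_le₀ (by simp) (by positivity))
    simpa using this
  linarith

/-- The mean field `W` of the first pair is almost everywhere also that of the second, so u and u'
minimize the same quadratic form at mass ν. Homogeneity extends minimality to all masses, and l, the
minimum divided by ν, plays the role of the lowest eigenvalue. -/
theorem IsMin.fst_unique (hd1 : 1 ≤ d) (hd3 : d ≤ 3) (hν : 0 < ν)
    (hVu : LocallyIntegrable Vu volume)
    (hB : ∀ a b : ℝ, 0 ≤ βuu * a ^ 2 + 2 * βud * (a * b) + βdd * b ^ 2)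
    (h : IsMin Vu Vd βuu βud βdd ν u v) (h' : IsMin Vu Vd βuu βud βdd ν u' v')
    (hu0 : ∀ x, 0 ≤ u x) (hu0' : ∀ x, 0 ≤ u' x) : ∀ᵐ x, u x = u' x := by
  have hint := h.interaction_eq hd1 hd3 hB h'
  set W : Space d → ℝ := fun x => Vu x + (βuu * u x ^ 2 + βud * v x ^ 2) with hW
  have pu := h.admu.memH1.memLp_sq hd1 hd3
  have pv := h.admv.memH1.memLp_sq hd1 hd3
  have pρ : MemLp (fun x => βuu * u x ^ 2 + βud * v x ^ 2) 2 volume :=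
    (pu.const_mul βuu).add (pv.const_mul βud)
  have hWl : LocallyIntegrable W volume := hVu.add (pρ.locallyIntegrable (by norm_num))
  have hWi : ∀ f : Space d → ℝ, MemH1 (toC f) →
      (Integrable (fun x => W x * f x ^ 2) ↔ Integrable fun x => Vu x * f x ^ 2) := by
    intro f hf
    have hρf := integrable_mul_of_memLp_two pρ (hf.memLp_sq hd1 hd3)
    refine ⟨fun hi => (hi.sub hρf).congr (Eventually.of_forall fun x => ?_),
      fun hi => (hi.add hρf).congr (Eventually.of_forall fun x => ?_)⟩
    · simp only [hW, Pi.sub_apply]; ring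
    · simp only [hW, Pi.add_apply]; ring
  have hmin : ∀ f, Adm Vu ν f → (1 / 2) * kinetic (toC u) + ∫ x, W x * u x ^ 2 ≤
      (1 / 2) * kinetic (toC f) + ∫ x, W x * f x ^ 2 := fun f hf => h.linear_le hd1 hd3 hf
  have hmin' : (1 / 2) * kinetic (toC u') + ∫ x, W x * u' x ^ 2 ≤
      (1 / 2) * kinetic (toC u) + ∫ x, W x * u x ^ 2 := by
    have := h'.linear_le hd1 hd3 h.admu
    have e : ∀ f : Space d → ℝ, ∫ x, (Vu x + (βuu * u' x ^ 2 + βud * v' x ^ 2)) * f x ^ 2 =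
        ∫ x, W x * f x ^ 2 := fun f =>
      integral_congr_ae (hint.mono fun x hx => by simp only [hW, hx])
    rwa [e, e] at this
  set l := ((1 / 2) * kinetic (toC u) + ∫ x, W x * u x ^ 2) / ν with hl
  have hlν : l * ν = (1 / 2) * kinetic (toC u) + ∫ x, W x * u x ^ 2 := div_mul_cancel₀ _ hν.ne'
  refine ae_eq_of_linear_min hWl (l := l) ?_ h.admu.memH1 h'.admu.memH1
    ((hWi u h.admu.memH1).2 h.admu.pot) ((hWi u' h'.admu.memH1).2 h'.admu.pot) hu0 hu0'
    (by rw [h.admu.mass, hlν]) (by rw [h'.admu.mass, hlν]; exact hmin')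
    (by rw [h.admu.mass, h'.admu.mass])
  intro f hf hWf
  have hf2 := memLp_of_toC hf.1
  set m := ∫ x, f x ^ 2 with hm
  have hmn : 0 ≤ m := integral_nonneg fun x => sq_nonneg (f x)
  rcases hmn.eq_or_lt with hm0 | hm0
  · have hz := (integral_sq_eq_zero_iff hf2).1 (hm ▸ hm0.symm)
    have : ∫ x, W x * f x ^ 2 = 0 := by
      rw [integral_congr_ae (g := fun _ => 0) (hz.mono fun x hx => by simp [hx]), integral_zero]
    rw [this, ← hm0]
    linarith [kinetic_nonneg (toC f)]
  · set c := √(ν / m) with hc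
    have hc2 : c ^ 2 = ν / m := Real.sq_sqrt (by positivity)
    have hcf := hf.const_mul_toC c
    have e : ∀ x, (c * f x) ^ 2 = c ^ 2 * f x ^ 2 := fun x => by ring
    have e' : ∀ (X : Space d → ℝ) (x), X x * (c ^ 2 * f x ^ 2) = c ^ 2 * (X x * f x ^ 2) :=
      fun X x => by ring
    have hadm : Adm Vu ν fun x => c * f x := by
      refine ⟨hcf.1, ?_, ?_⟩
      · simp_rw [e, e' Vu]
        exact ((hWi f hf).1 hWf).const_mul _
      · simp_rw [e]
        rw [integral_const_mul, hc2, ← hm]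
        field_simp
    have h1 := hmin _ hadm
    simp_rw [e, e' W] at h1
    rw [integral_const_mul, hcf.2, ← hlν, hc2] at h1
    have h2 : ν / m * (l * m) ≤ ν / m * ((1 / 2) * kinetic (toC f) + ∫ x, W x * f x ^ 2) := by
      have : ν / m * (l * m) = l * ν := by field_simp
      rw [this]; linarith
    exact le_of_mul_le_mul_left h2 (by positivity)

theorem IsMin.unique (hd1 : 1 ≤ d) (hd3 : d ≤ 3) (hν : ν ∈ Set.Ioo (0 : ℝ) 1)
    (hVu : LocallyIntegrable Vu volume) (hVd : LocallyIntegrable Vd volume)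
    (hB : ∀ a b : ℝ, 0 ≤ βuu * a ^ 2 + 2 * βud * (a * b) + βdd * b ^ 2)
    (h : IsMin Vu Vd βuu βud βdd ν u v) (h' : IsMin Vu Vd βuu βud βdd ν u' v')
    (hu0 : ∀ x, 0 ≤ u x) (hu0' : ∀ x, 0 ≤ u' x) (hv0 : ∀ x, 0 ≤ v x) (hv0' : ∀ x, 0 ≤ v' x) :
    (∀ᵐ x, u x = u' x) ∧ ∀ᵐ x, v x = v' x :=
  ⟨h.fst_unique hd1 hd3 hν.1 hVu hB h' hu0 hu0',
    h.swap.fst_unique hd1 hd3 (sub_pos.2 hν.2) hVd (fun a b => by linarith [hB b a]) h'.swap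
      hv0 hv0'⟩

end Uniqueness

end
end TwoComponentBEC

/-! ### The sharp constant, and coercivity for d = 1, d = 3 and under a mass gap. -/

namespace TwoComponentBEC
noncomputable section
variable {d : ℕ}

theorem integral_four_pos (hd1 : 1 ≤ d) (hd3 : d ≤ 3) {u : Space d → ℝ} (hu : MemH1 (toC u))
    (h0 : ¬ ∀ᵐ x, u x = 0) : 0 < ∫ x, u x ^ 4 := by
  have h4 := integrable_four (hu.memLp_sq hd1 hd3)
  refine lt_of_le_of_ne (integral_nonneg fun x => by positivity) fun h => h0 ?_
  rw [eq_comm, integral_eq_zero_iff_of_nonneg (fun x => by positivity) h4] at h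
  refine h.mono fun x hx => ?_
  simpa using hx

/-- The nonsharp inequality gives both positivity of the infimum and the lower boundedness without
which `sInf` would carry no information. The summand 1 in the witness covers C = 0. -/
theorem exists_pos_le_ratio : ∃ c : ℝ, 0 < c ∧ ∀ f : Space 2 → ℂ, MemH1 f → ¬ f =ᵐ[volume] 0 →
    c ≤ (∫ x, gradSq f x) * (∫ x, ‖f x‖ ^ 2) / ∫ x, ‖f x‖ ^ 4 := by
  obtain ⟨C, hC0, hC⟩ := exists_gagliardo_nirenberg (d := 2) (by norm_num) (by norm_num)
  refine ⟨1 / √(C + 1), by positivity, fun f hf h0 => ?_⟩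
  have h1 := (hC _ hf.norm.1).2
  have hN := integral_four_pos (by norm_num) (by norm_num) hf.norm.1 fun h => h0
    (h.mono fun x hx => norm_eq_zero.1 hx)
  rw [hf.integral_gradSq.2]
  have hK := hf.kinetic_norm_le
  have hK0 := kinetic_nonneg (toC fun x => ‖f x‖)
  have hm : 0 ≤ ∫ x, ‖f x‖ ^ 2 := integral_nonneg fun x => by positivity
  rw [div_le_div_iff₀ (by positivity) hN, one_mul]
  refine le_trans ?_ (mul_le_mul_of_nonneg_right (mul_le_mul_of_nonneg_right hK hm)
    (Real.sqrt_nonneg _))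
  refine abs_le_of_sq_le_sq' ?_ (by positivity) |>.2
  rw [mul_pow, Real.sq_sqrt (by positivity)]
  norm_num at h1
  nlinarith [sq_nonneg (kinetic (toC fun x => ‖f x‖) * ∫ x, ‖f x‖ ^ 2)]

theorem exists_memH1_ne_zero : ∃ f : Space d → ℂ, MemH1 f ∧ ¬ f =ᵐ[volume] 0 := by
  obtain ⟨u, hu⟩ := exists_adm (d := d) (V := fun _ => 0) (locallyIntegrable_const 0) zero_le_one
  refine ⟨toC u, hu.memH1, fun h => ?_⟩
  have := (integral_sq_eq_zero_iff hu.memLp).2 (h.mono fun x hx => by simpa using hx)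
  rw [hu.mass] at this
  exact one_ne_zero this

theorem bestConst_pos : 0 < bestConst := by
  obtain ⟨c, hc, h⟩ := exists_pos_le_ratio
  refine hc.trans_le (le_csInf ?_ ?_)
  · obtain ⟨f, hf, hf0⟩ := exists_memH1_ne_zero (d := 2)
    exact ⟨_, f, hf, hf0, rfl⟩
  · rintro r ⟨f, hf, hf0, rfl⟩
    exact h f hf hf0

/-- The Gagliardo–Nirenberg inequality with its best constant. -/
theorem bestConst_mul_le {u : Space 2 → ℝ} (hu : MemH1 (toC u)) :
    bestConst * ∫ x, u x ^ 4 ≤ kinetic (toC u) * ∫ x, u x ^ 2 := by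
  by_cases h0 : ∀ᵐ x, u x = 0
  · have e : ∫ x, u x ^ 4 = 0 := by
      rw [integral_congr_ae (g := fun _ => 0) (h0.mono fun x hx => by simp [hx]), integral_zero]
    rw [e, mul_zero]
    exact mul_nonneg (kinetic_nonneg _) (integral_nonneg fun x => sq_nonneg _)
  · have hN := integral_four_pos (by norm_num) (by norm_num) hu h0
    obtain ⟨c, hc, h⟩ := exists_pos_le_ratio
    have h1 : bestConst ≤ _ := csInf_le ⟨c, by rintro r ⟨f, hf, hf0, rfl⟩; exact h f hf hf0⟩
      ⟨toC u, hu, fun h => h0 (h.mono fun x hx => by simpa using hx), rfl⟩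
    rw [hu.integral_gradSq.2] at h1
    simp only [Complex.norm_real, Real.norm_eq_abs, sq_abs,
      show ∀ t : ℝ, |t| ^ 4 = t ^ 4 from fun t => (even_two_mul 2).pow_abs t] at h1
    rwa [le_div_iff₀ hN] at h1

theorem exists_lt_bestConst_mul {ε : ℝ} (hε : 0 < ε) : ∃ u : Space 2 → ℝ, MemH1 (toC u) ∧
    0 < ∫ x, u x ^ 4 ∧
    kinetic (toC u) * (∫ x, u x ^ 2) < (bestConst + ε) * ∫ x, u x ^ 4 := by
  obtain ⟨f, hf, hf0⟩ := exists_memH1_ne_zero (d := 2)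
  obtain ⟨r, ⟨g, hg, hg0, rfl⟩, hr⟩ := exists_lt_of_csInf_lt
    (s := {r : ℝ | ∃ f : Space 2 → ℂ, MemH1 f ∧ ¬ f =ᵐ[volume] 0 ∧
      r = (∫ x, gradSq f x) * (∫ x, ‖f x‖ ^ 2) / ∫ x, ‖f x‖ ^ 4})
    ⟨_, f, hf, hf0, rfl⟩ (lt_add_of_pos_right bestConst hε)
  have hN := integral_four_pos (by norm_num) (by norm_num) hg.norm.1 fun h => hg0
    (h.mono fun x hx => norm_eq_zero.1 hx)
  refine ⟨fun x => ‖g x‖, hg.norm.1, hN, ?_⟩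
  rw [div_lt_iff₀ hN, hg.integral_gradSq.2] at hr
  exact (mul_le_mul_of_nonneg_right hg.kinetic_norm_le
    (integral_nonneg fun x => by positivity)).trans_lt hr

section Coercive

variable {Vu Vd : Space d → ℝ} {βuu βud βdd ν : ℝ}

theorem kinetic_quartic_le_realEnergy (hVu : ∀ x, 0 ≤ Vu x) (hVd : ∀ x, 0 ≤ Vd x)
    (u v : Space d → ℝ) :
    kinetic (toC u) + kinetic (toC v) + (βuu * (∫ x, u x ^ 4) +
      2 * βud * (∫ x, u x ^ 2 * v x ^ 2) + βdd * ∫ x, v x ^ 4) ≤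
        2 * realEnergy Vu Vd βuu βud βdd u v := by
  have h1 := integral_mul_sq_nonneg (u := u) hVu
  have h2 := integral_mul_sq_nonneg (u := v) hVd
  unfold realEnergy
  linarith

theorem integral_form_eq (a b c : ℝ) {α : Type*} [MeasurableSpace α] {μ : Measure α} {u v : α → ℝ}
    (hu : MemLp (fun x => u x ^ 2) 2 μ) (hv : MemLp (fun x => v x ^ 2) 2 μ) :
    Integrable (fun x => a * u x ^ 4 + 2 * b * (u x ^ 2 * v x ^ 2) + c * v x ^ 4) μ ∧
    ∫ x, (a * u x ^ 4 + 2 * b * (u x ^ 2 * v x ^ 2) + c * v x ^ 4) ∂μ =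
      a * (∫ x, u x ^ 4 ∂μ) + 2 * b * (∫ x, u x ^ 2 * v x ^ 2 ∂μ) + c * ∫ x, v x ^ 4 ∂μ :=
  integral_lin_three a (2 * b) c (integrable_four hu) (integrable_mul_of_memLp_two hu hv)
    (integrable_four hv)

theorem integral_four_nonneg (u : Space d → ℝ) : 0 ≤ ∫ x, u x ^ 4 :=
  integral_nonneg fun x => by positivity

/-- With N the sum of the quartic integrals and K the kinetic energy, N² ≤ 2 C K by
Gagliardo–Nirenberg and K ≤ 2 (|M| + b N) by the energy bound. A quadratic is thus bounded by an
affine function of N. -/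
theorem quartic_bound_one (hd : d = 1) (hVu : ∀ x, 0 ≤ Vu x) (hVd : ∀ x, 0 ≤ Vd x)
    (hν : ν ∈ Set.Ioo (0 : ℝ) 1) (M : ℝ) : ∃ C : ℝ, ∀ u v, Adm Vu ν u → Adm Vd (1 - ν) v →
      realEnergy Vu Vd βuu βud βdd u v ≤ M → ∫ x, u x ^ 4 ≤ C ∧ ∫ x, v x ^ 4 ≤ C := by
  subst hd
  obtain ⟨C, hC0, hC⟩ := exists_gagliardo_nirenberg (d := 1) le_rfl (by norm_num)
  set b := |βuu| + |βdd| + |βud| with hb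
  have hb0 : 0 ≤ b := by positivity
  refine ⟨4 * C * (|M| + b) + 1, fun u v hu hv hE => ?_⟩
  have h1 := (hC u hu.memH1).2
  have h2 := (hC v hv.memH1).2
  rw [hu.mass] at h1
  rw [hv.mass] at h2
  norm_num at h1 h2
  have k1 := kinetic_nonneg (toC u)
  have k2 := kinetic_nonneg (toC v)
  have m1 : ν ^ 3 ≤ 1 := pow_le_one₀ hν.1.le hν.2.le
  have m2 : (1 - ν) ^ 3 ≤ 1 := pow_le_one₀ (by linarith [hν.2]) (by linarith [hν.1])
  have n1 := integral_four_nonneg u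
  have n2 := integral_four_nonneg v
  have pu := hu.memH1.memLp_sq le_rfl (by norm_num)
  have pv := hv.memH1.memLp_sq le_rfl (by norm_num)
  have hE' := kinetic_quartic_le_realEnergy (βuu := βuu) (βud := βud) (βdd := βdd) hVu hVd u v
  have hform : -(b * ((∫ x, u x ^ 4) + ∫ x, v x ^ 4)) ≤ βuu * (∫ x, u x ^ 4) +
      2 * βud * (∫ x, u x ^ 2 * v x ^ 2) + βdd * ∫ x, v x ^ 4 := by
    have e : -(b * ((∫ x, u x ^ 4) + ∫ x, v x ^ 4)) =
        ∫ x, ((-b) * u x ^ 4 + (-b) * v x ^ 4) := by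
      rw [(integral_lin_two (-b) (-b) (integrable_four pu) (integrable_four pv)).2]; ring
    rw [e, ← (integral_form_eq _ _ _ pu pv).2]
    refine integral_mono (integral_lin_two (-b) (-b) (integrable_four pu)
      (integrable_four pv)).1 (integral_form_eq _ _ _ pu pv).1 fun x => ?_
    simp only
    have a1 := neg_abs_le βuu
    have a2 := neg_abs_le βdd
    have a3 := abs_nonneg βud
    have a4 := neg_abs_le βud
    have q1 : 0 ≤ u x ^ 4 := by positivity
    have q2 : 0 ≤ v x ^ 4 := by positivity
    have q3 : 0 ≤ u x ^ 2 * v x ^ 2 := by positivity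
    nlinarith [mul_nonneg a3 (sq_nonneg (u x ^ 2 - v x ^ 2)), abs_nonneg βuu, abs_nonneg βdd,
      mul_nonneg (abs_nonneg βuu) q2, mul_nonneg (abs_nonneg βdd) q1,
      mul_nonneg (show 0 ≤ βuu + |βuu| by linarith) q1,
      mul_nonneg (show 0 ≤ βdd + |βdd| by linarith) q2,
      mul_nonneg (show 0 ≤ βud + |βud| by linarith) q3]
  set N := (∫ x, u x ^ 4) + ∫ x, v x ^ 4 with hN
  have hN2 : N ^ 2 ≤ 2 * C * (kinetic (toC u) + kinetic (toC v)) := by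
    have g1 : (∫ x, u x ^ 4) ^ 2 ≤ C * kinetic (toC u) := h1.trans
      (mul_le_mul_of_nonneg_left (mul_le_of_le_one_left k1 m1) hC0)
    have g2 : (∫ x, v x ^ 4) ^ 2 ≤ C * kinetic (toC v) := h2.trans
      (mul_le_mul_of_nonneg_left (mul_le_of_le_one_left k2 m2) hC0)
    nlinarith [sq_nonneg ((∫ x, u x ^ 4) - ∫ x, v x ^ 4)]
  have hK : kinetic (toC u) + kinetic (toC v) ≤ 2 * (|M| + b * N) := by
    have := le_abs_self M
    nlinarith [mul_nonneg hb0 (add_nonneg n1 n2)]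
  have hfin : N ≤ 4 * C * (|M| + b) + 1 := by
    by_contra hcon
    push Not at hcon
    have hs : 0 ≤ 4 * C * (|M| + b) := by positivity
    have hN1 : 1 < N := by linarith
    have h3 : N ^ 2 ≤ 4 * C * (|M| + b * N) := by
      nlinarith [mul_le_mul_of_nonneg_left hK hC0]
    have h4 : 4 * C * (|M| + b * N) ≤ 4 * C * (|M| + b) * N := by
      nlinarith [mul_nonneg (mul_nonneg hC0 (abs_nonneg M)) (show 0 ≤ N - 1 by linarith)]
    nlinarith
  constructor <;> linarith

/-- The form is needed only at densities, which are nonnegative, so copositivity covers both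
alternatives. The kinetic energies are then at most 2M and Gagliardo–Nirenberg concludes; N ≤ N² + 1
explains the summand 1. -/
theorem quartic_bound_three (hd : d = 3) (hVu : ∀ x, 0 ≤ Vu x) (hVd : ∀ x, 0 ≤ Vd x)
    (hν : ν ∈ Set.Ioo (0 : ℝ) 1)
    (hB : ∀ a b : ℝ, 0 ≤ a → 0 ≤ b → 0 ≤ βuu * a ^ 2 + 2 * βud * (a * b) + βdd * b ^ 2) (M : ℝ) :
    ∃ C : ℝ, ∀ u v, Adm Vu ν u → Adm Vd (1 - ν) v →
      realEnergy Vu Vd βuu βud βdd u v ≤ M → ∫ x, u x ^ 4 ≤ C ∧ ∫ x, v x ^ 4 ≤ C := by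
  subst hd
  obtain ⟨C, hC0, hC⟩ := exists_gagliardo_nirenberg (d := 3) (by norm_num) le_rfl
  refine ⟨C * (2 * M) ^ 3 + 1, fun u v hu hv hE => ?_⟩
  have pu := hu.memH1.memLp_sq (by norm_num) le_rfl
  have pv := hv.memH1.memLp_sq (by norm_num) le_rfl
  have k1 := kinetic_nonneg (toC u)
  have k2 := kinetic_nonneg (toC v)
  have hE' := kinetic_quartic_le_realEnergy (βuu := βuu) (βud := βud) (βdd := βdd) hVu hVd u v
  have hform : 0 ≤ βuu * (∫ x, u x ^ 4) + 2 * βud * (∫ x, u x ^ 2 * v x ^ 2) +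
      βdd * ∫ x, v x ^ 4 := by
    rw [← (integral_form_eq _ _ _ pu pv).2]
    refine integral_nonneg fun x => ?_
    have := hB (u x ^ 2) (v x ^ 2) (sq_nonneg _) (sq_nonneg _)
    simp only [Pi.zero_apply]
    nlinarith
  have key : ∀ (m : ℝ) (w : Space 3 → ℝ), m ≤ 1 → MemH1 (toC w) → ∫ x, w x ^ 2 = m →
      kinetic (toC w) ≤ 2 * M → ∫ x, w x ^ 4 ≤ C * (2 * M) ^ 3 + 1 := by
    intro m w hm hw hmass hK
    have h1 := (hC w hw).2
    have hm0 : 0 ≤ m := hmass ▸ integral_nonneg fun x => sq_nonneg _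
    rw [hmass] at h1
    have k := kinetic_nonneg (toC w)
    have h2 : m ^ (4 - 3) * kinetic (toC w) ^ 3 ≤ 1 * (2 * M) ^ 3 := by
      rw [show 4 - 3 = 1 from rfl, pow_one]
      exact mul_le_mul hm (pow_le_pow_left₀ k hK 3) (by positivity) zero_le_one
    have h3 := mul_le_mul_of_nonneg_left h2 hC0
    nlinarith [sq_nonneg ((∫ x, w x ^ 4) - 1), sq_nonneg ((∫ x, w x ^ 4))]
  exact ⟨key ν u hν.2.le hu.memH1 hu.mass (by linarith),
    key (1 - ν) v (by linarith [hν.1]) hv.memH1 hv.mass (by linarith)⟩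

end Coercive

/-- Where w exceeds t, the factor w/t is at least 1 and converts the L² error |w² - X| into a
product that Cauchy–Schwarz can estimate. -/
theorem trunc_sq_le {w X t : ℝ} (ht : 0 < t) (hw : 0 ≤ w) (hX : 0 ≤ X) :
    max (w - t) 0 ^ 2 ≤ 1 * X + t⁻¹ * (|w ^ 2 - X| * w) := by
  rcases le_total w t with h | h
  · rw [max_eq_right (by linarith)]
    simp only [ne_eq, OfNat.ofNat_ne_zero, not_false_eq_true, zero_pow, one_mul]
    positivity
  · rw [max_eq_left (by linarith)]
    have h2 : 1 ≤ t⁻¹ * w := by rw [le_inv_mul_iff₀ ht]; linarith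
    have h3 : (w - t) ^ 2 ≤ w ^ 2 := by
      apply pow_le_pow_left₀ <;> linarith
    have h4 := mul_le_mul_of_nonneg_right h2 (abs_nonneg (w ^ 2 - X))
    have h5 := le_abs_self (w ^ 2 - X)
    linarith

theorem le_trunc_four {w t : ℝ} (ht : 0 < t) (hw : 0 ≤ w) :
    1 * w ^ 4 + (-(4 * t)) * (w ^ 2 * w) ≤ max (w - t) 0 ^ 4 := by
  rcases le_total w t with h | h
  · rw [max_eq_right (by linarith)]
    have : 0 ≤ w ^ 3 := by positivity
    nlinarith [mul_nonneg (show 0 ≤ 4 * t - w by linarith) this]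
  · rw [max_eq_left (by linarith)]
    have : (w - t) ^ 4 - (w ^ 4 - 4 * t * w ^ 3) =
        t ^ 2 * (6 * w ^ 2 - 4 * t * w + t ^ 2) := by ring
    nlinarith [mul_nonneg (sq_nonneg t) (show 0 ≤ 6 * w ^ 2 - 4 * t * w + t ^ 2 by
      nlinarith [sq_nonneg (2 * w - t)])]

/-- Since s is half of 1 - 1/c, the quadratic terms leave b s τ² on the left; everything else is
O(τ). -/
theorem le_of_gap_inequality {b c E M s τ : ℝ} (hb : 0 < b) (hc : 0 < c) (hE : 0 ≤ E) (hM : 0 ≤ M)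
    (hs0 : 0 < s) (hs : s = (1 - 1 / c) / 2) (hτ : 1 < τ)
    (h : b * (τ ^ 2 * (1 - s)) ≤ (b / c * τ ^ 2 + M) * (1 + E / τ)) :
    τ ≤ (b * E / c + M + M * E) / (b * s) := by
  have hτ0 : 0 < τ := by linarith
  have e1 : b / c * τ ^ 2 * (E / τ) = b * E / c * τ := by field_simp
  have e2 : M * (E / τ) ≤ M * E * τ := by
    rw [mul_assoc]
    refine mul_le_mul_of_nonneg_left ?_ hM
    rw [div_le_iff₀ hτ0]
    nlinarith [mul_nonneg hE (show 0 ≤ τ * τ - 1 by nlinarith)]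
  have e3 : M ≤ M * τ := by nlinarith
  have e4 : b * (τ ^ 2 * (1 - s)) - b / c * τ ^ 2 = b * s * τ ^ 2 := by
    rw [hs]; field_simp; ring
  have h7 : b * s * τ * τ ≤ (b * E / c + M + M * E) * τ := by
    have : (b / c * τ ^ 2 + M) * (1 + E / τ) =
        b / c * τ ^ 2 + b / c * τ ^ 2 * (E / τ) + M + M * (E / τ) := by ring
    rw [this, e1] at h
    have : b * s * τ * τ = b * s * τ ^ 2 := by ring
    rw [this, ← e4]
    linarith
  rw [le_div_iff₀ (by positivity)]
  have := le_of_mul_le_mul_right h7 hτ0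
  linarith

/-- If `w²` is close in `L²` to a density of mass one, but has a larger mass `c`, then near
optimality of `w` in the Gagliardo–Nirenberg inequality bounds `w` in `L⁴`. -/
theorem quartic_bound_of_mass_gap {c D M : ℝ} (hc : 1 < c) (hD : 0 ≤ D) (hM : 0 ≤ M) : ∃ B : ℝ,
    ∀ w X : Space 2 → ℝ, MemH1 (toC w) → (∀ x, 0 ≤ w x) → (∀ x, 0 ≤ X x) → Integrable X →
      MemLp X 2 volume → ∫ x, X x = 1 → ∫ x, w x ^ 2 = c →
      kinetic (toC w) ≤ bestConst / c * (∫ x, w x ^ 4) + M → ∫ x, (w x ^ 2 - X x) ^ 2 ≤ D ^ 2 →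
      ∫ x, w x ^ 4 ≤ B := by
  have hb := bestConst_pos
  set b := bestConst with hbdef
  have hc0 : 0 < c := by linarith
  have hsc : 0 < √c := Real.sqrt_pos.2 hc0
  set s := (1 - 1 / c) / 2 with hs
  have hs0 : 0 < s := by
    have : 1 / c < 1 := by rw [div_lt_one hc0]; exact hc
    simp only [hs]; linarith
  -- The truncation height is κ τ with τ = √T. Its quartic loss is at most 4 κ τ ∫ w³ ≤ 4 κ τ · τ √c
  -- = s T, and the excess of mass over 1 is at most D √c / (κ τ) = E / τ. For large τ the truncated
  -- function has mass near 1 < c but keeps the fraction 1 - s of the quartic integral, which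
  -- violates the sharp inequality.
  set κ := s / (4 * √c) with hκ
  have hκ0 : 0 < κ := by positivity
  set E := D * √c / κ with hE
  have hE0 : 0 ≤ E := by positivity
  set τ₀ := (b * E / c + M + M * E) / (b * s) + 1 with hτ₀
  refine ⟨τ₀ ^ 2, fun w X hw hw0 hX0 hXi hX2 hX1 hwm hK hd => ?_⟩
  have hw2 := memLp_of_toC hw.1
  have hw4 := hw.memLp_sq (by norm_num) (by norm_num)
  set T := ∫ x, w x ^ 4 with hT
  have hT0 : 0 ≤ T := integral_four_nonneg w
  set τ := √T with hτ
  have hττ : τ ^ 2 = T := Real.sq_sqrt hT0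
  have hτ0 : 0 ≤ τ := Real.sqrt_nonneg _
  have hτ₀1 : 1 ≤ τ₀ := by
    simp only [hτ₀, le_add_iff_nonneg_left]; positivity
  rw [← hττ]
  refine pow_le_pow_left₀ hτ0 ?_ 2
  by_contra hcon
  push Not at hcon
  have hτ1 : 1 < τ := by linarith
  set t := κ * τ with ht
  have ht0 : 0 < t := by positivity
  -- the truncation
  have hgm : MemLp (fun x => max (w x - t) 0) 2 volume := by
    refine hw2.of_le ?_ (Eventually.of_forall fun x => ?_)
    · exact ((hw2.1.sub aestronglyMeasurable_const).sup aestronglyMeasurable_const)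
    · rw [Real.norm_of_nonneg (le_max_right _ _), Real.norm_of_nonneg (hw0 x)]
      exact max_le (by linarith) (hw0 x)
  have hg := memH1_of_increment_le_one hw hgm fun x y => by
    have := abs_max_sub_max_le_abs (w x - t) (w y - t) 0
    simpa using this
  have hgK : kinetic (toC fun x => max (w x - t) 0) ≤ kinetic (toC w) :=
    Finset.sum_le_sum fun i _ => hg.2 i
  have hg4 := integrable_four (hg.1.memLp_sq (by norm_num) (by norm_num))
  have hGN := bestConst_mul_le hg.1
  have hdm : MemLp (fun x => w x ^ 2 - X x) 2 volume := hw4.sub hX2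
  -- mass
  have hmass : ∫ x, max (w x - t) 0 ^ 2 ≤ 1 + E / τ := by
    have hi : Integrable fun x => |w x ^ 2 - X x| * w x :=
      integrable_mul_of_memLp_two hdm.abs hw2
    have h1 : ∫ x, max (w x - t) 0 ^ 2 ≤ ∫ x, (1 * X x + t⁻¹ * (|w x ^ 2 - X x| * w x)) := by
      refine integral_mono hgm.integrable_sq (integral_lin_two 1 t⁻¹ hXi hi).1 fun x => ?_
      exact trunc_sq_le ht0 (hw0 x) (hX0 x)
    refine h1.trans ?_
    rw [(integral_lin_two 1 t⁻¹ hXi hi).2, hX1, mul_one]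
    have h2 := abs_integral_mul_le hdm.abs hw2
    simp only [Pi.abs_apply, sq_abs, hwm] at h2
    have h3 : √(∫ x, (w x ^ 2 - X x) ^ 2) ≤ D := by
      rw [← Real.sqrt_sq hD]; exact Real.sqrt_le_sqrt hd
    have h4 : ∫ x, |w x ^ 2 - X x| * w x ≤ D * √c :=
      (le_abs_self _).trans (h2.trans (mul_le_mul_of_nonneg_right h3 hsc.le))
    have h5 : E / τ = t⁻¹ * (D * √c) := by
      rw [hE, ht]; field_simp
    rw [h5]
    gcongr
  -- quartic term
  have hquart : T * (1 - s) ≤ ∫ x, max (w x - t) 0 ^ 4 := by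
    have hi := integrable_mul_of_memLp_two hw4 hw2
    have h1 : ∫ x, (1 * w x ^ 4 + (-(4 * t)) * (w x ^ 2 * w x)) ≤ ∫ x, max (w x - t) 0 ^ 4 := by
      refine integral_mono (integral_lin_two 1 _ (integrable_four hw4) hi).1 hg4 fun x => ?_
      exact le_trunc_four ht0 (hw0 x)
    rw [(integral_lin_two 1 _ (integrable_four hw4) hi).2] at h1
    have h2 := (le_abs_self _).trans (abs_integral_mul_le hw4 hw2)
    have e : ∀ x, (w x ^ 2) ^ 2 = w x ^ 4 := fun x => by ring
    simp only [e, hwm] at h2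
    have h3 : 4 * t * ∫ x, w x ^ 2 * w x ≤ 4 * t * (τ * √c) :=
      mul_le_mul_of_nonneg_left h2 (by positivity)
    have h4 : 4 * t * (τ * √c) = T * s := by
      rw [ht, hκ, ← hττ]; field_simp
    linarith
  have hfin : b * (T * (1 - s)) ≤ (b / c * T + M) * (1 + E / τ) :=
    (mul_le_mul_of_nonneg_left hquart hb.le).trans (hGN.trans
      (mul_le_mul (hgK.trans hK) hmass (integral_nonneg fun x => sq_nonneg _) (by positivity)))
  have h8 : τ ≤ (b * E / c + M + M * E) / (b * s) := by
    rw [← hττ] at hfin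
    exact le_of_gap_inequality hb hc0 hE0 hM hs0 hs hτ1 hfin
  linarith

end
end TwoComponentBEC

/-! ### Coercivity in the plane. -/

namespace TwoComponentBEC
noncomputable section
variable {d : ℕ}

section PlaneCoercive

variable {Vu Vd : Space 2 → ℝ} {βuu βud βdd ν : ℝ}

theorem MemH1.abs_toC {u : Space d → ℝ} (hu : MemH1 (toC u)) :
    MemH1 (toC fun x => |u x|) ∧ kinetic (toC fun x => |u x|) ≤ kinetic (toC u) := by
  have := memH1_of_increment_le_one hu (w := fun x => |u x|) (memLp_of_toC hu.1).abs
    (fun x y => abs_abs_sub_abs_le_abs_sub _ _)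
  exact ⟨this.1, Finset.sum_le_sum fun i _ => this.2 i⟩

theorem abs_pow_four (t : ℝ) : |t| ^ 4 = t ^ 4 := (even_two_mul 2).pow_abs t

set_option maxHeartbeats 400000 in
-- After the sharp inequality is used for both components, the remaining form is the integral of
-- (α/ν u² - γ/(1-ν) v²)², so it is bounded by twice |M|. Rescaled, X = u²/ν has mass 1 and w =
-- √(c/(1-ν)) |v| has mass c = γ/α > 1, while w² - X stays bounded in L². This is the situation of
-- `quartic_bound_of_mass_gap`, applied to w; the bound for u follows from closeness.
theorem quartic_bound_two_boundary (hVu : ∀ x, 0 ≤ Vu x) (hVd : ∀ x, 0 ≤ Vd x)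
    (hν : ν ∈ Set.Ioo (0 : ℝ) 1) {α γ : ℝ} (hα : 0 < α) (hαγ : α < γ)
    (huu : ν * (bestConst + ν * βuu) = α ^ 2)
    (hdd : (1 - ν) * (bestConst + (1 - ν) * βdd) = γ ^ 2)
    (hud : ν * (1 - ν) * βud = -(α * γ)) (M : ℝ) :
    ∃ C : ℝ, ∀ u v, Adm Vu ν u → Adm Vd (1 - ν) v →
      realEnergy Vu Vd βuu βud βdd u v ≤ M → ∫ x, u x ^ 4 ≤ C ∧ ∫ x, v x ^ 4 ≤ C := by
  have hν0 := hν.1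
  have hμ0 : 0 < 1 - ν := sub_pos.2 hν.2
  have hγ : 0 < γ := hα.trans hαγ
  set μ := 1 - ν with hμ
  set c := γ / α with hc
  have hc1 : 1 < c := by rw [hc, one_lt_div hα]; exact hαγ
  have hc0 : 0 < c := by linarith
  set D := √(2 * |M|) / α with hD
  have hD0 : 0 ≤ D := by positivity
  have hD2 : D ^ 2 = 2 * |M| / α ^ 2 := by
    rw [hD, div_pow, Real.sq_sqrt (by positivity)]
  obtain ⟨B, hB⟩ := quartic_bound_of_mass_gap hc1 hD0
    (show 0 ≤ c / μ * (2 * |M|) by positivity)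
  refine ⟨max (ν ^ 2 * (2 * D ^ 2 + 2 * B)) (μ ^ 2 / c ^ 2 * B), fun u v hu hv hE => ?_⟩
  have pu := hu.memH1.memLp_sq (by norm_num) (by norm_num)
  have pv := hv.memH1.memLp_sq (by norm_num) (by norm_num)
  have hE' := kinetic_quartic_le_realEnergy (βuu := βuu) (βud := βud) (βdd := βdd) hVu hVd u v
  have gu := bestConst_mul_le hu.memH1
  have gv := bestConst_mul_le hv.memH1
  rw [hu.mass] at gu
  rw [hv.mass] at gv
  set b := bestConst
  set P := ∫ x, (α / ν * u x ^ 2 - γ / μ * v x ^ 2) ^ 2 with hP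
  have hP0 : 0 ≤ P := integral_nonneg fun x => sq_nonneg _
  have eP : P = (α / ν) ^ 2 * (∫ x, u x ^ 4) +
      2 * (-(α * γ / (ν * μ))) * (∫ x, u x ^ 2 * v x ^ 2) + (γ / μ) ^ 2 * ∫ x, v x ^ 4 := by
    rw [← (integral_form_eq _ _ _ pu pv).2, hP]
    refine integral_congr_ae (Eventually.of_forall fun x => ?_)
    simp only; field_simp; ring
  have e1 : βuu = (α / ν) ^ 2 - b / ν := by
    rw [div_pow, ← huu]; field_simp; ring
  have e2 : βdd = (γ / μ) ^ 2 - b / μ := by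
    rw [div_pow, ← hdd]; field_simp; ring
  have e3 : βud = -(α * γ / (ν * μ)) := by
    rw [← neg_div, ← hud]; field_simp
  rw [e1, e2, e3] at hE'
  rw [e1, e2, e3] at hE
  have gu' : b / ν * (∫ x, u x ^ 4) ≤ kinetic (toC u) := by
    rw [div_mul_eq_mul_div, div_le_iff₀ hν0]; exact gu
  have gv' : b / μ * (∫ x, v x ^ 4) ≤ kinetic (toC v) := by
    rw [div_mul_eq_mul_div, div_le_iff₀ hμ0]; exact gv
  have hM := le_abs_self M
  have hPM : P ≤ 2 * |M| := by linarith
  have hKM : kinetic (toC v) ≤ b / μ * (∫ x, v x ^ 4) + 2 * |M| := by linarith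
  -- apply the mass gap bound
  set r := √(c / μ) with hr
  have hr2 : r ^ 2 = c / μ := Real.sq_sqrt (by positivity)
  have hv' := hv.memH1.abs_toC
  have hw := hv'.1.const_mul_toC r
  have hwq : MemLp (fun x => (r * |v x|) ^ 2) 2 volume := hw.1.memLp_sq (by norm_num) (by norm_num)
  have hwsq : ∀ x, (r * |v x|) ^ 2 = c / μ * v x ^ 2 := fun x => by rw [mul_pow, sq_abs, hr2]
  have hw4 : ∀ x, (r * |v x|) ^ 4 = (c / μ) ^ 2 * v x ^ 4 := fun x => by
    rw [mul_pow, abs_pow_four, ← hr2]; ring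
  have hgap : ∀ x, c / μ * v x ^ 2 - ν⁻¹ * u x ^ 2 =
      -α⁻¹ * (α / ν * u x ^ 2 - γ / μ * v x ^ 2) := fun x => by
    rw [hc]; field_simp; ring
  have hgapI : ∫ x, ((r * |v x|) ^ 2 - ν⁻¹ * u x ^ 2) ^ 2 ≤ D ^ 2 := by
    simp_rw [hwsq, hgap, mul_pow]
    rw [integral_const_mul, ← hP, neg_sq, inv_pow, hD2, div_eq_inv_mul]
    gcongr
  have hT : ∫ x, (r * |v x|) ^ 4 = (c / μ) ^ 2 * ∫ x, v x ^ 4 := by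
    simp_rw [hw4]; rw [integral_const_mul]
  have hBv := hB (fun x => r * |v x|) (fun x => ν⁻¹ * u x ^ 2) hw.1 (fun x => by positivity)
    (fun x => by positivity) (hu.memLp.integrable_sq.const_mul _) (pu.const_mul _)
    (by rw [integral_const_mul, hu.mass, inv_mul_cancel₀ hν0.ne'])
    (by simp_rw [hwsq]; rw [integral_const_mul, hv.mass]; field_simp)
    (by
      rw [hw.2, hr2, hT]
      have h1 : c / μ * kinetic (toC fun x => |v x|) ≤
          c / μ * (b / μ * (∫ x, v x ^ 4) + 2 * |M|) :=
        mul_le_mul_of_nonneg_left (hv'.2.trans hKM) (by positivity)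
      refine h1.trans_eq ?_
      field_simp)
    hgapI
  refine ⟨le_max_of_le_left ?_, le_max_of_le_right ?_⟩
  · have hd : MemLp (fun x => (r * |v x|) ^ 2 - ν⁻¹ * u x ^ 2) 2 volume :=
      hwq.sub (pu.const_mul _)
    have hw4i := integrable_four hwq
    have h1 : ∫ x, (ν⁻¹) ^ 2 * u x ^ 4 ≤
        ∫ x, (2 * ((r * |v x|) ^ 2 - ν⁻¹ * u x ^ 2) ^ 2 + 2 * (r * |v x|) ^ 4) := by
      refine integral_mono ((integrable_four pu).const_mul _)
        (integral_lin_two 2 2 hd.integrable_sq hw4i).1 fun x => ?_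
      simp only
      nlinarith [sq_nonneg (2 * (r * |v x|) ^ 2 - ν⁻¹ * u x ^ 2)]
    rw [(integral_lin_two 2 2 hd.integrable_sq hw4i).2, integral_const_mul, inv_pow,
      inv_mul_le_iff₀ (by positivity)] at h1
    refine h1.trans ?_
    gcongr
  · rw [hT] at hBv
    rw [div_mul_eq_mul_div, le_div_iff₀ (by positivity)]
    calc (∫ x, v x ^ 4) * c ^ 2 = μ ^ 2 * ((c / μ) ^ 2 * ∫ x, v x ^ 4) := by field_simp
      _ ≤ _ := by gcongr

/-- On the quadrant a nonnegative `b` only helps. For negative `b`, ε is determinant over trace, so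
that (a - ε)(c - ε) = b² + ε² keeps the reduced form nonnegative. -/
theorem exists_pos_form_bound {a b c : ℝ} (ha : 0 < a) (hc : 0 < c) (hb : b < 0 → b ^ 2 < a * c) :
    ∃ ε : ℝ, 0 < ε ∧ ∀ x y : ℝ, 0 ≤ x → 0 ≤ y →
      ε * (x ^ 2 + y ^ 2) ≤ a * x ^ 2 + 2 * b * (x * y) + c * y ^ 2 := by
  by_cases hb0 : b < 0
  · have h1 := hb hb0
    set ε := (a * c - b ^ 2) / (a + c) with hε
    have hε0 : 0 < ε := div_pos (by linarith) (by linarith)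
    have hεe : ε * (a + c) = a * c - b ^ 2 := div_mul_cancel₀ _ (by positivity)
    refine ⟨ε, hε0, fun x y _ _ => ?_⟩
    have ha' : 0 < a - ε := by nlinarith [sq_nonneg b]
    have h2 : b ^ 2 ≤ (a - ε) * (c - ε) := by nlinarith [sq_nonneg ε]
    have h3 : 0 ≤ (a - ε) * ((a - ε) * x ^ 2 + 2 * b * (x * y) + (c - ε) * y ^ 2) := by
      nlinarith [sq_nonneg ((a - ε) * x + b * y), mul_nonneg (sub_nonneg.2 h2) (sq_nonneg y)]
    have h4 := nonneg_of_mul_nonneg_right h3 ha'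
    linarith
  · refine ⟨min a c, lt_min ha hc, fun x y hx hy => ?_⟩
    have h1 : min a c * x ^ 2 ≤ a * x ^ 2 :=
      mul_le_mul_of_nonneg_right (min_le_left _ _) (sq_nonneg _)
    have h2 : min a c * y ^ 2 ≤ c * y ^ 2 :=
      mul_le_mul_of_nonneg_right (min_le_right _ _) (sq_nonneg _)
    have h3 : 0 ≤ 2 * b * (x * y) := by
      have := not_lt.1 hb0
      positivity
    linarith

theorem quartic_bound_two_interior (hVu : ∀ x, 0 ≤ Vu x) (hVd : ∀ x, 0 ≤ Vd x)
    (hν : ν ∈ Set.Ioo (0 : ℝ) 1) (huu : 0 < bestConst / ν + βuu)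
    (hdd : 0 < bestConst / (1 - ν) + βdd)
    (hud : βud < 0 → βud ^ 2 < (bestConst / ν + βuu) * (bestConst / (1 - ν) + βdd)) (M : ℝ) :
    ∃ C : ℝ, ∀ u v, Adm Vu ν u → Adm Vd (1 - ν) v →
      realEnergy Vu Vd βuu βud βdd u v ≤ M → ∫ x, u x ^ 4 ≤ C ∧ ∫ x, v x ^ 4 ≤ C := by
  have hν0 := hν.1
  have hμ0 : 0 < 1 - ν := sub_pos.2 hν.2
  obtain ⟨ε, hε, hform⟩ := exists_pos_form_bound huu hdd hud
  refine ⟨2 * M / ε, fun u v hu hv hE => ?_⟩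
  have pu := hu.memH1.memLp_sq (by norm_num) (by norm_num)
  have pv := hv.memH1.memLp_sq (by norm_num) (by norm_num)
  have hE' := kinetic_quartic_le_realEnergy (βuu := βuu) (βud := βud) (βdd := βdd) hVu hVd u v
  have gu := bestConst_mul_le hu.memH1
  have gv := bestConst_mul_le hv.memH1
  rw [hu.mass] at gu
  rw [hv.mass] at gv
  have gu' : bestConst / ν * (∫ x, u x ^ 4) ≤ kinetic (toC u) := by
    rw [div_mul_eq_mul_div, div_le_iff₀ hν0]; exact gu
  have gv' : bestConst / (1 - ν) * (∫ x, v x ^ 4) ≤ kinetic (toC v) := by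
    rw [div_mul_eq_mul_div, div_le_iff₀ hμ0]; exact gv
  have n1 := integral_four_nonneg u
  have n2 := integral_four_nonneg v
  have key : ε * ((∫ x, u x ^ 4) + ∫ x, v x ^ 4) ≤ 2 * M := by
    have h1 : ∫ x, (ε * u x ^ 4 + ε * v x ^ 4) ≤ ∫ x, ((bestConst / ν + βuu) * u x ^ 4 +
        2 * βud * (u x ^ 2 * v x ^ 2) + (bestConst / (1 - ν) + βdd) * v x ^ 4) := by
      refine integral_mono (integral_lin_two ε ε (integrable_four pu) (integrable_four pv)).1
        (integral_form_eq _ _ _ pu pv).1 fun x => ?_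
      have := hform (u x ^ 2) (v x ^ 2) (sq_nonneg _) (sq_nonneg _)
      simp only [← pow_mul] at this ⊢
      linarith
    rw [(integral_lin_two ε ε (integrable_four pu) (integrable_four pv)).2,
      (integral_form_eq _ _ _ pu pv).2] at h1
    linarith
  constructor <;> rw [le_div_iff₀ hε] <;> nlinarith

theorem quartic_bound_two (hVu : ∀ x, 0 ≤ Vu x) (hVd : ∀ x, 0 ≤ Vd x)
    (hν : ν ∈ Set.Ioo (0 : ℝ) 1) (huu : -bestConst < ν * βuu) (hdd : -bestConst < (1 - ν) * βdd)
    (hud : -√((bestConst + ν * βuu) * (bestConst + (1 - ν) * βdd)) ≤ √(ν * (1 - ν)) * βud)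
    (hlast : -(1 / (2 * √(ν * (1 - ν)))) *
      (ν * (ν * βuu) + (1 - ν) * ((1 - ν) * βdd) + bestConst) < √(ν * (1 - ν)) * βud) (M : ℝ) :
    ∃ C : ℝ, ∀ u v, Adm Vu ν u → Adm Vd (1 - ν) v →
      realEnergy Vu Vd βuu βud βdd u v ≤ M → ∫ x, u x ^ 4 ≤ C ∧ ∫ x, v x ^ 4 ≤ C := by
  have hν0 := hν.1
  have hμ0 : 0 < 1 - ν := sub_pos.2 hν.2
  have hA : 0 < bestConst + ν * βuu := by linarith
  have hD : 0 < bestConst + (1 - ν) * βdd := by linarith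
  have hs : 0 < √(ν * (1 - ν)) := Real.sqrt_pos.2 (by positivity)
  have hss : √(ν * (1 - ν)) * √(ν * (1 - ν)) = ν * (1 - ν) := Real.mul_self_sqrt (by positivity)
  rcases hud.lt_or_eq with hlt | heq
  · have e1 : bestConst / ν + βuu = (bestConst + ν * βuu) / ν := by field_simp
    have e2 : bestConst / (1 - ν) + βdd = (bestConst + (1 - ν) * βdd) / (1 - ν) := by field_simp
    refine quartic_bound_two_interior hVu hVd hν (by rw [e1]; positivity) (by rw [e2]; positivity)
      (fun hneg => ?_) M
    rw [e1, e2, div_mul_div_comm, lt_div_iff₀ (by positivity)]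
    have h1 : √(ν * (1 - ν)) * -βud < √((bestConst + ν * βuu) * (bestConst + (1 - ν) * βdd)) := by
      linarith
    rw [Real.lt_sqrt (mul_nonneg hs.le (by linarith)), mul_pow, neg_sq, sq √_, hss] at h1
    linarith
  · have hα : 0 < √(ν * (bestConst + ν * βuu)) := Real.sqrt_pos.2 (by positivity)
    have hγ : 0 < √((1 - ν) * (bestConst + (1 - ν) * βdd)) := Real.sqrt_pos.2 (by positivity)
    have hα2 : √(ν * (bestConst + ν * βuu)) ^ 2 = ν * (bestConst + ν * βuu) :=
      Real.sq_sqrt (by positivity)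
    have hγ2 : √((1 - ν) * (bestConst + (1 - ν) * βdd)) ^ 2 =
        (1 - ν) * (bestConst + (1 - ν) * βdd) := Real.sq_sqrt (by positivity)
    have hprod : √(ν * (1 - ν)) * √((bestConst + ν * βuu) * (bestConst + (1 - ν) * βdd)) =
        √(ν * (bestConst + ν * βuu)) * √((1 - ν) * (bestConst + (1 - ν) * βdd)) := by
      rw [← Real.sqrt_mul (by positivity), ← Real.sqrt_mul (by positivity)]
      congr 1; ring
    have hcross : ν * (1 - ν) * βud =
        -(√(ν * (bestConst + ν * βuu)) * √((1 - ν) * (bestConst + (1 - ν) * βdd))) := by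
      rw [← hprod, ← mul_neg, heq, ← mul_assoc, hss]
    set α := √(ν * (bestConst + ν * βuu))
    set γ := √((1 - ν) * (bestConst + (1 - ν) * βdd))
    -- In these variables the last condition reads 2αγ < α² + γ², so it excludes exactly α = γ. The
    -- case α > γ is the case α < γ with the components exchanged.
    have hne : α ≠ γ := by
      intro h
      rw [neg_mul, neg_lt, one_div_mul_eq_div, lt_div_iff₀ (by positivity)] at hlast
      have e : -(√(ν * (1 - ν)) * βud) * (2 * √(ν * (1 - ν))) = 2 * (α * γ) := by
        have : -(√(ν * (1 - ν)) * βud) * (2 * √(ν * (1 - ν))) =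
          -2 * (√(ν * (1 - ν)) * √(ν * (1 - ν)) * βud) := by ring
        rw [this, hss, hcross]; ring
      have e' : ν * (ν * βuu) + (1 - ν) * ((1 - ν) * βdd) + bestConst = α ^ 2 + γ ^ 2 := by
        rw [hα2, hγ2]; ring
      rw [e, e', h] at hlast
      nlinarith
    rcases lt_or_gt_of_ne hne with h | h
    · exact quartic_bound_two_boundary hVu hVd hν hα h hα2.symm hγ2.symm hcross M
    · obtain ⟨C, hC⟩ := quartic_bound_two_boundary (βuu := βdd) (βud := βud) (βdd := βuu) hVd hVu
        (ν := 1 - ν) ⟨hμ0, by linarith⟩ hγ h hγ2.symm (by simpa using hα2.symm)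
        (by rw [sub_sub_cancel, mul_comm (1 - ν), hcross, mul_comm α]) M
      refine ⟨C, fun u v hu hv hE => ?_⟩
      rw [← realEnergy_swap] at hE
      exact (hC v u hv (by simpa using hu) hE).symm

end PlaneCoercive

end
end TwoComponentBEC

/-! ### Lower bounds tested on concentrating functions. -/

namespace TwoComponentBEC
noncomputable section
variable {d : ℕ}

/-- Smooth functions of mass one supported in the ball of radius `r`. -/
structure IsTrial (g : Space d → ℝ) (r : ℝ) : Prop where
  smooth : ContDiff ℝ ∞ g
  compact : HasCompactSupport g
  mass : ∫ x, g x ^ 2 = 1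
  radius : ∀ x, g x ≠ 0 → ‖x‖ ≤ r

/-- The functional `½ (∫ |∇g|² + β ∫ g⁴) + ∫ W g²` is bounded below by `m` on smooth compactly
supported functions of mass one. -/
def LowerBound (W : Space d → ℝ) (β m : ℝ) : Prop :=
  ∀ g : Space d → ℝ, ContDiff ℝ ∞ g → HasCompactSupport g → ∫ x, g x ^ 2 = 1 →
    m ≤ (1 / 2) * (kinetic (toC g) + β * ∫ x, g x ^ 4) + ∫ x, W x * g x ^ 2

/-- Only values of W on a compact set matter, and there W is integrable; a measure preserving shear
turns the integrand into a bounded factor times a product of integrable functions. -/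
theorem integrable_average {W : Space d → ℝ} (hW : LocallyIntegrable W volume) {a g : Space d → ℝ}
    (ha : Continuous a) (hac : HasCompactSupport a) (hg : Continuous g)
    (hgc : HasCompactSupport g) :
    Integrable (fun p : Space d × Space d => a p.1 * (W (p.2 + p.1) * g p.2 ^ 2))
      (volume.prod volume) := by
  obtain ⟨R, hR⟩ := hac.isCompact.isBounded.exists_norm_le
  obtain ⟨R', hR'⟩ := hgc.isCompact.isBounded.exists_norm_le
  obtain ⟨G, hG⟩ := (hasCompactSupport_sq hgc).exists_bound_of_continuous (hg.pow 2)
  set S : Set (Space d) := Metric.closedBall 0 (R + R')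
  have hWS : Integrable (S.indicator W) :=
    (integrable_indicator_iff measurableSet_closedBall).2
      (hW.integrableOn_isCompact (isCompact_closedBall _ _))
  have h1 := (ha.integrable_of_hasCompactSupport hac (μ := volume)).mul_prod hWS
  have h2 : Integrable (fun p : Space d × Space d =>
      g (p.2 - p.1) ^ 2 * (a p.1 * S.indicator W p.2)) (volume.prod volume) :=
    h1.bdd_mul ((hg.comp (continuous_snd.sub continuous_fst)).pow 2).aestronglyMeasurable
      (Eventually.of_forall fun p => hG (p.2 - p.1))
  have h3 := (measurePreserving_prod_add_right (volume : Measure (Space d))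
    (volume : Measure (Space d))).integrable_comp_of_integrable h2
  refine h3.congr (Eventually.of_forall fun p => ?_)
  simp only [Function.comp_apply, add_sub_cancel_right]
  by_cases h4 : a p.1 = 0
  · simp [h4]
  by_cases h5 : g p.2 = 0
  · simp [h5]
  have h6 : p.2 + p.1 ∈ S := by
    rw [mem_closedBall_zero_iff]
    have := hR p.1 (subset_tsupport _ h4)
    have := hR' p.2 (subset_tsupport _ h5)
    linarith [norm_add_le p.2 p.1]
  rw [Set.indicator_of_mem h6]
  ring

theorem continuous_average {W : Space d → ℝ} (hW : LocallyIntegrable W volume) {a : Space d → ℝ}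
    (ha : Continuous a) (hac : HasCompactSupport a) :
    Continuous fun y => ∫ z, a z * W (y + z) := by
  have h := HasCompactSupport.continuous_convolution_left (μ := volume)
    (ContinuousLinearMap.mul ℝ ℝ) (hac.comp_homeomorph (Homeomorph.neg (Space d)))
    (ha.comp continuous_neg) hW
  convert h using 1
  ext y
  rw [convolution_def, ← integral_neg_eq_self]
  simp [sub_eq_add_neg]

/-- A locally integrable W has no value at a point at which g could concentrate. Averaging the bound
over translates of g with weight a replaces W by a continuous function, and kinetic and quartic
terms do not increase under translation. -/
theorem LowerBound.average {W : Space d → ℝ} (hW : LocallyIntegrable W volume) {β m : ℝ}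
    (h : LowerBound W β m) {g : Space d → ℝ} {r : ℝ} (hg : IsTrial g r) {a : Space d → ℝ}
    (ha : Continuous a) (hac : HasCompactSupport a) (ha0 : ∀ z, 0 ≤ a z) :
    m * ∫ z, a z ≤ (1 / 2) * (kinetic (toC g) + β * ∫ x, g x ^ 4) * (∫ z, a z) +
      ∫ y, (∫ z, a z * W (y + z)) * g y ^ 2 := by
  have hint := integrable_average hW ha hac hg.smooth.continuous hg.compact
  have hai : Integrable a := ha.integrable_of_hasCompactSupport hac
  set E := (1 / 2) * (kinetic (toC g) + β * ∫ x, g x ^ 4) with hE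
  have hz : ∀ z, m ≤ E + ∫ y, W (y + z) * g y ^ 2 := by
    intro z
    have h1 := h (fun x => g (x + -z)) (hg.smooth.comp (contDiff_id.add contDiff_const))
      (hg.compact.comp_homeomorph (Homeomorph.addRight (-z)))
      (by rw [integral_add_right_eq_self (fun x => g x ^ 2)]; exact hg.mass)
    have h2 := ((memH1_of_contDiff hg.smooth hg.compact).1.comp_add (-z)).2
    rw [integral_add_right_eq_self (fun x => g x ^ 4)] at h1
    have h3 : ∫ x, W x * g (x + -z) ^ 2 = ∫ y, W (y + z) * g y ^ 2 := by
      rw [← integral_add_right_eq_self _ z]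
      simp
    rw [h3] at h1
    linarith
  have hi : Integrable fun z => a z * ∫ y, W (y + z) * g y ^ 2 := by
    have := hint.integral_prod_left
    simpa only [integral_const_mul] using this
  have h1 : ∫ z, m * a z ≤ ∫ z, (E * a z + 1 * (a z * ∫ y, W (y + z) * g y ^ 2)) := by
    refine integral_mono (hai.const_mul m) (integral_lin_two E 1 hai hi).1 fun z => ?_
    simp only
    nlinarith [mul_le_mul_of_nonneg_left (hz z) (ha0 z)]
  rw [(integral_lin_two E 1 hai hi).2, integral_const_mul, one_mul] at h1
  refine h1.trans_eq ?_
  congr 1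
  simp_rw [← integral_const_mul]
  rw [integral_integral_swap hint]
  congr 1; ext y
  rw [← integral_mul_const]
  congr 1; ext z; ring

theorem IsTrial.exists_integral_le {A : Space d → ℝ} (hA : Continuous A) {ε : ℝ} (hε : 0 < ε) :
    ∃ r : ℝ, 0 < r ∧ ∀ g : Space d → ℝ, IsTrial g r → ∫ y, A y * g y ^ 2 ≤ A 0 + ε := by
  obtain ⟨r, hr, h⟩ := Metric.continuousAt_iff.1 hA.continuousAt ε hε
  refine ⟨r / 2, by positivity, fun g hg => ?_⟩
  have hi := integrable_mul_sq_of_contDiff hA.locallyIntegrable hg.smooth.continuous hg.compact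
  have hg2 := (memLp_of_contDiff hg.smooth hg.compact 2).integrable_sq
  calc ∫ y, A y * g y ^ 2 ≤ ∫ y, (A 0 + ε) * g y ^ 2 := by
        refine integral_mono hi (hg2.const_mul _) fun y => ?_
        simp only
        by_cases hy : g y = 0
        · simp [hy]
        have h1 := h (x := y) (by
          have := hg.radius y hy
          rw [dist_zero_right]; linarith)
        rw [Real.dist_eq] at h1
        exact mul_le_mul_of_nonneg_right (by linarith [le_abs_self (A y - A 0)]) (sq_nonneg _)
    _ = A 0 + ε := by rw [integral_const_mul, hg.mass, mul_one]

theorem LowerBound.false_of_unbounded {W : Space d → ℝ} (hW : LocallyIntegrable W volume) {β m : ℝ}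
    (h : LowerBound W β m) (hg : ∀ r X : ℝ, 0 < r → ∃ g : Space d → ℝ, IsTrial g r ∧
      kinetic (toC g) + β * ∫ x, g x ^ 4 ≤ X) : False := by
  obtain ⟨a, ha⟩ := exists_isMollifier (d := d) one_pos
  have hA := continuous_average hW ha.smooth.continuous ha.compact
  obtain ⟨r, hr, hlim⟩ := IsTrial.exists_integral_le hA one_pos
  set A0 := ∫ z, a z * W (0 + z)
  obtain ⟨g, hg, hX⟩ := hg r (2 * (m - A0 - 2)) hr
  have h1 := h.average hW hg ha.smooth.continuous ha.compact ha.nonneg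
  have h2 := hlim g hg
  rw [ha.integral] at h1
  linarith

theorem ae_nonneg_of_integral_test {F : Space d → ℝ} (hF : LocallyIntegrable F volume)
    (h : ∀ a : Space d → ℝ, ContDiff ℝ ∞ a → HasCompactSupport a → (∀ z, 0 ≤ a z) →
      0 ≤ ∫ z, a z * F z) : ∀ᵐ x, 0 ≤ F x := by
  let φ : ℕ → ContDiffBump (0 : Space d) := fun n =>
    ⟨1 / ((n : ℝ) + 1), 2 * (1 / ((n : ℝ) + 1)), by positivity, by
      have : 0 < 1 / ((n : ℝ) + 1) := by positivity
      linarith⟩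
  have hφ : Tendsto (fun n => (φ n).rOut) atTop (𝓝 0) := by
    simpa [φ] using (tendsto_one_div_add_atTop_nhds_zero_nat (𝕜 := ℝ)).const_mul 2
  have hae := ContDiffBump.ae_convolution_tendsto_right_of_locallyIntegrable (φ := φ) (μ := volume)
    (K := 2) hφ (Eventually.of_forall fun n => le_rfl) hF
  refine hae.mono fun x hx => ge_of_tendsto' hx fun n => ?_
  rw [convolution_def, ← integral_sub_left_eq_self _ volume x]
  simp only [sub_sub_cancel, ContinuousLinearMap.lsmul_apply, smul_eq_mul]
  exact h (fun t => (φ n).normed volume (x - t))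
    ((φ n).contDiff_normed.comp (contDiff_const.sub contDiff_id))
    ((φ n).hasCompactSupport_normed.comp_homeomorph (Homeomorph.subLeft x))
    fun z => (φ n).nonneg_normed _

/-- Concentrating g at no energetic cost turns the averaged bound into m ∫ a ≤ ∫ a W for every
nonnegative test function a. -/
theorem LowerBound.ae_le {W : Space d → ℝ} (hW : LocallyIntegrable W volume) {β m : ℝ}
    (h : LowerBound W β m) (hg : ∀ r ε : ℝ, 0 < r → 0 < ε → ∃ g : Space d → ℝ, IsTrial g r ∧
      kinetic (toC g) + β * ∫ x, g x ^ 4 ≤ ε) : ∀ᵐ x, m ≤ W x := by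
  have hc : LocallyIntegrable (fun _ : Space d => m) volume := locallyIntegrable_const m
  have key : ∀ᵐ x, 0 ≤ W x - m := by
    refine ae_nonneg_of_integral_test (hW.sub hc) fun a ha hac ha0 => ?_
    have hai : Integrable a := ha.continuous.integrable_of_hasCompactSupport hac
    have hI0 : 0 ≤ ∫ z, a z := integral_nonneg ha0
    have hWa : Integrable fun z => a z * W z := by
      simpa using hW.integrable_smul_left_of_hasCompactSupport ha.continuous hac
    have e : ∫ z, a z * (W z - m) = (∫ z, a z * W z) - m * ∫ z, a z := by
      rw [← integral_const_mul, ← integral_sub hWa (hai.const_mul m)]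
      congr 1; ext z; ring
    rw [e, sub_nonneg]
    refine le_of_forall_pos_le_add fun ε hε => ?_
    have hA := continuous_average hW ha.continuous hac
    obtain ⟨r, hr, hlim⟩ := IsTrial.exists_integral_le hA (half_pos hε)
    obtain ⟨g, hg, hgε⟩ := hg r (ε / ((∫ z, a z) + 1)) hr (by positivity)
    have h1 := h.average hW hg ha.continuous hac ha0
    have h2 := hlim g hg
    simp only [zero_add] at h2
    have h3 : (1 / 2) * (kinetic (toC g) + β * ∫ x, g x ^ 4) * (∫ z, a z) ≤ ε / 2 := by
      have h4 : (kinetic (toC g) + β * ∫ x, g x ^ 4) * (∫ z, a z) ≤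
          ε / ((∫ z, a z) + 1) * ∫ z, a z := mul_le_mul_of_nonneg_right hgε hI0
      have h5 : ε / ((∫ z, a z) + 1) * (∫ z, a z) ≤ ε := by
        rw [div_mul_eq_mul_div, div_le_iff₀ (by positivity)]
        nlinarith
      linarith
    linarith
  exact key.mono fun x hx => by linarith

/-- The dilation that preserves mass. The quartic factor l^d beats the kinetic l² for d = 3; for d =
2 they balance, and only the sign of the sum counts. -/
theorem IsTrial.scale {g : Space d → ℝ} {R : ℝ} (hg : IsTrial g R) {l : ℝ} (hl : 0 < l) :
    ∃ g' : Space d → ℝ, IsTrial g' (R / l) ∧ kinetic (toC g') ≤ l ^ 2 * kinetic (toC g) ∧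
      ∫ x, g' x ^ 4 = l ^ d * ∫ x, g x ^ 4 := by
  set c := √(l ^ d) with hc
  have hc2 : c ^ 2 = l ^ d := Real.sq_sqrt (by positivity)
  have hH := (memH1_of_contDiff hg.smooth hg.compact).1.comp_smul hl
  have hH' := hH.1.const_mul_toC c
  have hl0 : (l ^ d : ℝ) ≠ 0 := by positivity
  refine ⟨fun x => c * g (l • x), ⟨contDiff_const.mul (hg.smooth.comp (contDiff_const_smul l)),
    (hg.compact.comp_homeomorph (Homeomorph.smulOfNeZero l hl.ne')).mul_left, ?_, ?_⟩, ?_, ?_⟩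
  · simp_rw [mul_pow]
    rw [integral_const_mul, integral_comp_smul_pos (fun x => g x ^ 2) hl, hc2, hg.mass]
    field_simp
  · intro x hx
    have := hg.radius _ (right_ne_zero_of_mul hx)
    rw [norm_smul, Real.norm_of_nonneg hl.le] at this
    rw [le_div_iff₀ hl]; linarith
  · rw [hH'.2, hc2]
    calc _ ≤ l ^ d * ((l ^ d)⁻¹ * l ^ 2 * kinetic (toC g)) :=
          mul_le_mul_of_nonneg_left hH.2 (by positivity)
      _ = _ := by field_simp
  · have e : ∀ x, (c * g (l • x)) ^ 4 = (l ^ d) ^ 2 * g (l • x) ^ 4 := fun x => by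
      rw [mul_pow, ← hc2]; ring
    simp_rw [e]
    rw [integral_const_mul, integral_comp_smul_pos (fun x => g x ^ 4) hl]
    field_simp

theorem exists_isTrial : ∃ (g : Space d → ℝ) (r : ℝ), IsTrial g r := by
  obtain ⟨χ, L, -, hs, hc, h0, -, h1, h2, -⟩ := exists_cutoff (d := d)
  have hpos : 0 < ∫ x, χ x ^ 2 := by
    have hχ2 := (memLp_of_contDiff hs hc 2).integrable_sq
    rw [integral_pos_iff_support_of_nonneg (fun x => sq_nonneg _) hχ2]
    refine lt_of_lt_of_le (Metric.measure_ball_pos volume (0 : Space d) one_pos)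
      (measure_mono fun x hx => ?_)
    have : χ x = 1 := h1 x (by simpa using (Metric.mem_ball.1 hx).le)
    simp [Function.mem_support, this]
  refine ⟨fun x => √(∫ x, χ x ^ 2)⁻¹ * χ x, 2, contDiff_const.mul hs, hc.mul_left, ?_, ?_⟩
  · simp_rw [mul_pow]
    rw [integral_const_mul, Real.sq_sqrt (by positivity), inv_mul_cancel₀ hpos.ne']
  · intro x hx
    by_contra hn
    exact right_ne_zero_of_mul hx (h2 x (not_le.1 hn).le)

theorem LowerBound.nonneg_of_three {W : Space 3 → ℝ}
    (hW : LocallyIntegrable W volume) {β m : ℝ} (h : LowerBound W β m) : 0 ≤ β := by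
  by_contra hβ
  push Not at hβ
  refine h.false_of_unbounded hW fun r X hr => ?_
  obtain ⟨g, R, hg⟩ := exists_isTrial (d := 3)
  have hN : 0 < ∫ x, g x ^ 4 := by
    refine integral_four_pos (by norm_num) (by norm_num) (memH1_of_contDiff hg.smooth hg.compact).1
      fun h0 => ?_
    have := (integral_sq_eq_zero_iff (memLp_of_contDiff hg.smooth hg.compact 2)).2 h0
    rw [hg.mass] at this
    exact one_ne_zero this
  have hK := kinetic_nonneg (toC g)
  set K := kinetic (toC g)
  set N := ∫ x, g x ^ 4
  have hbN : 0 < -β * N := mul_pos (by linarith) hN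
  -- The factor R/r shrinks the support into radius r; the last entry makes the energy at most -l²
  -- |X|, and l ≥ 1 turns this into at most X.
  set l := max (max 1 (R / r)) ((K + |X|) / (-β * N)) with hl
  have hl1 : 1 ≤ l := (le_max_left _ _).trans (le_max_left _ _)
  have hl0 : 0 < l := by linarith
  obtain ⟨g', hg', hK', hN'⟩ := hg.scale hl0
  refine ⟨g', ⟨hg'.smooth, hg'.compact, hg'.mass, fun x hx => (hg'.radius x hx).trans ?_⟩, ?_⟩
  · rw [div_le_iff₀ hl0]
    have : R / r ≤ l := (le_max_right _ _).trans (le_max_left _ _)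
    rw [div_le_iff₀ hr] at this
    linarith
  · have h1 : (K + |X|) / (-β * N) ≤ l := le_max_right _ _
    rw [div_le_iff₀ hbN] at h1
    rw [hN']
    have h2 : l ^ 2 * (K + |X|) ≤ l ^ 2 * (l * (-β * N)) :=
      mul_le_mul_of_nonneg_left h1 (by positivity)
    have h3 : |X| ≤ l ^ 2 * |X| := le_mul_of_one_le_left (abs_nonneg _) (one_le_pow₀ hl1)
    have h4 := neg_abs_le X
    nlinarith

/-- Smooth, compactly supported, nearly optimal functions for the Gagliardo–Nirenberg
inequality. -/
theorem exists_isTrial_near_optimal {ε : ℝ} (hε : 0 < ε) : ∃ (g : Space 2 → ℝ) (r : ℝ),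
    IsTrial g r ∧ 0 < kinetic (toC g) ∧ kinetic (toC g) < (bestConst + ε) * ∫ x, g x ^ 4 := by
  obtain ⟨u, hu, hN, hlt⟩ := exists_lt_bestConst_mul hε
  have hu2 := memLp_of_toC hu.1
  obtain ⟨w, K, hws, hwc, hwu, -, hwK, hK⟩ := exists_contDiff_seq hu
  have hwH := fun n => (memH1_of_contDiff (hws n) (hwc n)).1
  obtain ⟨C, hC⟩ := hK.bddAbove_range
  have hq := tendsto_sq_sub_sq (by norm_num) (by norm_num) hwH hu
    (fun n => (hwK n).trans (hC ⟨n, rfl⟩)) hwu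
  have hN' := tendsto_integral_sq (fun n => (hwH n).memLp_sq (by norm_num) (by norm_num))
    (hu.memLp_sq (by norm_num) (by norm_num)) hq
  have hm' := tendsto_integral_sq (fun n => memLp_of_toC (hwH n).1) hu2 hwu
  simp_rw [← pow_mul] at hN'
  norm_num at hN'
  have h1 : ∀ᶠ n in atTop, K n * (∫ x, w n x ^ 2) < (bestConst + ε) * ∫ x, w n x ^ 4 :=
    (hK.mul hm').eventually_lt (hN'.const_mul _) hlt
  have h2 : ∀ᶠ n in atTop, 0 < ∫ x, w n x ^ 4 := hN'.eventually_const_lt hN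
  obtain ⟨n, h1, h2⟩ := (h1.and h2).exists
  set W := w n
  have hm0 : 0 ≤ ∫ x, W x ^ 2 := integral_nonneg fun x => sq_nonneg _
  have hGN := bestConst_mul_le (hwH n)
  have hKm : 0 < kinetic (toC W) * ∫ x, W x ^ 2 := (mul_pos bestConst_pos h2).trans_le hGN
  have hm : 0 < ∫ x, W x ^ 2 := pos_of_mul_pos_right hKm (kinetic_nonneg _)
  have hKp : 0 < kinetic (toC W) := pos_of_mul_pos_left hKm hm0
  set m := ∫ x, W x ^ 2
  obtain ⟨R, hR⟩ := (hwc n).isCompact.isBounded.exists_norm_le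
  set c := √m⁻¹ with hc
  have hc2 : c ^ 2 = m⁻¹ := Real.sq_sqrt (by positivity)
  have hcH := (hwH n).const_mul_toC c
  refine ⟨fun x => c * W x, R, ⟨contDiff_const.mul (hws n), (hwc n).mul_left, ?_, ?_⟩, ?_, ?_⟩
  · simp_rw [mul_pow]
    rw [integral_const_mul, hc2, inv_mul_cancel₀ hm.ne']
  · exact fun x hx => hR x (subset_tsupport _ (right_ne_zero_of_mul hx))
  · rw [hcH.2, hc2]; positivity
  · have e : ∀ x, (c * W x) ^ 4 = (m⁻¹) ^ 2 * W x ^ 4 := fun x => by rw [mul_pow, ← hc2]; ring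
    simp_rw [e]
    rw [hcH.2, integral_const_mul, hc2]
    have h3 : kinetic (toC W) * m < (bestConst + ε) * ∫ x, W x ^ 4 :=
      (mul_le_mul_of_nonneg_right (hwK n) hm0).trans_lt h1
    have h4 := mul_lt_mul_of_pos_left h3 (show 0 < (m⁻¹) ^ 2 by positivity)
    have h5 : (m⁻¹) ^ 2 * m = m⁻¹ := by rw [sq, mul_assoc, inv_mul_cancel₀ hm.ne', mul_one]
    calc _ = (m⁻¹) ^ 2 * (kinetic (toC W) * m) := by rw [mul_left_comm, h5, mul_comm]
      _ < _ := h4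
      _ = _ := by ring

theorem LowerBound.ge_of_two {W : Space 2 → ℝ} (hW : LocallyIntegrable W volume) {β m : ℝ}
    (h : LowerBound W β m) : -bestConst ≤ β := by
  by_contra hβ
  push Not at hβ
  refine h.false_of_unbounded hW fun r X hr => ?_
  obtain ⟨g, R, hg, hK, hKN⟩ := exists_isTrial_near_optimal (ε := -β - bestConst) (by linarith)
  have hneg : kinetic (toC g) + β * ∫ x, g x ^ 4 < 0 := by
    have : bestConst + (-β - bestConst) = -β := by ring
    rw [this] at hKN
    linarith
  set K := kinetic (toC g)
  set N := ∫ x, g x ^ 4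
  set l := max (max 1 (R / r)) (|X| / -(K + β * N)) with hl
  have hl1 : 1 ≤ l := (le_max_left _ _).trans (le_max_left _ _)
  have hl0 : 0 < l := by linarith
  obtain ⟨g', hg', hK', hN'⟩ := hg.scale hl0
  refine ⟨g', ⟨hg'.smooth, hg'.compact, hg'.mass, fun x hx => (hg'.radius x hx).trans ?_⟩, ?_⟩
  · rw [div_le_iff₀ hl0]
    have : R / r ≤ l := (le_max_right _ _).trans (le_max_left _ _)
    rw [div_le_iff₀ hr] at this
    linarith
  · have h1 : |X| / -(K + β * N) ≤ l := le_max_right _ _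
    rw [div_le_iff₀ (by linarith)] at h1
    rw [hN']
    have h2 : l * |X| ≤ l * (l * -(K + β * N)) := mul_le_mul_of_nonneg_left h1 hl0.le
    have h3 : |X| ≤ l * |X| := le_mul_of_one_le_left (abs_nonneg _) hl1
    have h4 := neg_abs_le X
    nlinarith

end
end TwoComponentBEC

/-! ### Concentration of nearly optimal functions of large kinetic energy. -/

namespace TwoComponentBEC
noncomputable section
variable {d : ℕ}

theorem integral_mul_translate {p q : Space d → ℝ} (hp : Integrable p) (hq : Integrable q) :
    Integrable (fun y => ∫ x, q x * p (x - y)) ∧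
      ∫ y, ∫ x, q x * p (x - y) = (∫ x, q x) * ∫ x, p x := by
  have hp' : Integrable fun x => p (-x) := hp.comp_neg
  have e : (fun y => ∫ x, q x * p (x - y)) =
      convolution q (fun x => p (-x)) (ContinuousLinearMap.mul ℝ ℝ) volume := by
    ext y
    simp [convolution_def]
  have h1 := Integrable.integrable_convolution (ContinuousLinearMap.mul ℝ ℝ) hq hp'
  have h2 := integral_convolution (ContinuousLinearMap.mul ℝ ℝ) (μ := volume) (ν := volume) hq hp'
  rw [← e] at h1 h2
  refine ⟨h1, h2.trans ?_⟩
  simp only [ContinuousLinearMap.mul_apply']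
  rw [integral_neg_eq_self (fun x => p x)]

theorem fderiv_mul_apply {χ f : Space d → ℝ} (hχ : ContDiff ℝ ∞ χ) (hf : ContDiff ℝ ∞ f)
    (x : Space d) :
    fderiv ℝ (fun x => χ x * f x) x = χ x • fderiv ℝ f x + f x • fderiv ℝ χ x :=
  (((hχ.differentiable (by simp)).differentiableAt (x := x)).hasFDerivAt.mul
    ((hf.differentiable (by simp)).differentiableAt (x := x)).hasFDerivAt).fderiv

theorem sq_norm_fderiv_mul_le {χ f : Space d → ℝ} (hχ : ContDiff ℝ ∞ χ) (hf : ContDiff ℝ ∞ f)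
    {θ : ℝ} (hθ : 0 < θ) (x : Space d) : ‖fderiv ℝ (fun x => χ x * f x) x‖ ^ 2 ≤
      (1 + θ) * (‖fderiv ℝ f x‖ ^ 2 * χ x ^ 2) + (1 + θ⁻¹) * (f x ^ 2 * ‖fderiv ℝ χ x‖ ^ 2) := by
  rw [fderiv_mul_apply hχ hf]
  have h1 : ‖χ x • fderiv ℝ f x + f x • fderiv ℝ χ x‖ ≤
      |χ x| * ‖fderiv ℝ f x‖ + |f x| * ‖fderiv ℝ χ x‖ := by
    refine (norm_add_le _ _).trans_eq ?_
    rw [norm_smul, norm_smul, Real.norm_eq_abs, Real.norm_eq_abs]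
  have h2 := pow_le_pow_left₀ (norm_nonneg _) h1 2
  refine h2.trans ?_
  set A := |χ x| * ‖fderiv ℝ f x‖ with hA
  set B := |f x| * ‖fderiv ℝ χ x‖ with hB
  have eA : ‖fderiv ℝ f x‖ ^ 2 * χ x ^ 2 = A ^ 2 := by rw [hA, mul_pow, sq_abs]; ring
  have eB : f x ^ 2 * ‖fderiv ℝ χ x‖ ^ 2 = B ^ 2 := by rw [hB, mul_pow, sq_abs]
  rw [eA, eB]
  have h3 : 0 ≤ θ⁻¹ * (θ * A - B) ^ 2 := by positivity
  have h4 : θ⁻¹ * (θ * A - B) ^ 2 = θ * A ^ 2 - 2 * (A * B) + θ⁻¹ * B ^ 2 := by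
    field_simp
    ring
  nlinarith

theorem integrable_norm_fderiv_sq {f : Space d → ℝ} (hf : ContDiff ℝ ∞ f)
    (hc : HasCompactSupport f) : Integrable fun x => ‖fderiv ℝ f x‖ ^ 2 := by
  have : MemLp (fun x => ‖fderiv ℝ f x‖) 2 volume :=
    (hf.continuous_fderiv (by simp)).norm.memLp_of_hasCompactSupport (hc.fderiv ℝ).norm
  exact this.integrable_sq

theorem integrable_pow_four {f : Space d → ℝ} (hf : Continuous f)
    (hc : HasCompactSupport f) : Integrable fun x => f x ^ 4 := by
  have h : HasCompactSupport fun x => f x ^ 4 := hc.mono fun x hx => by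
    rw [Function.mem_support] at hx ⊢
    exact fun h0 => hx (by rw [h0, zero_pow four_ne_zero])
  exact (hf.pow 4).integrable_of_hasCompactSupport h

/-- If no translate of `χ` captures more than the fraction `M` of the mass of `f`, then `f` is far
from optimal in the Gagliardo–Nirenberg inequality. -/
theorem bestConst_mul_le_of_spread {f χ : Space 2 → ℝ} (hf : ContDiff ℝ ∞ f)
    (hfc : HasCompactSupport f) (hm : ∫ x, f x ^ 2 = 1) (hχ : ContDiff ℝ ∞ χ)
    (hχc : HasCompactSupport χ) {M θ : ℝ} (hθ : 0 < θ)
    (hM : ∀ y, ∫ x, f x ^ 2 * χ (x - y) ^ 2 ≤ M) :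
    bestConst * ((∫ x, f x ^ 4) * ∫ x, χ x ^ 4) ≤
      M * ((1 + θ) * (kinetic (toC f) * ∫ x, χ x ^ 2) + (1 + θ⁻¹) * kinetic (toC χ)) := by
  have f2 := (memLp_of_contDiff hf hfc 2).integrable_sq
  have f4 := integrable_pow_four hf.continuous hfc
  have fd := integrable_norm_fderiv_sq hf hfc
  have c2 := (memLp_of_contDiff hχ hχc 2).integrable_sq
  have c4 := integrable_pow_four hχ.continuous hχc
  have cd := integrable_norm_fderiv_sq hχ hχc
  have t4 := integral_mul_translate c4 f4
  have t2 := integral_mul_translate c2 fd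
  have td := integral_mul_translate cd f2
  have hM0 : 0 ≤ M := (integral_nonneg fun x => by positivity).trans (hM 0)
  have hy : ∀ y, bestConst * (∫ x, f x ^ 4 * χ (x - y) ^ 4) ≤
      M * (1 + θ) * (∫ x, ‖fderiv ℝ f x‖ ^ 2 * χ (x - y) ^ 2) +
        M * (1 + θ⁻¹) * ∫ x, f x ^ 2 * ‖fderiv ℝ χ (x - y)‖ ^ 2 := by
    intro y
    set χy : Space 2 → ℝ := fun x => χ (x - y) with hχy
    have hs : ContDiff ℝ ∞ χy := hχ.comp (contDiff_id.sub contDiff_const)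
    have hsc : HasCompactSupport χy := hχc.comp_homeomorph (Homeomorph.subRight y)
    have hder : ∀ x, fderiv ℝ χy x = fderiv ℝ χ (x - y) := fun x => by
      simp only [hχy, sub_eq_add_neg, fderiv_comp_add_right]
    have hps : ContDiff ℝ ∞ fun x => χy x * f x := hs.mul hf
    have hpc : HasCompactSupport fun x => χy x * f x := hfc.mul_left
    have h1 := bestConst_mul_le (memH1_of_contDiff hps hpc).1
    rw [kinetic_of_contDiff hps hpc] at h1
    have e4 : ∫ x, (χy x * f x) ^ 4 = ∫ x, f x ^ 4 * χ (x - y) ^ 4 := by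
      congr 1; ext x; simp only [hχy]; ring
    have e2 : ∫ x, (χy x * f x) ^ 2 = ∫ x, f x ^ 2 * χ (x - y) ^ 2 := by
      congr 1; ext x; simp only [hχy]; ring
    rw [e4, e2] at h1
    have i1 : Integrable fun x => ‖fderiv ℝ f x‖ ^ 2 * χ (x - y) ^ 2 :=
      (((hf.continuous_fderiv (by simp)).norm.pow 2).mul (hs.continuous.pow 2))
        |>.integrable_of_hasCompactSupport (hasCompactSupport_sq hsc).mul_left
    have i2 : Integrable fun x => f x ^ 2 * ‖fderiv ℝ χ (x - y)‖ ^ 2 := by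
      simp_rw [← hder]
      exact ((hf.continuous.pow 2).mul ((hs.continuous_fderiv (by simp)).norm.pow 2))
        |>.integrable_of_hasCompactSupport (hasCompactSupport_sq hfc).mul_right
    have h2 : ∫ x, ‖fderiv ℝ (fun x => χy x * f x) x‖ ^ 2 ≤
        (1 + θ) * (∫ x, ‖fderiv ℝ f x‖ ^ 2 * χ (x - y) ^ 2) +
          (1 + θ⁻¹) * ∫ x, f x ^ 2 * ‖fderiv ℝ χ (x - y)‖ ^ 2 := by
      rw [← (integral_lin_two _ _ i1 i2).2]
      refine integral_mono (integrable_norm_fderiv_sq hps hpc) (integral_lin_two _ _ i1 i2).1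
        fun x => ?_
      have := sq_norm_fderiv_mul_le hs hf hθ x
      rwa [hder] at this
    calc _ ≤ _ := h1
      _ ≤ ((1 + θ) * (∫ x, ‖fderiv ℝ f x‖ ^ 2 * χ (x - y) ^ 2) +
          (1 + θ⁻¹) * ∫ x, f x ^ 2 * ‖fderiv ℝ χ (x - y)‖ ^ 2) * M :=
        mul_le_mul h2 (hM y) (integral_nonneg fun x => by positivity) (by positivity)
      _ = _ := by ring
  -- The windowed inequalities are integrated over all positions y of the window; by Fubini every
  -- term becomes a product of an integral of f and one of χ.
  have h3 := integral_mono (t4.1.const_mul bestConst)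
    (integral_lin_two (M * (1 + θ)) (M * (1 + θ⁻¹)) t2.1 td.1).1 hy
  rw [(integral_lin_two (M * (1 + θ)) (M * (1 + θ⁻¹)) t2.1 td.1).2, integral_const_mul, t4.2,
    t2.2, td.2, hm, ← kinetic_of_contDiff hf hfc, ← kinetic_of_contDiff hχ hχc] at h3
  linarith

/-- Smooth windows close to the indicator function of a ball. -/
theorem exists_window {ρ e : ℝ} (hρ : 0 < ρ) (he : 0 < e) (he1 : e ≤ 1) : ∃ χ : Space 2 → ℝ,
    ContDiff ℝ ∞ χ ∧ HasCompactSupport χ ∧ (∀ x, 0 ≤ χ x) ∧ (∀ x, χ x ≤ 1) ∧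
    (∀ x, ρ ≤ ‖x‖ → χ x = 0) ∧ 0 < ∫ x, χ x ^ 2 ∧
    (1 - e / 2) * ∫ x, χ x ^ 2 ≤ ∫ x, χ x ^ 4 := by
  have hin : 0 < ρ * (1 - e / 4) := by
    apply mul_pos hρ; linarith
  -- The inner radius is chosen so that (1 - e/4)² ≥ 1 - e/2; the areas of the two balls then
  -- compare the fourth and second moments.
  let b : ContDiffBump (0 : Space 2) := ⟨ρ * (1 - e / 4), ρ, hin, by nlinarith⟩
  have hs : ContDiff ℝ ∞ b := b.contDiff
  have hc := b.hasCompactSupport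
  have c2 := (memLp_of_contDiff hs hc 2).integrable_sq
  have c4 := integrable_pow_four hs.continuous hc
  set V := volume.real (Metric.closedBall (0 : Space 2) 1) with hV
  have hV0 : 0 < V := ENNReal.toReal_pos
    (Metric.measure_closedBall_pos volume _ one_pos).ne' measure_closedBall_lt_top.ne
  have hvol : ∀ {s : ℝ}, 0 ≤ s → volume.real (Metric.closedBall (0 : Space 2) s) = s ^ 2 * V := by
    intro s hs
    rw [Measure.addHaar_real_closedBall' volume _ hs, finrank_euclideanSpace_fin]
  have hlow : (ρ * (1 - e / 4)) ^ 2 * V ≤ ∫ x, b x ^ 4 := by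
    rw [← hvol hin.le, ← integral_indicator_one measurableSet_closedBall]
    refine integral_mono ((integrable_indicator_iff measurableSet_closedBall).2
      (integrableOn_const measure_closedBall_lt_top.ne)) c4 fun x => ?_
    by_cases hx : x ∈ Metric.closedBall (0 : Space 2) (ρ * (1 - e / 4))
    · rw [Set.indicator_of_mem hx, b.one_of_mem_closedBall hx]; simp
    · rw [Set.indicator_of_notMem hx]
      have := b.nonneg (x := x)
      positivity
  have hup : ∫ x, b x ^ 2 ≤ ρ ^ 2 * V := by
    rw [← hvol hρ.le, ← integral_indicator_one measurableSet_closedBall]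
    refine integral_mono c2 ((integrable_indicator_iff measurableSet_closedBall).2
      (integrableOn_const measure_closedBall_lt_top.ne)) fun x => ?_
    by_cases hx : x ∈ Metric.closedBall (0 : Space 2) ρ
    · rw [Set.indicator_of_mem hx]
      exact pow_le_one₀ b.nonneg b.le_one
    · rw [Set.indicator_of_notMem hx, b.zero_of_le_dist]
      · simp
      · simpa using (not_le.1 (by simpa using hx)).le
  have h42 : ∫ x, b x ^ 4 ≤ ∫ x, b x ^ 2 := integral_mono c4 c2 fun x =>
    pow_le_pow_of_le_one b.nonneg b.le_one (by norm_num)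
  refine ⟨b, hs, hc, fun x => b.nonneg, fun x => b.le_one, fun x hx => b.zero_of_le_dist ?_, ?_, ?_⟩
  · simpa using hx
  · exact lt_of_lt_of_le (by positivity) (hlow.trans h42)
  · refine le_trans ?_ hlow
    calc (1 - e / 2) * ∫ x, b x ^ 2 ≤ (1 - e / 2) * (ρ ^ 2 * V) :=
          mul_le_mul_of_nonneg_left hup (by linarith)
      _ ≤ _ := by
        have : 0 ≤ ρ ^ 2 * V * (e / 4) ^ 2 := by positivity
        nlinarith

/-- Nearly optimal functions with a large kinetic energy. -/
theorem exists_concentrated {k δ : ℝ} (hk : 0 < k) (hδ : 0 < δ) : ∃ (f : Space 2 → ℝ) (r : ℝ),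
    IsTrial f r ∧ bestConst * (∫ x, f x ^ 4) = k ∧ kinetic (toC f) ≤ k + δ := by
  have hb := bestConst_pos
  -- Dilation by l multiplies the deficit by l² = k/(bestConst · N); this relative accuracy leaves
  -- the absolute deficit at most δ after normalizing the quartic term to k.
  obtain ⟨g, R, hg, hK, hKN⟩ := exists_isTrial_near_optimal
    (ε := δ * bestConst / k) (by positivity)
  have hN : 0 < ∫ x, g x ^ 4 := by
    have : 0 < bestConst + δ * bestConst / k := by positivity
    exact pos_of_mul_pos_right (hK.trans hKN) this.le
  set N := ∫ x, g x ^ 4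
  set l := √(k / (bestConst * N)) with hl
  have hl0 : 0 < l := Real.sqrt_pos.2 (by positivity)
  have hl2 : l ^ 2 = k / (bestConst * N) := Real.sq_sqrt (by positivity)
  obtain ⟨f, hf, hfK, hfN⟩ := hg.scale hl0
  refine ⟨f, R / l, hf, ?_, hfK.trans ?_⟩
  · rw [hfN, hl2, show ∫ x, g x ^ 4 = N from rfl]; field_simp
  · have h1 := mul_le_mul_of_nonneg_left hKN.le (sq_nonneg l)
    refine h1.trans_eq ?_
    rw [hl2]; field_simp

end
end TwoComponentBEC

/-! ### Small absolute deficit with arbitrarily small support. -/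

namespace TwoComponentBEC
noncomputable section
variable {d : ℕ}

/-- The retained gain of half of s² a² pays for the quartic tail in `cut_deficit_le`; a cutoff
estimate without it would leave that tail uncontrolled by the small mass. -/
theorem cut_gradient_le {s a p : ℝ} (hs0 : 0 ≤ s) (hs1 : s ≤ 1) :
    ((1 - s ^ 2) * a + 2 * s * p) ^ 2 ≤ a ^ 2 + (-(1 / 2)) * (s ^ 2 * a ^ 2) + 12 * p ^ 2 := by
  have ht : s ^ 2 ≤ 1 := pow_le_one₀ hs0 hs1
  have h1 : 0 ≤ (s * (1 - s ^ 2) * a - 4 * p) ^ 2 := sq_nonneg _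
  have h2 : s ^ 2 * p ^ 2 ≤ p ^ 2 := mul_le_of_le_one_left (sq_nonneg _) ht
  have h3 : (1 - s ^ 2) ^ 2 * (1 + s ^ 2 / 2) ≤ 1 - s ^ 2 / 2 := by
    nlinarith [mul_nonneg (sq_nonneg s) (sub_nonneg.2 ht), sq_nonneg (s ^ 2),
      mul_nonneg (mul_nonneg (sq_nonneg s) (sub_nonneg.2 ht)) (sq_nonneg s)]
  have h4 := mul_le_mul_of_nonneg_right h3 (sq_nonneg a)
  nlinarith

/-- The effect of cutting off a tail of small mass on the deficit in the Gagliardo–Nirenberg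
inequality. -/
theorem cut_deficit_le {C : ℝ} (hC0 : 0 ≤ C) (hC : ∀ v : Space 2 → ℝ, ContDiff ℝ ∞ v →
      HasCompactSupport v → ∫ x, v x ^ 2 ≤ C * (∫ x, ‖fderiv ℝ v x‖) ^ 2)
    {f s σ : Space 2 → ℝ} (hf : ContDiff ℝ ∞ f) (hfc : HasCompactSupport f)
    (hs : ContDiff ℝ ∞ s) (hs0 : ∀ x, 0 ≤ s x) (hs1 : ∀ x, s x ≤ 1) {L : ℝ}
    (hL : ∀ x, ‖fderiv ℝ s x‖ ≤ L) (hσ : Continuous σ) (hσ0 : ∀ x, 0 ≤ σ x) (hσ1 : ∀ x, σ x ≤ 1)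
    (hsσ : ∀ x, s x ≠ 0 → σ x = 1) (hdσ : ∀ x, fderiv ℝ s x ≠ 0 → σ x = 1) {e : ℝ}
    (he1 : e ≤ 1) (he : ∫ x, σ x * f x ^ 2 ≤ e) (heC : 32 * bestConst * C * e ≤ 1 / 2) :
    kinetic (toC fun x => (1 - s x ^ 2) * f x) - bestConst * (∫ x, ((1 - s x ^ 2) * f x) ^ 4) ≤
      kinetic (toC f) - bestConst * (∫ x, f x ^ 4) + e * (L ^ 2 * (12 + 8 * bestConst * C)) := by
  have hb := bestConst_pos
  have hL0 : 0 ≤ L := (norm_nonneg _).trans (hL 0)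
  have hσf : Integrable fun x => σ x * f x ^ 2 :=
    (hσ.mul (hf.continuous.pow 2)).integrable_of_hasCompactSupport (hasCompactSupport_sq hfc).mul_left
  have he0 : 0 ≤ e :=
    (integral_nonneg fun x => mul_nonneg (hσ0 x) (sq_nonneg (f x))).trans he
  have hη : ContDiff ℝ ∞ fun x => 1 - s x ^ 2 := contDiff_const.sub (hs.pow 2)
  have hg : ContDiff ℝ ∞ fun x => (1 - s x ^ 2) * f x := hη.mul hf
  have hgc : HasCompactSupport fun x => (1 - s x ^ 2) * f x := hfc.mul_left
  have hfd := integrable_norm_fderiv_sq hf hfc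
  have hcfd := (hf.continuous_fderiv (by simp)).norm
  have hPi : Integrable fun x => s x ^ 2 * ‖fderiv ℝ f x‖ ^ 2 :=
    ((hs.continuous.pow 2).mul (hcfd.pow 2)).integrable_of_hasCompactSupport
      (hasCompactSupport_sq (hfc.fderiv ℝ).norm).mul_left
  set P := ∫ x, s x ^ 2 * ‖fderiv ℝ f x‖ ^ 2 with hP
  have hP0 : 0 ≤ P := integral_nonneg fun x => by positivity
  have hLσ : ∀ x, ‖fderiv ℝ s x‖ ≤ L * σ x := fun x => by
    by_cases h : fderiv ℝ s x = 0
    · rw [h, norm_zero]; exact mul_nonneg hL0 (hσ0 x)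
    · rw [hdσ x h, mul_one]; exact hL x
  have hsq : ∀ x, fderiv ℝ (fun y => s y ^ 2) x = (2 * s x) • fderiv ℝ s x := fun x => by
    have := ((hs.differentiable (by simp)).differentiableAt (x := x)).hasFDerivAt.pow 2
    rw [this.fderiv]
    simp
  -- kinetic energy
  have hK : kinetic (toC fun x => (1 - s x ^ 2) * f x) ≤
      kinetic (toC f) - (1 / 2) * P + 12 * L ^ 2 * e := by
    rw [kinetic_of_contDiff hg hgc, kinetic_of_contDiff hf hfc]
    have hlin := integral_lin_three 1 (-(1 / 2)) (12 * L ^ 2) hfd hPi hσf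
    have h1 : ∫ x, ‖fderiv ℝ (fun x => (1 - s x ^ 2) * f x) x‖ ^ 2 ≤
        ∫ x, (1 * ‖fderiv ℝ f x‖ ^ 2 + (-(1 / 2)) * (s x ^ 2 * ‖fderiv ℝ f x‖ ^ 2) +
          12 * L ^ 2 * (σ x * f x ^ 2)) := by
      refine integral_mono (integrable_norm_fderiv_sq hg hgc) hlin.1 fun x => ?_
      simp only
      rw [fderiv_mul_apply hη hf, fderiv_const_sub, hsq]
      have h2 : ‖(1 - s x ^ 2) • fderiv ℝ f x + f x • -((2 * s x) • fderiv ℝ s x)‖ ≤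
          (1 - s x ^ 2) * ‖fderiv ℝ f x‖ + 2 * s x * (|f x| * ‖fderiv ℝ s x‖) := by
        refine (norm_add_le _ _).trans_eq ?_
        rw [norm_smul, norm_smul, norm_neg, norm_smul, Real.norm_of_nonneg
          (sub_nonneg.2 (pow_le_one₀ (hs0 x) (hs1 x))), Real.norm_eq_abs (f x),
          Real.norm_of_nonneg (mul_nonneg zero_le_two (hs0 x))]
        ring
      have h3 : (|f x| * ‖fderiv ℝ s x‖) ^ 2 ≤ L ^ 2 * (σ x * f x ^ 2) := by
        rw [mul_pow, sq_abs]
        have h4 : ‖fderiv ℝ s x‖ ^ 2 ≤ (L * σ x) ^ 2 := pow_le_pow_left₀ (norm_nonneg _) (hLσ x) 2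
        have h5 : σ x ^ 2 ≤ σ x := by
          rw [sq]; exact mul_le_of_le_one_left (hσ0 x) (hσ1 x)
        calc f x ^ 2 * ‖fderiv ℝ s x‖ ^ 2 ≤ f x ^ 2 * (L ^ 2 * σ x) := by
              refine mul_le_mul_of_nonneg_left (h4.trans ?_) (sq_nonneg _)
              rw [mul_pow]
              exact mul_le_mul_of_nonneg_left h5 (sq_nonneg _)
          _ = _ := by ring
      have h6 := pow_le_pow_left₀ (norm_nonneg _) h2 2
      have h7 := cut_gradient_le (a := ‖fderiv ℝ f x‖) (p := |f x| * ‖fderiv ℝ s x‖)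
        (hs0 x) (hs1 x)
      linarith
    rw [hlin.2] at h1
    nlinarith [mul_le_mul_of_nonneg_left he (show 0 ≤ 12 * L ^ 2 by positivity)]
  -- the quartic tail
  have htail : ∫ x, (s x * f x ^ 2) ^ 2 ≤ C * (2 * L ^ 2 * e ^ 2 + 8 * e * P) := by
    have hv : ContDiff ℝ ∞ fun x => s x * f x ^ 2 := hs.mul (hf.pow 2)
    have hvc : HasCompactSupport fun x => s x * f x ^ 2 := (hasCompactSupport_sq hfc).mul_left
    refine (hC _ hv hvc).trans (mul_le_mul_of_nonneg_left ?_ hC0)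
    have hφ : MemLp (fun x => σ x * |f x|) 2 volume :=
      (hσ.mul hf.continuous.abs).memLp_of_hasCompactSupport
        (hfc.norm.mul_left : HasCompactSupport fun x => σ x * ‖f x‖)
    have hψ : MemLp (fun x => s x * ‖fderiv ℝ f x‖) 2 volume :=
      (hs.continuous.mul hcfd).memLp_of_hasCompactSupport (hfc.fderiv ℝ).norm.mul_left
    have h1 : ∫ x, ‖fderiv ℝ (fun x => s x * f x ^ 2) x‖ ≤
        ∫ x, (L * (σ x * f x ^ 2) + 2 * ((σ x * |f x|) * (s x * ‖fderiv ℝ f x‖))) := by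
      refine integral_mono ((hv.continuous_fderiv (by simp)).norm.integrable_of_hasCompactSupport
        (hvc.fderiv ℝ).norm) (integral_lin_two L 2 hσf (integrable_mul_of_memLp_two hφ hψ)).1
        fun x => ?_
      simp only
      rw [fderiv_mul_apply hs (hf.pow 2)]
      have hfsq : fderiv ℝ (fun y => f y ^ 2) x = (2 * f x) • fderiv ℝ f x := by
        have := ((hf.differentiable (by simp)).differentiableAt (x := x)).hasFDerivAt.pow 2
        rw [this.fderiv]
        simp
      rw [hfsq]
      refine (norm_add_le _ _).trans ?_
      rw [norm_smul, norm_smul, norm_smul, Real.norm_of_nonneg (hs0 x),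
        Real.norm_of_nonneg (sq_nonneg (f x)), norm_mul, Real.norm_eq_abs (f x),
        Real.norm_of_nonneg zero_le_two]
      have h2 : f x ^ 2 * ‖fderiv ℝ s x‖ ≤ L * (σ x * f x ^ 2) := by
        nlinarith [mul_le_mul_of_nonneg_left (hLσ x) (sq_nonneg (f x))]
      have h3 : s x * (2 * |f x| * ‖fderiv ℝ f x‖) =
          2 * ((σ x * |f x|) * (s x * ‖fderiv ℝ f x‖)) := by
        by_cases h : s x = 0
        · simp [h]
        · rw [hsσ x h]; ring
      linarith
    rw [(integral_lin_two L 2 hσf (integrable_mul_of_memLp_two hφ hψ)).2] at h1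
    have h4 := (le_abs_self _).trans (abs_integral_mul_le hφ hψ)
    have h5 : √(∫ x, (σ x * |f x|) ^ 2) ≤ √e := by
      refine Real.sqrt_le_sqrt (le_trans (integral_mono hφ.integrable_sq hσf fun x => ?_) he)
      simp only [mul_pow, sq_abs]
      refine mul_le_mul_of_nonneg_right ?_ (sq_nonneg _)
      rw [sq]; exact mul_le_of_le_one_left (hσ0 x) (hσ1 x)
    have h6 : √(∫ x, (s x * ‖fderiv ℝ f x‖) ^ 2) = √P := by simp_rw [hP, mul_pow]
    rw [h6] at h4
    have h7 : ∫ x, ‖fderiv ℝ (fun x => s x * f x ^ 2) x‖ ≤ L * e + 2 * (√e * √P) := by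
      have := mul_le_mul_of_nonneg_right h5 (Real.sqrt_nonneg P)
      have := mul_le_mul_of_nonneg_left he hL0
      linarith
    have h8 := pow_le_pow_left₀ (integral_nonneg fun x => norm_nonneg _) h7 2
    refine h8.trans ?_
    have h9 : (√e * √P) ^ 2 = e * P := by rw [mul_pow, Real.sq_sqrt he0, Real.sq_sqrt hP0]
    nlinarith [sq_nonneg (L * e - 2 * (√e * √P))]
  -- quartic term
  have hN : (∫ x, f x ^ 4) - 4 * (∫ x, (s x * f x ^ 2) ^ 2) ≤ ∫ x, ((1 - s x ^ 2) * f x) ^ 4 := by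
    have i4 := integrable_pow_four hf.continuous hfc
    have iv : Integrable fun x => (s x * f x ^ 2) ^ 2 :=
      (memLp_of_contDiff (hs.mul (hf.pow 2)) (hasCompactSupport_sq hfc).mul_left 2).integrable_sq
    have h1 : ∫ x, (1 * f x ^ 4 + (-4) * (s x * f x ^ 2) ^ 2) ≤
        ∫ x, ((1 - s x ^ 2) * f x) ^ 4 := by
      refine integral_mono (integral_lin_two 1 (-4) i4 iv).1
        (integrable_pow_four hg.continuous hgc) fun x => ?_
      simp only
      -- Bernoulli's inequality: the loss is at most 4 s² f⁴ = 4 (s f²)², and s f² is smooth, so the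
      -- W^{1,1} embedding applies to it.
      have h2 := one_add_mul_le_pow (a := -(s x ^ 2))
        (by nlinarith [pow_le_one₀ (hs0 x) (hs1 x) (n := 2)]) 4
      have h3 := mul_le_mul_of_nonneg_right h2 (show 0 ≤ f x ^ 4 by positivity)
      rw [show ((1 - s x ^ 2) * f x) ^ 4 = (1 + -(s x ^ 2)) ^ 4 * f x ^ 4 by ring]
      refine le_trans (le_of_eq ?_) h3
      push_cast
      ring
    rw [(integral_lin_two 1 (-4) i4 iv).2] at h1
    linarith
  have h1 := mul_le_mul_of_nonneg_left hN hb.le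
  have h2 := mul_le_mul_of_nonneg_left htail hb.le
  -- The quartic tail contributes 4 · bestConst · C · 8 e P, and smallness of `e` lets the kinetic
  -- gain P/2 absorb it; what remains is linear in `e`.
  have h3 := mul_le_mul_of_nonneg_right heC hP0
  have h4 : bestConst * C * L ^ 2 * e ^ 2 ≤ bestConst * C * L ^ 2 * e :=
    mul_le_mul_of_nonneg_left (by nlinarith) (by positivity)
  nlinarith

theorem exists_small_parameter {a A ε : ℝ} (ha : 0 ≤ a) (hA : 0 ≤ A) (hε : 0 < ε) :
    ∃ e : ℝ, 0 < e ∧ e ≤ 1 / 4 ∧ a * e ≤ 1 / 2 ∧ e * A ≤ ε := by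
  refine ⟨min (1 / 4) (min (1 / 2 / (a + 1)) (ε / (A + 1))), by positivity, min_le_left _ _, ?_, ?_⟩
  · have h1 : min (1 / 4) (min (1 / 2 / (a + 1)) (ε / (A + 1))) ≤ 1 / 2 / (a + 1) :=
      (min_le_right _ _).trans (min_le_left _ _)
    have h0 : 0 < min (1 / 4) (min (1 / 2 / (a + 1)) (ε / (A + 1))) := by positivity
    rw [le_div_iff₀ (by positivity)] at h1
    linarith
  · have h1 : min (1 / 4) (min (1 / 2 / (a + 1)) (ε / (A + 1))) ≤ ε / (A + 1) :=
      (min_le_right _ _).trans (min_le_right _ _)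
    have h0 : 0 < min (1 / 4) (min (1 / 2 / (a + 1)) (ε / (A + 1))) := by positivity
    rw [le_div_iff₀ (by positivity)] at h1
    linarith

/-- Normalizing a function whose mass lies between `1/2` and `1`. -/
theorem exists_isTrial_of_mass {r ε : ℝ} (hε : 0 < ε) {g : Space 2 → ℝ} (hgs : ContDiff ℝ ∞ g)
    (hgc : HasCompactSupport g) (hgz : ∀ x, g x ≠ 0 → ‖x‖ ≤ r) (hm1 : ∫ x, g x ^ 2 ≤ 1)
    (hm2 : 1 / 2 ≤ ∫ x, g x ^ 2) (h1 : kinetic (toC g) - bestConst * (∫ x, g x ^ 4) ≤ ε / 4) :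
    ∃ g : Space 2 → ℝ, IsTrial g r ∧ kinetic (toC g) + -bestConst * ∫ x, g x ^ 4 ≤ ε := by
  set m := ∫ x, g x ^ 2 with hm
  have hm0 : 0 < m := by linarith
  set c := √m⁻¹ with hc
  have hc2 : c ^ 2 = m⁻¹ := Real.sq_sqrt (by positivity)
  have hcH := (memH1_of_contDiff hgs hgc).1.const_mul_toC c
  refine ⟨fun x => c * g x, ⟨contDiff_const.mul hgs, hgc.mul_left, ?_, ?_⟩, ?_⟩
  · simp_rw [mul_pow]
    rw [integral_const_mul, hc2, ← hm, inv_mul_cancel₀ hm0.ne']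
  · intro x hx
    exact hgz x (right_ne_zero_of_mul hx)
  · have e4 : ∀ x, (c * g x) ^ 4 = (m⁻¹) ^ 2 * g x ^ 4 := fun x => by rw [mul_pow, ← hc2]; ring
    simp_rw [e4]
    rw [hcH.2, integral_const_mul, hc2]
    have hKg := kinetic_nonneg (toC g)
    have h2 : m * kinetic (toC g) - bestConst * (∫ x, g x ^ 4) ≤ ε / 4 := by
      have := mul_le_of_le_one_left hKg hm1
      linarith
    have h3 : m⁻¹ * kinetic (toC g) + -bestConst * ((m⁻¹) ^ 2 * ∫ x, g x ^ 4) =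
        (m⁻¹) ^ 2 * (m * kinetic (toC g) - bestConst * ∫ x, g x ^ 4) := by
      have h5 : (m⁻¹) ^ 2 * m = m⁻¹ := by rw [sq, mul_assoc, inv_mul_cancel₀ hm0.ne', mul_one]
      rw [mul_sub, ← mul_assoc (m⁻¹ ^ 2) m, h5]; ring
    rw [h3]
    have h6 : (m⁻¹) ^ 2 ≤ 4 := by
      have : m⁻¹ ≤ 2 := by
        rw [inv_le_comm₀ hm0 two_pos]; linarith
      have := pow_le_pow_left₀ (inv_pos.2 hm0).le this 2
      linarith
    calc _ ≤ (m⁻¹) ^ 2 * (ε / 4) := mul_le_mul_of_nonneg_left h2 (sq_nonneg _)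
      _ ≤ 4 * (ε / 4) := mul_le_mul_of_nonneg_right h6 (by positivity)
      _ = ε := by ring

/-- A nearly optimal function that is concentrated near the origin. -/
theorem exists_concentrated_at_zero {ρ e δ : ℝ} (hρ : 0 < ρ) (he0 : 0 < e) (he4 : e ≤ 1 / 4)
    (hδ0 : 0 < δ) : ∃ f χ : Space 2 → ℝ, ContDiff ℝ ∞ f ∧ HasCompactSupport f ∧
      ∫ x, f x ^ 2 = 1 ∧ kinetic (toC f) - bestConst * (∫ x, f x ^ 4) ≤ δ ∧ ContDiff ℝ ∞ χ ∧
      (∀ x, 0 ≤ χ x) ∧ (∀ x, χ x ≤ 1) ∧ (∀ x, 2 * ρ ≤ ‖x‖ → χ x = 0) ∧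
      1 - e ≤ ∫ x, χ x ^ 2 * f x ^ 2 := by
  obtain ⟨χ, hχs, hχc, hχ0, hχ1, hχz, hq0, hq⟩ := exists_window (ρ := ρ) (e := e)
    hρ he0 (by linarith)
  set q := ∫ x, χ x ^ 2 with hqdef
  set B := (1 + (e / 4)⁻¹) * kinetic (toC χ) with hB
  have hB0 : 0 ≤ B := mul_nonneg (by positivity) (kinetic_nonneg _)
  -- If every window missed more than the fraction e of the mass, (1 - e)(1 + e/4) ≤ 1 - 3e/4
  -- against 1 - e/2 would give (e/4) k q ≤ q δ + B. This `k` is too large for that.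
  set k := 4 / (e * q) * (2 * q * δ + B) + 1 with hk
  have hk0 : 0 < k := by positivity
  obtain ⟨f₀, R, hf₀, hf₀N, hf₀K⟩ := exists_concentrated hk0 hδ0
  have hf₀2 := (memLp_of_contDiff hf₀.smooth hf₀.compact 2).integrable_sq
  -- concentration
  obtain ⟨y, hy⟩ : ∃ y, 1 - e < ∫ x, f₀ x ^ 2 * χ (x - y) ^ 2 := by
    by_contra hcon
    push Not at hcon
    have h1 := bestConst_mul_le_of_spread hf₀.smooth hf₀.compact hf₀.mass hχs hχc
      (θ := e / 4) (by positivity) hcon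
    rw [← mul_assoc, hf₀N, ← hqdef, ← hB] at h1
    have h2 : k * ((1 - e / 2) * q) ≤ (1 - e) * ((1 + e / 4) * ((k + δ) * q) + B) := by
      refine (mul_le_mul_of_nonneg_left hq hk0.le).trans (h1.trans ?_)
      refine mul_le_mul_of_nonneg_left ?_ (by linarith)
      gcongr
    have h3 : (1 - e) * (1 + e / 4) ≤ 1 - 3 * e / 4 := by nlinarith
    have h4 : (1 - e) * ((1 + e / 4) * ((k + δ) * q) + B) ≤
        (1 - 3 * e / 4) * (k * q) + (q * δ + B) := by
      have h5 := mul_le_mul_of_nonneg_right h3 (show 0 ≤ (k + δ) * q by positivity)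
      have h6 : (1 - 3 * e / 4) * (δ * q) ≤ δ * q :=
        mul_le_of_le_one_left (by positivity) (by linarith)
      nlinarith [mul_nonneg he0.le hB0]
    have h7 : e * q * k = 4 * (2 * q * δ + B) + e * q := by
      rw [hk]; field_simp
    nlinarith [mul_pos hq0 hδ0, mul_pos he0 hq0]
  set f : Space 2 → ℝ := fun x => f₀ (x + y) with hf
  have hfs : ContDiff ℝ ∞ f := hf₀.smooth.comp (contDiff_id.add contDiff_const)
  have hfc : HasCompactSupport f := hf₀.compact.comp_homeomorph (Homeomorph.addRight y)
  have hfm : ∫ x, f x ^ 2 = 1 := by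
    rw [hf, integral_add_right_eq_self (fun x => f₀ x ^ 2)]; exact hf₀.mass
  have hfN : ∫ x, f x ^ 4 = ∫ x, f₀ x ^ 4 := integral_add_right_eq_self (fun x => f₀ x ^ 4) y
  have hfK : kinetic (toC f) ≤ k + δ :=
    ((memH1_of_contDiff hf₀.smooth hf₀.compact).1.comp_add y).2.trans hf₀K
  have hfχ : 1 - e ≤ ∫ x, χ x ^ 2 * f x ^ 2 := by
    rw [← integral_add_right_eq_self _ y] at hy
    refine hy.le.trans_eq ?_
    congr 1; ext x; simp only [hf, add_sub_cancel_right]; ring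
  exact ⟨f, χ, hfs, hfc, hfm, by rw [hfN, hf₀N]; linarith, hχs, hχ0, hχ1,
    fun x hx => hχz x (by linarith), hfχ⟩

/-- Near optimality in the Gagliardo–Nirenberg inequality, in absolute terms, is possible with
arbitrarily small supports. -/
theorem exists_isTrial_deficit_le {r ε : ℝ} (hr : 0 < r) (hε : 0 < ε) : ∃ g : Space 2 → ℝ,
    IsTrial g r ∧ kinetic (toC g) + -bestConst * ∫ x, g x ^ 4 ≤ ε := by
  have hb := bestConst_pos
  obtain ⟨C, hC0, hC⟩ := exists_integral_sq_le_two
  obtain ⟨χ₀, -, -, hχ₀s, hχ₀c, hχ₀0, hχ₀1, hχ₀one, hχ₀z, -⟩ := exists_cutoff (d := 2)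
  set η : Space 2 → ℝ := fun x => χ₀ ((2 / r) • x) with hη
  have hηs : ContDiff ℝ ∞ η := hχ₀s.comp (contDiff_const_smul _)
  have hηc : HasCompactSupport η :=
    hχ₀c.comp_homeomorph (Homeomorph.smulOfNeZero (2 / r) (by positivity))
  have hη1 : ∀ x, ‖x‖ ≤ r / 2 → η x = 1 := fun x hx => hχ₀one _ (by
    rw [norm_smul, Real.norm_of_nonneg (by positivity), div_mul_eq_mul_div, div_le_one hr]
    linarith)
  have hηz : ∀ x, r ≤ ‖x‖ → η x = 0 := fun x hx => hχ₀z _ (by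
    rw [norm_smul, Real.norm_of_nonneg (by positivity), div_mul_eq_mul_div, le_div_iff₀ hr]
    linarith)
  set s : Space 2 → ℝ := fun x => 1 - η x with hs
  have hss : ContDiff ℝ ∞ s := contDiff_const.sub hηs
  obtain ⟨L, hL⟩ := (hηc.fderiv ℝ).exists_bound_of_continuous (hηs.continuous_fderiv (by simp))
  have hsd : ∀ x, fderiv ℝ s x = -fderiv ℝ η x := fun x => by rw [hs, fderiv_const_sub]
  have hL0 : 0 ≤ L := (norm_nonneg _).trans (hL 0)
  set A := L ^ 2 * (12 + 8 * bestConst * C) with hA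
  have hA0 : 0 ≤ A := by positivity
  obtain ⟨e, he0, he4, heC, heA⟩ := exists_small_parameter
    (show 0 ≤ 32 * bestConst * C by positivity) hA0 (show 0 < ε / 8 by positivity)
  -- With ρ = r/4 the window lives within r/2, where η = 1 and s = 0; thus σ = 1 - χ² equals 1
  -- wherever s or its gradient is nonzero, and the mass seen by the cut is at most e. The deficit
  -- becomes at most ε/8 + e A ≤ ε/4, ready for normalization.
  obtain ⟨f, χ, hfs, hfc, hfm, hfd, hχs, hχ0, hχ1, hχz, hfχ⟩ := exists_concentrated_at_zero
    (ρ := r / 4) (δ := ε / 8) (by positivity) he0 he4 (by positivity)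
  have hf2 := (memLp_of_contDiff hfs hfc 2).integrable_sq
  set σ : Space 2 → ℝ := fun x => 1 - χ x ^ 2 with hσ
  have hχ2 : ∀ x, χ x ^ 2 ≤ 1 := fun x => pow_le_one₀ (hχ0 x) (hχ1 x)
  have hσone : ∀ x, r / 2 ≤ ‖x‖ → σ x = 1 := fun x hx => by
    simp [hσ, hχz x (by linarith)]
  have hχf : Integrable fun x => χ x ^ 2 * f x ^ 2 :=
    ((hχs.continuous.pow 2).mul (hfs.continuous.pow 2)).integrable_of_hasCompactSupport
      (hasCompactSupport_sq hfc).mul_left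
  have he : ∫ x, σ x * f x ^ 2 ≤ e := by
    have e1 : ∫ x, σ x * f x ^ 2 = 1 - ∫ x, χ x ^ 2 * f x ^ 2 := by
      rw [← hfm, ← integral_sub hf2 hχf]
      congr 1; ext x; simp only [hσ]; ring
    linarith
  have hs0 : ∀ x, 0 ≤ s x := fun x => sub_nonneg.2 (hχ₀1 _)
  have hs1 : ∀ x, s x ≤ 1 := fun x => sub_le_self _ (hχ₀0 _)
  have hsσ : ∀ x, s x ≠ 0 → σ x = 1 := fun x hx => hσone x (by
    by_contra hn
    exact hx (by simp [hs, hη1 x (not_le.1 hn).le]))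
  have hdσ : ∀ x, fderiv ℝ s x ≠ 0 → σ x = 1 := fun x hx => hσone x (by
    by_contra hn
    refine hx ?_
    have : s =ᶠ[𝓝 x] fun _ => 0 := by
      have hopen : IsOpen {z : Space 2 | ‖z‖ < r / 2} := isOpen_lt continuous_norm continuous_const
      filter_upwards [hopen.mem_nhds (not_le.1 hn)] with z hz
      simp [hs, hη1 z (le_of_lt hz)]
    rw [this.fderiv_eq]; simp)
  have hcut := cut_deficit_le hC0 hC hfs hfc hss hs0 hs1
    (fun x => by rw [hsd, norm_neg]; exact hL x) (continuous_const.sub (hχs.continuous.pow 2))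
    (fun x => sub_nonneg.2 (hχ2 x)) (fun x => sub_le_self _ (sq_nonneg _)) hsσ hdσ
    (by linarith) he heC
  set g : Space 2 → ℝ := fun x => (1 - s x ^ 2) * f x with hg
  have hgs : ContDiff ℝ ∞ g := (contDiff_const.sub (hss.pow 2)).mul hfs
  have hgc : HasCompactSupport g := hfc.mul_left
  have hg2 := (memLp_of_contDiff hgs hgc 2).integrable_sq
  set m := ∫ x, g x ^ 2 with hm
  have hm1 : m ≤ 1 := by
    rw [← hfm]
    refine integral_mono hg2 hf2 fun x => ?_
    simp only [hg, mul_pow]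
    have h1 := pow_le_one₀ (hs0 x) (hs1 x) (n := 2)
    exact mul_le_of_le_one_left (sq_nonneg _)
      (pow_le_one₀ (by linarith) (by linarith [sq_nonneg (s x)]))
  -- Since s² ≤ σ, the cut removes at most 2 ∫ σ f² ≤ 2e ≤ 1/2 of the unit mass.
  have hm2 : 1 / 2 ≤ m := by
    have i1 := integral_lin_two 1 (-2) hf2 (show Integrable fun x => σ x * f x ^ 2 from
      ((continuous_const.sub (hχs.continuous.pow 2)).mul
        (hfs.continuous.pow 2)).integrable_of_hasCompactSupport (hasCompactSupport_sq hfc).mul_left)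
    have h1 : ∫ x, (1 * f x ^ 2 + (-2) * (σ x * f x ^ 2)) ≤ m := by
      refine integral_mono i1.1 hg2 fun x => ?_
      simp only [hg, mul_pow]
      have h2 : s x ^ 2 ≤ σ x := by
        by_cases h : s x = 0
        · rw [h]; simpa [hσ] using hχ2 x
        · rw [hsσ x h]; exact pow_le_one₀ (hs0 x) (hs1 x)
      have h3 : 1 - 2 * σ x ≤ (1 - s x ^ 2) ^ 2 := by nlinarith [sq_nonneg (s x ^ 2)]
      nlinarith [mul_le_mul_of_nonneg_right h3 (sq_nonneg (f x))]
    rw [i1.2, hfm] at h1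
    linarith
  refine exists_isTrial_of_mass hε hgs hgc (fun x hx => ?_) hm1 hm2 (by linarith)
  by_contra hn
  exact hx (by simp [hg, hs, hηz x (not_le.1 hn).le])

end
end TwoComponentBEC

/-! ### Nonexistence of minimizers. -/

namespace TwoComponentBEC
noncomputable section
variable {d : ℕ} {Vu Vd : Space d → ℝ} {βuu βud βdd ν : ℝ} {u v : Space d → ℝ}

theorem adm_sqrt_mul {V : Space d → ℝ} (hV : LocallyIntegrable V volume) {m : ℝ} (hm : 0 ≤ m)
    {g : Space d → ℝ} (hg : ContDiff ℝ ∞ g) (hc : HasCompactSupport g) (h1 : ∫ x, g x ^ 2 = 1) :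
    Adm V m fun x => √m * g x := by
  refine ⟨((memH1_of_contDiff hg hc).1.const_mul_toC _).1, ?_, ?_⟩
  · refine ((integrable_mul_sq_of_contDiff hV hg.continuous hc).const_mul m).congr
      (Eventually.of_forall fun x => ?_)
    simp only [mul_pow, Real.sq_sqrt hm]
    ring
  · simp only [mul_pow, Real.sq_sqrt hm]
    rw [integral_const_mul, h1, mul_one]

theorem sqrt_mul_pow_four {m : ℝ} (hm : 0 ≤ m) (t : ℝ) : (√m * t) ^ 4 = m ^ 2 * t ^ 4 := by
  rw [mul_pow, show √m ^ 4 = (√m ^ 2) ^ 2 by ring, Real.sq_sqrt hm]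

theorem locallyIntegrable_add_const_mul_sq (hV : LocallyIntegrable Vu volume)
    (hv : MemLp v 2 volume) (β : ℝ) : LocallyIntegrable (fun x => Vu x + β * v x ^ 2) volume :=
  hV.add (hv.integrable_sq.const_mul β).locallyIntegrable

theorem integral_effective (β : ℝ) {f : Space d → ℝ} (hf : Integrable fun x => Vu x * f x ^ 2)
    (hfv : Integrable fun x => f x ^ 2 * v x ^ 2) :
    Integrable (fun x => (Vu x + β * v x ^ 2) * f x ^ 2) ∧
    ∫ x, (Vu x + β * v x ^ 2) * f x ^ 2 =
      (∫ x, Vu x * f x ^ 2) + β * ∫ x, f x ^ 2 * v x ^ 2 := by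
  have h := integral_lin_two 1 β hf hfv
  have e : (fun x => (Vu x + β * v x ^ 2) * f x ^ 2) =
      fun x => 1 * (Vu x * f x ^ 2) + β * (f x ^ 2 * v x ^ 2) := by ext x; ring
  rw [e]
  exact ⟨h.1, by rw [h.2, one_mul]⟩

/-- Varying only the first component of a minimizer. -/
theorem IsMin.lowerBound_fst (hd1 : 1 ≤ d) (hd3 : d ≤ 3) (hν : 0 < ν)
    (hVu : LocallyIntegrable Vu volume) (h : IsMin Vu Vd βuu βud βdd ν u v) :
    LowerBound (fun x => Vu x + βud * v x ^ 2) (ν * βuu)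
      (((1 / 2) * kinetic (toC u) + (1 / 2) * βuu * (∫ x, u x ^ 4) +
        ∫ x, (Vu x + βud * v x ^ 2) * u x ^ 2) / ν) := by
  intro g hg hc h1
  have pu := h.admu.memH1.memLp_sq hd1 hd3
  have pv := h.admv.memH1.memLp_sq hd1 hd3
  have pg := (memH1_of_contDiff hg hc).1.memLp_sq hd1 hd3
  have h2 := h.le _ _ (adm_sqrt_mul hVu hν.le hg hc h1) h.admv
  unfold realEnergy at h2
  simp_rw [sqrt_mul_pow_four hν.le, mul_pow, Real.sq_sqrt hν.le, mul_left_comm _ ν, mul_assoc ν,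
    integral_const_mul] at h2
  rw [((memH1_of_contDiff hg hc).1.const_mul_toC _).2, Real.sq_sqrt hν.le] at h2
  rw [(integral_effective βud h.admu.pot (integrable_mul_of_memLp_two pu pv)).2,
    (integral_effective βud (integrable_mul_sq_of_contDiff hVu hg.continuous hc)
      (integrable_mul_of_memLp_two pg pv)).2, div_le_iff₀ hν]
  linarith

/-- Varying both components of a minimizer simultaneously. -/
theorem IsMin.lowerBound_both (hν : ν ∈ Set.Ioo (0 : ℝ) 1)
    (hVu : LocallyIntegrable Vu volume) (hVd : LocallyIntegrable Vd volume)
    (h : IsMin Vu Vd βuu βud βdd ν u v) :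
    LowerBound (fun x => ν * Vu x + (1 - ν) * Vd x)
      (ν ^ 2 * βuu + 2 * (ν * (1 - ν)) * βud + (1 - ν) ^ 2 * βdd)
      (realEnergy Vu Vd βuu βud βdd u v) := by
  intro g hg hc h1
  have hμ : 0 ≤ 1 - ν := (sub_pos.2 hν.2).le
  refine (h.le _ _ (adm_sqrt_mul hVu hν.1.le hg hc h1) (adm_sqrt_mul hVd hμ hg hc h1)).trans ?_
  unfold realEnergy
  have e : ∀ x, (√ν * g x) ^ 2 * (√(1 - ν) * g x) ^ 2 = ν * (1 - ν) * g x ^ 4 := fun x => by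
    rw [mul_pow, mul_pow, Real.sq_sqrt hν.1.le, Real.sq_sqrt hμ]; ring
  simp_rw [e, sqrt_mul_pow_four hν.1.le, sqrt_mul_pow_four hμ, mul_pow, Real.sq_sqrt hν.1.le,
    Real.sq_sqrt hμ, mul_left_comm _ ν, mul_left_comm _ (1 - ν), integral_const_mul]
  rw [((memH1_of_contDiff hg hc).1.const_mul_toC _).2, Real.sq_sqrt hν.1.le,
    ((memH1_of_contDiff hg hc).1.const_mul_toC _).2, Real.sq_sqrt hμ]
  have hl := integral_lin_two ν (1 - ν) (integrable_mul_sq_of_contDiff hVu hg.continuous hc)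
    (integrable_mul_sq_of_contDiff hVd hg.continuous hc)
  have e2 : ∫ x, (ν * Vu x + (1 - ν) * Vd x) * g x ^ 2 =
      ν * (∫ x, Vu x * g x ^ 2) + (1 - ν) * ∫ x, Vd x * g x ^ 2 := by
    rw [← hl.2]; congr 1; ext x; ring
  rw [e2]
  linarith

/-- An optimizer of the Gagliardo–Nirenberg inequality is positive almost everywhere. -/
theorem ae_pos_of_optimizer {f : Space 2 → ℝ} (hf : MemH1 (toC f)) (hf0 : ∀ x, 0 ≤ f x)
    (hm : 0 < ∫ x, f x ^ 2)
    (hopt : kinetic (toC f) * (∫ x, f x ^ 2) ≤ bestConst * ∫ x, f x ^ 4) : ∀ᵐ x, 0 < f x := by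
  have hf2 := memLp_of_toC hf.1
  refine (ae_eq_zero_or_ae_pos hf hf0 fun η hη hc => ?_).resolve_left fun h => hm.ne'
    ((integral_sq_eq_zero_iff hf2).2 h)
  have hηH := (memH1_of_contDiff hη hc).1
  have hη2 := memLp_of_contDiff hη hc 2
  -- Replacing f by g = √(f² + ε² η²) does not lower the quartic integral, so optimality of f and
  -- the sharp inequality for g give (K(f) - K(g)) ∫ f² ≤ ε² K(g) ∫ η², with K(g) ≤ K(f) + K(η).
  refine ⟨(kinetic (toC f) + kinetic (toC η)) * (∫ x, η x ^ 2) / ∫ x, f x ^ 2, fun ε hε hε1 => ?_⟩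
  have hg := hf.sqrt_combo hηH (a := 1) (b := ε ^ 2) zero_le_one (sq_nonneg ε)
  set g : Space 2 → ℝ := fun x => √(1 * f x ^ 2 + ε ^ 2 * η x ^ 2) with hgdef
  have hsq : ∀ x, g x ^ 2 = 1 * f x ^ 2 + ε ^ 2 * η x ^ 2 := fun x => Real.sq_sqrt (by positivity)
  have hgm : ∫ x, g x ^ 2 = (∫ x, f x ^ 2) + ε ^ 2 * ∫ x, η x ^ 2 := by
    simp_rw [hsq]
    rw [(integral_lin_two 1 (ε ^ 2) hf2.integrable_sq hη2.integrable_sq).2, one_mul]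
  have hN : ∫ x, f x ^ 4 ≤ ∫ x, g x ^ 4 := by
    refine integral_mono (integrable_four (hf.memLp_sq (by norm_num) (by norm_num)))
      (integrable_four (hg.1.memLp_sq (by norm_num) (by norm_num))) fun x => ?_
    have h1 : f x ^ 2 ≤ g x ^ 2 := by rw [hsq]; nlinarith [sq_nonneg (ε * η x)]
    have := pow_le_pow_left₀ (sq_nonneg _) h1 2
    simp only
    linarith
  have hGN := bestConst_mul_le hg.1
  rw [hgm] at hGN
  have h1 := mul_le_mul_of_nonneg_left hN bestConst_pos.le
  have hq : 0 ≤ ∫ x, η x ^ 2 := integral_nonneg fun x => sq_nonneg _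
  have hε2 : ε ^ 2 ≤ 1 := pow_le_one₀ hε.le hε1
  have hK : kinetic (toC g) ≤ kinetic (toC f) + kinetic (toC η) := by
    have := mul_le_of_le_one_left (kinetic_nonneg (toC η)) hε2
    linarith [hg.2]
  rw [div_mul_eq_mul_div, le_div_iff₀ hm]
  have h2 := mul_le_mul_of_nonneg_right hK (show 0 ≤ ε ^ 2 * ∫ x, η x ^ 2 by positivity)
  linarith

/-- A potential that diverges at infinity is not compensated by an integrable function. -/
theorem not_ae_const (hd : 1 ≤ d) (hV : Tendsto Vu (cocompact (Space d)) atTop)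
    {w : Space d → ℝ} (hw : Integrable w) (m : ℝ) : ¬ ∀ᵐ x, Vu x + w x = m := by
  intro h
  have : Nonempty (Fin d) := ⟨⟨0, hd⟩⟩
  have : NoncompactSpace (Space d) := NormedSpace.noncompactSpace ℝ _
  have hev := hV.eventually (eventually_ge_atTop (m + 1))
  obtain ⟨K, hK, hKV⟩ := mem_cocompact.1 hev
  have h1 : ∀ᵐ x, x ∈ Kᶜ → 1 ≤ ‖w x‖ := h.mono fun x hx hxK => by
    have : m + 1 ≤ Vu x := hKV hxK
    rw [Real.norm_eq_abs]
    exact (by linarith : (1 : ℝ) ≤ -w x).trans (neg_le_abs _)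
  -- Outside a compact set |w| would be at least 1, which an integrable function allows only on a
  -- set of finite measure; the whole space would have finite measure.
  have h2 : volume Kᶜ ≤ volume {x | 1 ≤ ‖w x‖} := measure_mono_ae h1
  have h3 := hw.measure_norm_ge_lt_top one_pos
  have h4 : volume (Set.univ : Set (Space d)) < ⊤ := by
    rw [← Set.union_compl_self K]
    exact (measure_union_le _ _).trans_lt
      (ENNReal.add_lt_top.2 ⟨hK.measure_lt_top, h2.trans_lt h3⟩)
  rw [measure_univ_of_isAddLeftInvariant] at h4
  exact lt_irrefl _ h4

/-- In the plane no minimizer exists at the critical strength. -/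
theorem IsMin.ne_critical {Vu Vd : Space 2 → ℝ} {u v : Space 2 → ℝ} (hν : 0 < ν)
    (hVu : LocallyIntegrable Vu volume) (hlim : Tendsto Vu (cocompact (Space 2)) atTop)
    (h : IsMin Vu Vd βuu βud βdd ν u v) (hu0 : ∀ x, 0 ≤ u x) : ν * βuu ≠ -bestConst := by
  intro hcrit
  have hL := h.lowerBound_fst (by norm_num) (by norm_num) hν hVu
  rw [hcrit] at hL
  have hv := h.admv.memLp
  have hW := locallyIntegrable_add_const_mul_sq hVu hv βud
  -- Zero-cost concentration at the critical strength gives W ≥ w0/ν almost everywhere, where w0 is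
  -- the part of the energy of the minimizer that depends on `u`.
  have hae := hL.ae_le hW fun r ε hr hε => exists_isTrial_deficit_le hr hε
  have pu := h.admu.memH1.memLp_sq (by norm_num) (by norm_num)
  have pv := h.admv.memH1.memLp_sq (by norm_num) (by norm_num)
  have hWu := (integral_effective βud h.admu.pot (integrable_mul_of_memLp_two pu pv)).1
  have hGN := bestConst_mul_le h.admu.memH1
  rw [h.admu.mass] at hGN
  have hu2 := h.admu.memLp.integrable_sq
  set W : Space 2 → ℝ := fun x => Vu x + βud * v x ^ 2 with hWdef
  set w0 := (1 / 2) * kinetic (toC u) + (1 / 2) * βuu * (∫ x, u x ^ 4) + ∫ x, W x * u x ^ 2 with hw0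
  have hl := integral_lin_two 1 (-(w0 / ν)) hWu hu2
  have hnn : 0 ≤ᵐ[volume] fun x => 1 * (W x * u x ^ 2) + -(w0 / ν) * u x ^ 2 :=
    hae.mono fun x hx => by
      have := mul_nonneg (sub_nonneg.2 hx) (sq_nonneg (u x))
      simp only [Pi.zero_apply]
      linarith
  have hI0 := integral_nonneg_of_ae hnn
  rw [hl.2, h.admu.mass, neg_mul, div_mul_cancel₀ _ hν.ne'] at hI0
  have hβN : ν * (βuu * ∫ x, u x ^ 4) = -(bestConst * ∫ x, u x ^ 4) := by
    rw [← mul_assoc, hcrit]; ring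
  -- The pointwise bound integrates to ∫ W u² ≥ w0, hence this sum is at most 0, while the sharp
  -- inequality makes it nonnegative. Both are equalities: u is an optimizer, hence positive, and W
  -- = w0/ν wherever u is positive.
  have hKN : 0 ≤ kinetic (toC u) + βuu * ∫ x, u x ^ 4 := by
    refine nonneg_of_mul_nonneg_right (a := ν) ?_ hν
    rw [mul_add, hβN]; linarith
  have hKN' : kinetic (toC u) + βuu * (∫ x, u x ^ 4) = 0 := by linarith
  have hpos := ae_pos_of_optimizer h.admu.memH1 hu0 (by rw [h.admu.mass]; exact hν) (by
    rw [h.admu.mass, show kinetic (toC u) = -(βuu * ∫ x, u x ^ 4) by linarith]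
    linarith)
  have hzero : ∫ x, (1 * (W x * u x ^ 2) + -(w0 / ν) * u x ^ 2) = 0 := by
    rw [hl.2, h.admu.mass, neg_mul, div_mul_cancel₀ _ hν.ne']
    linarith
  rw [integral_eq_zero_iff_of_nonneg_ae hnn hl.1] at hzero
  refine not_ae_const (by norm_num) hlim (hv.integrable_sq.const_mul βud) (w0 / ν) ?_
  filter_upwards [hzero, hpos] with x hx hux
  simp only [Pi.zero_apply] at hx
  have h1 : (W x - w0 / ν) * u x ^ 2 = 0 := by linarith
  have := (mul_eq_zero.1 h1).resolve_right (by positivity)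
  simp only [hWdef] at this
  linarith

theorem IsMin.fst_gt_of_two {Vu Vd : Space 2 → ℝ} {u v : Space 2 → ℝ} (hν : 0 < ν)
    (hVu : LocallyIntegrable Vu volume) (hlim : Tendsto Vu (cocompact (Space 2)) atTop)
    (h : IsMin Vu Vd βuu βud βdd ν u v) (hu0 : ∀ x, 0 ≤ u x) : -bestConst < ν * βuu :=
  lt_of_le_of_ne ((h.lowerBound_fst (by norm_num) (by norm_num) hν hVu).ge_of_two
    (locallyIntegrable_add_const_mul_sq hVu h.admv.memLp βud)) (h.ne_critical hν hVu hlim hu0).symm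

theorem IsMin.fst_nonneg_of_three {Vu Vd : Space 3 → ℝ} {u v : Space 3 → ℝ} (hν : 0 < ν)
    (hVu : LocallyIntegrable Vu volume) (h : IsMin Vu Vd βuu βud βdd ν u v) : 0 ≤ βuu :=
  nonneg_of_mul_nonneg_right ((h.lowerBound_fst (by norm_num) (by norm_num) hν hVu).nonneg_of_three
    (locallyIntegrable_add_const_mul_sq hVu h.admv.memLp βud)) hν

theorem locallyIntegrable_combo (hVu : LocallyIntegrable Vu volume)
    (hVd : LocallyIntegrable Vd volume) (a b : ℝ) :
    LocallyIntegrable (fun x => a * Vu x + b * Vd x) volume :=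
  (hVu.smul a).add (hVd.smul b)

/-- Minimizers exclude the nonexistence regime. -/
theorem IsMin.not_nonexistenceCondition (hν : ν ∈ Set.Ioo (0 : ℝ) 1)
    (hVu : LocallyIntegrable Vu volume) (hVd : LocallyIntegrable Vd volume)
    (hVu_lim : Tendsto Vu (cocompact (Space d)) atTop)
    (hVd_lim : Tendsto Vd (cocompact (Space d)) atTop)
    (h : IsMin Vu Vd βuu βud βdd ν u v) (hu0 : ∀ x, 0 ≤ u x) (hv0 : ∀ x, 0 ≤ v x) :
    ¬ NonexistenceCondition d βuu βud βdd ν := by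
  have hμ : 0 < 1 - ν := sub_pos.2 hν.2
  have hp : 0 < ν * (1 - ν) := mul_pos hν.1 hμ
  have hW := locallyIntegrable_combo hVu hVd ν (1 - ν)
  have hB := h.lowerBound_both hν hVu hVd
  rintro (⟨rfl, h1 | h1 | h1⟩ | ⟨rfl, h1 | h1 | h1⟩)
  · exact (h.fst_gt_of_two hν.1 hVu hVu_lim hu0).not_ge h1
  · exact (h.swap.fst_gt_of_two hμ hVd hVd_lim hv0).not_ge h1
  -- Multiplied by 2√(ν(1-ν)), the condition says that the effective strength of a common profile
  -- lies below -bestConst.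
  · have h2 := hB.ge_of_two hW
    have h3 := mul_lt_mul_of_pos_left h1 (show 0 < 2 * √(ν * (1 - ν)) by positivity)
    have h4 : 2 * √(ν * (1 - ν)) * (√(ν * (1 - ν)) * βud) = 2 * (ν * (1 - ν)) * βud := by
      rw [← mul_assoc, mul_assoc 2, Real.mul_self_sqrt hp.le]
    have h5 : 2 * √(ν * (1 - ν)) * -(1 / (2 * √(ν * (1 - ν)))) = -1 := by
      rw [mul_neg, mul_one_div_cancel (by positivity)]
    rw [h4, ← mul_assoc _ (-(1 / _)), h5] at h3
    linarith
  · exact (h.fst_nonneg_of_three hν.1 hVu).not_gt h1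
  · exact (h.swap.fst_nonneg_of_three hμ hVd).not_gt h1
  · have h2 := hB.nonneg_of_three hW
    have h3 := mul_lt_mul_of_pos_left h1 (show 0 < 2 * (ν * (1 - ν)) by positivity)
    have h5 : 2 * (ν * (1 - ν)) * -(1 / (2 * (ν * (1 - ν)))) = -1 := by
      rw [mul_neg, mul_one_div_cancel (by positivity)]
    rw [← mul_assoc _ (-(1 / _)), h5] at h3
    linarith

end
end TwoComponentBEC

/-! ### Assembling the theorem; the conditions themselves fix the dimension. -/

namespace TwoComponentBEC
noncomputable section
variable {d : ℕ} {Vu Vd : Space d → ℝ} {βuu βud βdd ν : ℝ}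

theorem form_nonneg_of_posSemidef (hB : (interactionMatrix βuu βud βdd).PosSemidef) (a b : ℝ) :
    0 ≤ βuu * a ^ 2 + 2 * βud * (a * b) + βdd * b ^ 2 := by
  have h := hB.dotProduct_mulVec_nonneg ![a, b]
  simp only [interactionMatrix, dotProduct, Matrix.mulVec, Fin.sum_univ_two, Matrix.of_apply,
    Matrix.cons_val_zero, Matrix.cons_val_one, Pi.star_apply, star_trivial, Matrix.cons_val',
    Matrix.cons_val_fin_one] at h
  linarith

theorem ExistenceCondition.dim (h : ExistenceCondition d βuu βud βdd ν) : 1 ≤ d ∧ d ≤ 3 := by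
  rcases h with h | ⟨h, -⟩ | ⟨h, -⟩ <;> omega

theorem NonexistenceCondition.dim (h : NonexistenceCondition d βuu βud βdd ν) :
    1 ≤ d ∧ d ≤ 3 := by
  rcases h with ⟨h, -⟩ | ⟨h, -⟩ <;> omega

theorem ExistenceCondition.quartic_bound (h : ExistenceCondition d βuu βud βdd ν)
    (hVu : ∀ x, 0 ≤ Vu x) (hVd : ∀ x, 0 ≤ Vd x) (hν : ν ∈ Set.Ioo (0 : ℝ) 1) (M : ℝ) :
    ∃ C : ℝ, ∀ u v, Adm Vu ν u → Adm Vd (1 - ν) v →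
      realEnergy Vu Vd βuu βud βdd u v ≤ M → ∫ x, u x ^ 4 ≤ C ∧ ∫ x, v x ^ 4 ≤ C := by
  rcases h with h | ⟨rfl, huu, hdd, hud, hlast⟩ | ⟨h, hB⟩
  · exact quartic_bound_one h hVu hVd hν M
  · exact quartic_bound_two hVu hVd hν huu hdd hud hlast M
  · refine quartic_bound_three h hVu hVd hν (fun a b ha hb => ?_) M
    rcases hB with hB | ⟨h1, h2, h3⟩
    · exact form_nonneg_of_posSemidef hB a b
    · positivity

end
end TwoComponentBEC

theorem mainTheorem2 (d : ℕ) (Vu Vd : TwoComponentBEC.Space d → ℝ)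
    (hVu_int : LocallyIntegrable Vu volume) (hVd_int : LocallyIntegrable Vd volume)
    (hVu_nonneg : ∀ x, 0 ≤ Vu x) (hVd_nonneg : ∀ x, 0 ≤ Vd x)
    (hVu_lim : Tendsto Vu (cocompact (TwoComponentBEC.Space d)) atTop)
    (hVd_lim : Tendsto Vd (cocompact (TwoComponentBEC.Space d)) atTop)
    (βuu βud βdd ν : ℝ) (hν : ν ∈ Set.Ioo (0 : ℝ) 1) :
    (TwoComponentBEC.ExistenceCondition d βuu βud βdd ν →
      (∃ Φ, TwoComponentBEC.IsGroundState Vu Vd βuu βud βdd ν Φ) ∧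
      (∀ Φ, TwoComponentBEC.IsGroundState Vu Vd βuu βud βdd ν Φ → ∀ θu θd : ℝ,
        TwoComponentBEC.IsGroundState Vu Vd βuu βud βdd ν
          (TwoComponentBEC.phaseModulus θu θd Φ)) ∧
      ((TwoComponentBEC.interactionMatrix βuu βud βdd).PosSemidef →
        ∀ Φ Ψ, TwoComponentBEC.IsGroundState Vu Vd βuu βud βdd ν Φ →
          TwoComponentBEC.IsGroundState Vu Vd βuu βud βdd ν Ψ →
          (fun x => ‖Φ.1 x‖) =ᵐ[volume] (fun x => ‖Ψ.1 x‖) ∧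
          (fun x => ‖Φ.2 x‖) =ᵐ[volume] (fun x => ‖Ψ.2 x‖))) ∧
    (TwoComponentBEC.NonexistenceCondition d βuu βud βdd ν →
      ¬ ∃ Φ, TwoComponentBEC.IsGroundState Vu Vd βuu βud βdd ν Φ) := by
  open TwoComponentBEC in
  refine ⟨fun hE => ?_, fun hN => ?_⟩
  · have hd := hE.dim
    have hd1 := hd.1
    have hd3 := hd.2
    refine ⟨?_, fun Φ hΦ θu θd => ?_, fun hB Φ Ψ hΦ hΨ => ?_⟩
    · obtain ⟨u, v, huv⟩ := exists_isMin hd1 hd3 hVu_int hVd_int hVu_nonneg hVd_nonneg hVu_lim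
        hVd_lim hν fun M => hE.quartic_bound hVu_nonneg hVd_nonneg hν M
      exact ⟨_, isGroundState_of_isMin hd1 hd3 huv (a := 1) (b := 1) (by simp) (by simp)⟩
    · exact isGroundState_of_isMin hd1 hd3 (isMin_norm_of_isGroundState hd1 hd3 hΦ)
        (Complex.norm_exp_ofReal_mul_I θu) (Complex.norm_exp_ofReal_mul_I θd)
    · exact (isMin_norm_of_isGroundState hd1 hd3 hΦ).unique hd1 hd3 hν hVu_int hVd_int
        (form_nonneg_of_posSemidef hB) (isMin_norm_of_isGroundState hd1 hd3 hΨ)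
        (fun x => norm_nonneg _) (fun x => norm_nonneg _) (fun x => norm_nonneg _)
        (fun x => norm_nonneg _)
  · rintro ⟨Φ, hΦ⟩
    have hd := hN.dim
    exact (isMin_norm_of_isGroundState hd.1 hd.2 hΦ).not_nonexistenceCondition hν hVu_int
      hVd_int hVu_lim hVd_lim (fun x => norm_nonneg _) (fun x => norm_nonneg _) hN
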